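/- Setting. Let $\mathcal S,\mathcal A$ be measurable spaces (not necessarily finite) and $H,d,L\ge 0$ integers. A time-inhomogeneous linear mixture MDP has a known initial distribution $\rho$ on $\mathcal S$, known measurable mean rewards $R(h,s,a)\in[0,1]$ for $0\le h\le H-1$, and a known feature mapping $\phi(s'\mid x)\in\mathbb R^d$, measurable in $(s',x)$, for $x=(h,s,a)$. Sums over $s'$ are sums if $\mathcal S$ is countable, and in general integrals against a reference ($s$-finite, measurably varying) measure $\nu_x$ on $\mathcal S$, with respect to which $\phi(\cdot\mid x)$ is integrable. A parameter $\Theta=(\theta_0,\dots,\theta_{H-1})$, $\theta_h\in\mathbb R^d$, is proper if for every $x=(h,s,a)$ the function $s'\mapsto\langle\theta_h,\phi(s'\mid x)\rangle$ is a probability density (nonnegative with sum, or integral, equal to $1$); it then defines the MDP $M(\Theta)$ with transition kernel $P(\cdot\mid h,s,a)=\langle\theta_h,\phi(\cdot\mid h,s,a)\rangle$. For a deterministic measurable policy $\pi=(\pi_h)_{h<H}$, $\pi_h:\mathcal S\to\mathcal A$, let $\bar V^{M(\Theta)}_\pi=\mathbb E\big[\sum_{h=0}^{H-1}R(h,s_h,a_h)\big]$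 with $s_0\sim\rho$, $a_h=\pi_h(s_h)$, $s_{h+1}\sim P(\cdot\mid h,s_h,a_h)$; $\pi$ is optimal for $M(\Theta)$ if it maximizes $\bar V^{M(\Theta)}_\pi$ over all such policies. The true parameter $\Theta^*=(\theta^*_0,\dots,\theta^*_{H-1})$ is random with a prior distribution under which it is almost surely proper and $\mathbb E\|\theta_h^*\|_2^2<\infty$ for all $h$. Fix a selection $\Theta\mapsto\pi^{M(\Theta)}$ of policies, such that $(\Theta,s)\mapsto\pi^{M(\Theta)}_h(s)$ is measurable for every $h$, which is optimal for $M(\Theta)$ for almost every $\Theta$ under the prior. In each episode $\ell=1,\dots,L$, PSRL draws $\hat\Theta_\ell$ from the posterior $\mathbb P(\Theta^*\in\cdot\mid D_\ell)$, where $D_\ell$ consists of the trajectories $(s_0,a_0,\dots,s_{H-1},a_{H-1},s_H)$ of all previous episodes (the draw being independent of $\Theta^*$ given $D_\ell$), and runs the policy $\pi_\ell=\pi^{M(\hat\Theta_\ell)}$ in $M(\Theta^*)$. Its Bayesian regret is $$\mathfrak{BR}(L)=\mathbb E\Big[\sum_{\ell=1}^L\Big(\bar V^{M(\Theta^*)}_{\pi^{M(\Theta^*)}}-\bar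 V^{M(\Theta^*)}_{\pi_\ell}\Big)\Big].$$ Theorem. Suppose that 1. for every measurable $V:\mathcal S\to[0,1]$ and every $x=(h,s,a)$, the vector $\phi_V(x)=\sum_{s'}\phi(s'\mid x)V(s')$ satisfies $\|\phi_V(x)\|_2\le 1$; 2. $\theta^*_0,\dots,\theta^*_{H-1}$ are mutually independent under the prior. Then, with $\Gamma_{1,h}\in\mathbb R^{d\times d}$ the covariance matrix of $\theta^*_h$ under the prior and $I$ the identity matrix, $$\mathfrak{BR}(L)\le\sqrt{2dH^3L\sum_{h=0}^{H-1}\log\det\big(I+L\,\Gamma_{1,h}\big)} .$$ -/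

import Mathlib

open MeasureTheory ProbabilityTheory

noncomputable section

namespace LinearMixture

/-- Parameters `Θ = (θ_0, …, θ_{H-1})` with `θ_h ∈ ℝ^d` (Euclidean norm). -/
abbrev Param (H d : ℕ) : Type := Fin H → EuclideanSpace ℝ (Fin d)

/-- Observations up to stage `h` of one episode: `(s_0, a_0, …, s_{h-1}, a_{h-1}, s_h)`. -/
abbrev Obs (S A : Type*) (h : ℕ) : Type _ := (Fin h → S × A) × S

/-- The observations up to stage `h + 1`: append the action `a_h` and the next state `s_{h+1}`. -/
def Obs.extend {S A : Type*} {h : ℕ} (o : Obs S A h) (a : A) (s' : S) : Obs S A (h + 1) :=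
  (Fin.snoc (α := fun _ => S × A) o.1 (o.2, a), s')

/-- Observational history before an episode that is preceded by `ℓ` complete episodes. -/
abbrev Hist (S A : Type*) (H ℓ : ℕ) : Type _ := Fin ℓ → Obs S A H

/-- The known part of a time-inhomogeneous linear mixture MDP with horizon `H` and feature
dimension `d`: initial distribution `ρ`, mean rewards `R(h, s, a) ∈ [0, 1]`, and the feature mapping
`φ(s' | h, s, a) ∈ ℝ^d`. Sums over the next state `s'` are integrals against a reference measure
`ν(h, s, a)` on the state space (the counting measure for a countable state space; the reference
measure may be, but need not be, the same for all `(h, s, a)`). -/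
structure Model (S A : Type*) [MeasurableSpace S] [MeasurableSpace A] (H d : ℕ) where
  ρ : Measure S
  isProbabilityMeasure_ρ : IsProbabilityMeasure ρ
  R : Fin H → S × A → ℝ
  measurable_R : ∀ h, Measurable (R h)
  R_mem : ∀ h x, R h x ∈ Set.Icc (0 : ℝ) 1
  ν : Fin H → Kernel (S × A) S
  isSFiniteKernel_ν : ∀ h, IsSFiniteKernel (ν h)
  φ : Fin H → S × A → S → EuclideanSpace ℝ (Fin d)
  measurable_φ : ∀ h, Measurable fun p : (S × A) × S => φ h p.1 p.2
  integrable_φ : ∀ h x, Integrable (φ h x) (ν h x)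

variable {S A : Type*} [MeasurableSpace S] [MeasurableSpace A] {H d : ℕ}

namespace Model

instance (M : Model S A H d) : IsProbabilityMeasure M.ρ := M.isProbabilityMeasure_ρ

instance (M : Model S A H d) (h : Fin H) : IsSFiniteKernel (M.ν h) := M.isSFiniteKernel_ν h

/-- Value-correlated feature `φ_V(h, s, a) = ∑_{s'} V(s') φ(s' | h, s, a)`. -/
def valueFeature (M : Model S A H d) (V : S → ℝ) (h : Fin H) (x : S × A) :
    EuclideanSpace ℝ (Fin d) :=
  ∫ s', V s' • M.φ h x s' ∂(M.ν h x)

/-- `‖φ_V(x)‖₂ ≤ 1` for every (measurable) `V : S → [0, 1]` and every `x = (h, s, a)`. -/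
def BoundedFeatures (M : Model S A H d) : Prop :=
  ∀ V : S → ℝ, Measurable V → (∀ s, V s ∈ Set.Icc (0 : ℝ) 1) →
    ∀ (h : Fin H) (x : S × A), ‖M.valueFeature V h x‖ ≤ 1

/-- `Θ` induces a proper transition kernel: `⟨θ_h, φ(· | h, s, a)⟩` is a probability density
for every `(h, s, a)`. -/
def IsProper (M : Model S A H d) (Θ : Param H d) : Prop :=
  ∀ (h : Fin H) (x : S × A),
    (∀ᵐ s' ∂(M.ν h x), 0 ≤ inner ℝ (Θ h) (M.φ h x s')) ∧
      ∫ s', inner ℝ (Θ h) (M.φ h x s') ∂(M.ν h x) = 1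

/-- The kernel `(Θ, (s, a)) ↦ ⟨θ_h, φ(· | h, s, a)⟩` (with the positive part of the density). -/
def mixture (M : Model S A H d) (h : Fin H) : Kernel (Param H d × (S × A)) S :=
  Kernel.withDensity (Kernel.prodMkLeft (Param H d) (M.ν h))
    fun p s' => ENNReal.ofReal (inner ℝ (p.1 h) (M.φ h p.2 s'))

lemma measurable_density (M : Model S A H d) (h : Fin H) :
    Measurable (Function.uncurry fun (p : Param H d × (S × A)) s' =>
      ENNReal.ofReal (inner ℝ (p.1 h) (M.φ h p.2 s'))) := by
  refine ENNReal.measurable_ofReal.comp ?_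
  refine Measurable.inner (𝕜 := ℝ) ?_ ?_
  · exact (measurable_pi_apply h).comp (measurable_fst.comp measurable_fst)
  · exact (M.measurable_φ h).comp
      ((measurable_snd.comp measurable_fst).prodMk measurable_snd)

lemma measurableSet_mixture_univ (M : Model S A H d) (h : Fin H) :
    MeasurableSet {p : Param H d × (S × A) | M.mixture h p Set.univ = 1} :=
  (M.mixture h).measurable_coe MeasurableSet.univ (measurableSet_singleton 1)

open Classical in
/-- The transition kernel of stage `h` of the MDP `M(Θ)`, as a kernel in `(Θ, (s, a))`. For proper
`Θ` it is `⟨θ_h, φ(· | h, s, a)⟩`, see `transition_of_isProper`. Where the mixture is not a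
probability measure, an arbitrary default (here `ρ`) is used, so that it is always a Markov
kernel. -/
def transition (M : Model S A H d) (h : Fin H) : Kernel (Param H d × (S × A)) S :=
  Kernel.piecewise (M.measurableSet_mixture_univ h) (M.mixture h) (Kernel.const _ M.ρ)

instance (M : Model S A H d) (h : Fin H) : IsMarkovKernel (M.transition h) := by
  refine ⟨fun p => ⟨?_⟩⟩
  rw [transition, Kernel.piecewise_apply]
  split_ifs with hp
  · exact hp
  · simp

lemma transition_of_isProper (M : Model S A H d) {Θ : Param H d} (hΘ : M.IsProper Θ)
    (h : Fin H) (x : S × A) :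
    M.transition h (Θ, x) =
      (M.ν h x).withDensity fun s' => ENNReal.ofReal (inner ℝ (Θ h) (M.φ h x s')) := by
  have e : M.mixture h (Θ, x) =
      (M.ν h x).withDensity fun s' => ENNReal.ofReal (inner ℝ (Θ h) (M.φ h x s')) := by
    rw [mixture, Kernel.withDensity_apply _ (M.measurable_density h), Kernel.prodMkLeft_apply]
  have hi : Integrable (fun s' => (inner ℝ (Θ h) (M.φ h x s') : ℝ)) (M.ν h x) :=
    (M.integrable_φ h x).const_inner (Θ h)
  rw [transition, Kernel.piecewise_apply, if_pos, e]
  rw [Set.mem_ofPred_eq, e, withDensity_apply _ MeasurableSet.univ, Measure.restrict_univ,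
    ← ofReal_integral_eq_lintegral_ofReal hi (hΘ h x).1, (hΘ h x).2, ENNReal.ofReal_one]

/-- Law of the observations `(s_0, a_0, …, s_h)` up to stage `h ≤ H` when the deterministic policy
`π` is run in the MDP `M(Θ)`: `s_0 ∼ ρ`, `a_j = π_j(s_j)`, and `s_{j+1}` is drawn from the
transition kernel of `M(Θ)` at `(j, s_j, a_j)`. -/
def obsLaw (M : Model S A H d) (Θ : Param H d) (π : Fin H → S → A) :
    (h : ℕ) → h ≤ H → Measure (Obs S A h)
  | 0, _ => M.ρ.map fun s => (Fin.elim0, s)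
  | h + 1, hh => (obsLaw M Θ π h (Nat.le_of_succ_le hh)).bind fun o =>
      (M.transition ⟨h, hh⟩ (Θ, (o.2, π ⟨h, hh⟩ o.2))).map
        fun s' => o.extend (π ⟨h, hh⟩ o.2) s'

/-- Law of the observations `(s_0, a_0, …, a_{H-1}, s_H)` of a whole episode. -/
def episodeLaw (M : Model S A H d) (Θ : Param H d) (π : Fin H → S → A) : Measure (Obs S A H) :=
  M.obsLaw Θ π H le_rfl

/-- The sum `∑_h R(h, s_h, a_h)` of the mean rewards collected in an episode. -/
def totalReward (M : Model S A H d) (o : Obs S A H) : ℝ := ∑ h : Fin H, M.R h (o.1 h)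

/-- The expected value of the policy `π` in the MDP `M(Θ)`. -/
def value (M : Model S A H d) (Θ : Param H d) (π : Fin H → S → A) : ℝ :=
  ∫ o, M.totalReward o ∂(M.episodeLaw Θ π)

/-- `π` is an optimal (deterministic, measurable) policy of the MDP `M(Θ)`. -/
def IsOptimal (M : Model S A H d) (Θ : Param H d) (π : Fin H → S → A) : Prop :=
  (∀ h, Measurable (π h)) ∧
    ∀ π' : Fin H → S → A, (∀ h, Measurable (π' h)) → M.value Θ π' ≤ M.value Θ π

end Model

/-- A map `Θ ↦ π^{M(Θ)}` from parameters to deterministic policies, measurable jointly in the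
parameter and the state. -/
structure Planner (S A : Type*) [MeasurableSpace S] [MeasurableSpace A] (H d : ℕ) where
  policy : Param H d → Fin H → S → A
  measurable_policy : ∀ h, Measurable fun p : Param H d × S => policy p.1 h p.2

lemma Obs.measurable_extend {h : ℕ} :
    Measurable fun q : (Obs S A h × A) × S => Obs.extend q.1.1 q.1.2 q.2 := by
  unfold Obs.extend
  refine Measurable.prodMk ?_ measurable_snd
  refine measurable_pi_lambda _ fun i => ?_
  refine Fin.lastCases ?_ (fun j => ?_) i
  · simp only [Fin.snoc_last]
    fun_prop
  · simp only [Fin.snoc_castSucc]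
    fun_prop

/-- The laws of the observations depend measurably on the true and on the planning parameter. -/
lemma Model.exists_obsKernel (M : Model S A H d) (pl : Planner S A H d) (h : ℕ) (hh : h ≤ H) :
    ∃ κ : Kernel (Param H d × Param H d) (Obs S A h), IsMarkovKernel κ ∧
      ∀ p, κ p = M.obsLaw p.1 (pl.policy p.2) h hh := by
  induction h with
  | zero =>
    have hm : Measurable fun s : S => ((Fin.elim0, s) : Obs S A 0) :=
      measurable_const.prodMk measurable_id
    refine ⟨Kernel.const _ (M.ρ.map fun s => (Fin.elim0, s)), ?_, fun p => ?_⟩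
    · have := Measure.isProbabilityMeasure_map (μ := M.ρ) hm.aemeasurable
      infer_instance
    · rw [Kernel.const_apply, Model.obsLaw]
  | succ h ih =>
    obtain ⟨κ, hκ, hκe⟩ := ih (Nat.le_of_succ_le hh)
    let i : Fin H := ⟨h, hh⟩
    let act : (Param H d × Param H d) × Obs S A h → A := fun q => pl.policy q.1.2 i q.2.2
    have hact : Measurable act := (pl.measurable_policy i).comp
      ((measurable_snd.comp measurable_fst).prodMk (measurable_snd.comp measurable_snd))
    have hinp : Measurable fun q : (Param H d × Param H d) × Obs S A h =>
        (q.1.1, (q.2.2, act q)) :=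
      (measurable_fst.comp measurable_fst).prodMk
        ((measurable_snd.comp measurable_snd).prodMk hact)
    have hext : Measurable fun r : ((Param H d × Param H d) × Obs S A h) × S =>
        Obs.extend r.1.2 (act r.1) r.2 :=
      Obs.measurable_extend.comp
        (((measurable_snd.comp measurable_fst).prodMk (hact.comp measurable_fst)).prodMk
          measurable_snd)
    let η : Kernel ((Param H d × Param H d) × Obs S A h) (Obs S A (h + 1)) :=
      (Kernel.id ×ₖ (M.transition i).comap _ hinp).map
        fun r => Obs.extend r.1.2 (act r.1) r.2
    have hη : IsMarkovKernel η := Kernel.IsMarkovKernel.map _ hext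
    refine ⟨(κ ⊗ₖ η).snd, inferInstance, fun p => ?_⟩
    have hη' : ∀ o, η (p, o) = (M.transition i (p.1, (o.2, pl.policy p.2 i o.2))).map
        fun s' => Obs.extend o (pl.policy p.2 i o.2) s' := by
      intro o
      rw [Kernel.map_apply _ hext, Kernel.prod_apply, Kernel.id_apply, Kernel.comap_apply,
        Measure.dirac_prod, Measure.map_map hext measurable_prodMk_left]
      rfl
    rw [Kernel.snd_apply, Kernel.compProd_apply_eq_compProd_sectR, ← Measure.snd,
      Measure.snd_compProd, hκe p, Model.obsLaw]
    congr 1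
    funext o
    exact hη' o

/-- The kernel `(Θ, Θ') ↦` law of an episode in `M(Θ)` under the policy planned for `Θ'`. -/
def Model.episodeKernel (M : Model S A H d) (pl : Planner S A H d) :
    Kernel (Param H d × Param H d) (Obs S A H) where
  toFun p := M.episodeLaw p.1 (pl.policy p.2)
  measurable' := by
    obtain ⟨κ, -, hκ⟩ := M.exists_obsKernel pl H le_rfl
    have e : (fun p : Param H d × Param H d => M.episodeLaw p.1 (pl.policy p.2)) = κ :=
      funext fun p => (hκ p).symm
    rw [e]
    exact κ.measurable

instance (M : Model S A H d) (pl : Planner S A H d) : IsMarkovKernel (M.episodeKernel pl) := by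
  obtain ⟨κ, hκ, hκe⟩ := M.exists_obsKernel pl H le_rfl
  refine ⟨fun p => ?_⟩
  change IsProbabilityMeasure (M.obsLaw p.1 (pl.policy p.2) H le_rfl)
  rw [← hκe p]
  infer_instance

/-- One more episode. `κ` is the law, given the true parameter `Θ`, of the history of `ℓ`
episodes; the agent draws `Θ' ∼ post(history)` (independently of `Θ` given the history), runs the
policy planned for `Θ'` in `M(Θ)`, and the observed episode is appended to the history. -/
def Model.nextHist (M : Model S A H d) (pl : Planner S A H d) {ℓ : ℕ}
    (κ : Kernel (Param H d) (Hist S A H ℓ)) (post : Kernel (Hist S A H ℓ) (Param H d)) :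
    Kernel (Param H d) (Hist S A H (ℓ + 1)) :=
  (κ ⊗ₖ (M.episodeKernel pl ∘ₖ (Kernel.id ∥ₖ post))).map
    fun q => Fin.snoc (α := fun _ => Obs S A H) q.1 q.2

lemma measurable_snocHist {ℓ : ℕ} : Measurable fun q : Hist S A H ℓ × Obs S A H =>
    (Fin.snoc (α := fun _ => Obs S A H) q.1 q.2 : Hist S A H (ℓ + 1)) := by
  refine measurable_pi_lambda _ fun i => ?_
  refine Fin.lastCases ?_ (fun j => ?_) i
  · simp only [Fin.snoc_last]
    fun_prop
  · simp only [Fin.snoc_castSucc]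
    fun_prop

lemma Model.isMarkovKernel_nextHist (M : Model S A H d) (pl : Planner S A H d) {ℓ : ℕ}
    (κ : Kernel (Param H d) (Hist S A H ℓ)) (post : Kernel (Hist S A H ℓ) (Param H d))
    [IsMarkovKernel κ] [IsMarkovKernel post] : IsMarkovKernel (M.nextHist pl κ post) :=
  Kernel.IsMarkovKernel.map _ measurable_snocHist

/-- The interaction of posterior sampling with the MDP: the Markov kernel that maps the true
parameter `Θ` to the law, given `Θ`, of the observational history of `ℓ` episodes. In the next
episode the agent draws its parameter from the posterior `ℙ(Θ* ∈ · | history)`. -/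
def psrlHistAux (M : Model S A H d) (pl : Planner S A H d) (prior : Measure (Param H d))
    [IsProbabilityMeasure prior] :
    (ℓ : ℕ) → {κ : Kernel (Param H d) (Hist S A H ℓ) // IsMarkovKernel κ}
  | 0 => ⟨Kernel.const _ (Measure.dirac Fin.elim0), inferInstance⟩
  | ℓ + 1 =>
    let κ := psrlHistAux M pl prior ℓ
    haveI : IsMarkovKernel κ.1 := κ.2
    ⟨M.nextHist pl κ.1 (posterior κ.1 prior), M.isMarkovKernel_nextHist pl _ _⟩

/-- Law of the observational history of `ℓ` episodes of posterior sampling, given `Θ`. -/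
def psrlHist (M : Model S A H d) (pl : Planner S A H d) (prior : Measure (Param H d))
    [IsProbabilityMeasure prior] (ℓ : ℕ) : Kernel (Param H d) (Hist S A H ℓ) :=
  (psrlHistAux M pl prior ℓ).1

instance (M : Model S A H d) (pl : Planner S A H d) (prior : Measure (Param H d))
    [IsProbabilityMeasure prior] (ℓ : ℕ) : IsMarkovKernel (psrlHist M pl prior ℓ) :=
  (psrlHistAux M pl prior ℓ).2

/-- The posterior distribution `ℙ(Θ* ∈ · | history)` from which posterior sampling draws the
parameter after `ℓ` episodes. -/
def psrlPosterior (M : Model S A H d) (pl : Planner S A H d) (prior : Measure (Param H d))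
    [IsProbabilityMeasure prior] (ℓ : ℕ) : Kernel (Hist S A H ℓ) (Param H d) :=
  posterior (psrlHist M pl prior ℓ) prior

instance (M : Model S A H d) (pl : Planner S A H d) (prior : Measure (Param H d))
    [IsProbabilityMeasure prior] (ℓ : ℕ) : IsMarkovKernel (psrlPosterior M pl prior ℓ) := by
  unfold psrlPosterior
  infer_instance

/-- Expected cumulative regret of posterior sampling over `L` episodes in the MDP `M(Θ)`. All
values lie in `[0, H]`. -/
def psrlRegret (M : Model S A H d) (pl : Planner S A H d) (prior : Measure (Param H d))
    [IsProbabilityMeasure prior] (L : ℕ) (Θ : Param H d) : ℝ :=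
  ∑ ℓ ∈ Finset.range L, ∫ hist, ∫ Θ',
    (M.value Θ (pl.policy Θ) - M.value Θ (pl.policy Θ'))
      ∂(psrlPosterior M pl prior ℓ hist) ∂(psrlHist M pl prior ℓ Θ)

/-- Bayesian regret: the expected cumulative regret averaged over the prior. -/
def psrlBayesRegret (M : Model S A H d) (pl : Planner S A H d) (prior : Measure (Param H d))
    [IsProbabilityMeasure prior] (L : ℕ) : ℝ :=
  ∫ Θ, psrlRegret M pl prior L Θ ∂prior

/-- Covariance matrix `Γ_{1,h}` of `θ*_h` under the prior. -/
def priorCov (prior : Measure (Param H d)) (h : Fin H) : Matrix (Fin d) (Fin d) ℝ :=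
  Matrix.of fun i j => covariance (fun Θ : Param H d => Θ h i) (fun Θ : Param H d => Θ h j) prior

end LinearMixture

end

/-! Condition on the history before an episode. The true parameter Θ and the planning parameter Θ'
are then two independent draws from the posterior. Swapping them turns the expected regret into the
difference of the values of one policy, the one planned for Θ', in the two MDPs M(Θ') and M(Θ)
(`integral_expRegret_eq`). The simulation lemma `value_sub_value` writes this difference as the sum
over h of (H-h-1)⟨θ'_h - θ_h, ψ_h⟩, averaged over a trajectory in M(Θ). Here ψ_h is the
value-correlated feature, at the pair of stage h, of the value function of Θ' normalized to [0, 1].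

Decoupling. The feature ψ_h is correlated with θ'_h, so no independence is used for this product. A
Cauchy-Schwarz inequality weighted by the (regularized) inverse of the posterior covariance Γ of θ_h
bounds it by ε d (H-h-1)² + E[ψᵀΓψ]/(2ε), because both draws have covariance Γ and the dimension
bounds the trace (`exists_dual_weight`, `integral_stageGap_le`).

Potential. It remains to bound the sum over the episodes of E[ψᵀΓψ] by 2 log det(I + LΓ_1)
(`sum_expPredVar_le`). The potential is E log det(I + kΓ), where k counts the episodes still to
come. Passing from (k + 1, Γ) to (k, Γ') over one episode costs at least half of the prediction
variance (`lintegral_logDet_step_le`). The tangent inequality of log det at I + (k+1)Γ, with inverse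
W, reduces this to a bound on E tr(WΓ'). That trace is at most the W-weighted mean squared error of
any estimator of θ_h. The linear estimator with gain 4Γψ, applied to the value of the next state,
has error at most tr(WΓ) - 4(Γψ)ᵀW(Γψ), since an observation in [0, 1] has variance at most 1/4
(`lintegral_quadForm_linear_estimator`). What is left is a scalar inequality between eigenvalues
(`quadForm_le_trace_resolvent`).

Independence. The estimator uses Θ', which is not part of the history, and it needs θ_h to be
independent of the input of stage h. Both points follow from one fact: given all observations, θ_h
is independent of the pair formed by the other components and Θ'. This holds under the prior and
survives each episode, because an episode is a two-party protocol: every action and every next state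
is a message that one party sends given the public transcript (`IsCondIndep.message_left`,
`isCondIndep_stageLaw`).

Optimizing ε after summation, together with 2 Σ (H-h-1)² ≤ H³, gives the constant. -/

open MeasureTheory ProbabilityTheory

noncomputable section

/-! ### Spectral calculus, log-determinants and resolvents of real symmetric matrices. -/

namespace LinearMixture

section MatrixFacts

open Matrix

variable {n : Type*} [Fintype n] [DecidableEq n]

/-- The symmetric matrix with orthonormal eigenvectors the columns of `U` and eigenvalues `f`. -/
def conjDiag (U : Matrix n n ℝ) (f : n → ℝ) : Matrix n n ℝ := U * diagonal f * Uᵀ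

lemma conjDiag_mul {U : Matrix n n ℝ} (hU : Uᵀ * U = 1) (f g : n → ℝ) :
    conjDiag U f * conjDiag U g = conjDiag U (fun i => f i * g i) := by
  unfold conjDiag
  rw [← diagonal_mul_diagonal]
  simp only [Matrix.mul_assoc]
  rw [← Matrix.mul_assoc Uᵀ U, hU, Matrix.one_mul]

lemma conjDiag_one {U : Matrix n n ℝ} (hU : U * Uᵀ = 1) : conjDiag U (fun _ => 1) = 1 := by
  simp [conjDiag, hU]

lemma conjDiag_add (U : Matrix n n ℝ) (f g : n → ℝ) :
    conjDiag U (fun i => f i + g i) = conjDiag U f + conjDiag U g := by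
  unfold conjDiag
  rw [← diagonal_add, Matrix.mul_add, Matrix.add_mul]

lemma conjDiag_smul (U : Matrix n n ℝ) (c : ℝ) (f : n → ℝ) :
    conjDiag U (fun i => c * f i) = c • conjDiag U f := by
  have : diagonal (fun i => c * f i) = c • diagonal f := by
    ext i j; by_cases h : i = j <;> simp [h, diagonal]
  unfold conjDiag
  rw [this, Matrix.mul_smul, Matrix.smul_mul]

lemma trace_conjDiag {U : Matrix n n ℝ} (hU : Uᵀ * U = 1) (f : n → ℝ) :
    (conjDiag U f).trace = ∑ i, f i := by
  rw [conjDiag, Matrix.trace_mul_comm, ← Matrix.mul_assoc, hU, Matrix.one_mul, trace_diagonal]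

lemma dotProduct_conjDiag_mulVec (U : Matrix n n ℝ) (f : n → ℝ) (a b : n → ℝ) :
    a ⬝ᵥ conjDiag U f *ᵥ b = ∑ i, f i * ((Uᵀ *ᵥ a) i * (Uᵀ *ᵥ b) i) := by
  rw [conjDiag, ← mulVec_mulVec, ← mulVec_mulVec, dotProduct_mulVec, ← mulVec_transpose,
    dotProduct]
  refine Finset.sum_congr rfl fun i _ => ?_
  rw [mulVec_diagonal]
  ring

lemma sum_sq_transpose_mulVec {U : Matrix n n ℝ} (hU : U * Uᵀ = 1) (a : n → ℝ) :
    ∑ i, (Uᵀ *ᵥ a) i ^ 2 = a ⬝ᵥ a := by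
  have h := dotProduct_conjDiag_mulVec U (fun _ => 1) a a
  rw [conjDiag_one hU, one_mulVec] at h
  rw [h]
  exact Finset.sum_congr rfl fun i _ => by ring

lemma inv_conjDiag {U : Matrix n n ℝ} (hU : U * Uᵀ = 1) (hU' : Uᵀ * U = 1) {f : n → ℝ}
    (hf : ∀ i, f i ≠ 0) : (conjDiag U f)⁻¹ = conjDiag U (fun i => (f i)⁻¹) := by
  refine inv_eq_right_inv ?_
  rw [conjDiag_mul hU']
  simp [mul_inv_cancel₀ (hf _), conjDiag_one hU]

lemma posSemidef_conjDiag (U : Matrix n n ℝ) {f : n → ℝ} (hf : ∀ i, 0 ≤ f i) :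
    (conjDiag U f).PosSemidef := by
  have := (PosSemidef.diagonal hf).mul_mul_conjTranspose_same U
  simpa [conjDiag, conjTranspose_eq_transpose_of_trivial] using this

lemma exists_eq_conjDiag {A : Matrix n n ℝ} (hA : A.IsHermitian) :
    ∃ U : Matrix n n ℝ, U * Uᵀ = 1 ∧ Uᵀ * U = 1 ∧ A = conjDiag U hA.eigenvalues := by
  refine ⟨hA.eigenvectorUnitary, ?_, ?_, ?_⟩
  · have := Unitary.coe_mul_star_self hA.eigenvectorUnitary
    simpa [star_eq_conjTranspose, conjTranspose_eq_transpose_of_trivial] using this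
  · have := Unitary.coe_star_mul_self hA.eigenvectorUnitary
    simpa [star_eq_conjTranspose, conjTranspose_eq_transpose_of_trivial] using this
  · have := hA.spectral_theorem
    rw [Unitary.conjStarAlgAut_apply] at this
    simpa [conjDiag, star_eq_conjTranspose, conjTranspose_eq_transpose_of_trivial,
      Function.comp_def] using this

/-- Apply log x ≤ x - 1 to each eigenvalue. This is the tangent inequality of log det at the
identity. -/
lemma log_det_le_trace_sub_card {A : Matrix n n ℝ} (hA : A.PosDef) :
    Real.log A.det ≤ A.trace - Fintype.card n := by
  have h1 : A.det = ∏ i, hA.isHermitian.eigenvalues i := by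
    simpa using hA.isHermitian.det_eq_prod_eigenvalues
  have h2 : A.trace = ∑ i, hA.isHermitian.eigenvalues i := by
    simpa using hA.isHermitian.trace_eq_sum_eigenvalues
  rw [h1, h2, Real.log_prod fun i _ => (hA.eigenvalues_pos i).ne']
  have : ∑ i, hA.isHermitian.eigenvalues i - (Fintype.card n : ℝ) =
      ∑ i, (hA.isHermitian.eigenvalues i - 1) := by simp
  rw [this]
  exact Finset.sum_le_sum fun i _ => Real.log_le_sub_one_of_pos (hA.eigenvalues_pos i)

/-- The tangent inequality of the concave function `log det`. -/
lemma log_det_le_log_det_add_trace {A B : Matrix n n ℝ} (hA : A.PosDef) (hB : B.PosDef) :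
    Real.log A.det ≤ Real.log B.det + ((B⁻¹ * A).trace - Fintype.card n) := by
  obtain ⟨U, hU, hU', hBU⟩ := exists_eq_conjDiag hB.isHermitian
  have hb := hB.eigenvalues_pos
  set b := hB.isHermitian.eigenvalues
  -- D is the inverse square root of B. Replacing A by D A D moves the point of tangency from B to
  -- the identity.
  let D := conjDiag U fun i => (√(b i))⁻¹
  have hDD : D * D = B⁻¹ := by
    rw [conjDiag_mul hU', hBU, inv_conjDiag hU hU' fun i => (hb i).ne']
    congr 1; funext i
    rw [← mul_inv, Real.mul_self_sqrt (hb i).le]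
  have hdet : D.det * D.det * B.det = 1 := by
    rw [← det_mul, hDD, ← det_mul, nonsing_inv_mul _ (isUnit_iff_ne_zero.2 hB.det_pos.ne'),
      det_one]
  have hD0 : D.det ≠ 0 := by rintro h; simp [h] at hdet
  have hDt : Dᵀ = D := by
    simp [D, conjDiag, Matrix.mul_assoc]
  have hC : (D * A * D).PosDef := by
    have := hA.conjTranspose_mul_mul_same (B := D)
      (mulVec_injective_of_isUnit ((isUnit_iff_isUnit_det D).2 (isUnit_iff_ne_zero.2 hD0)))
    rwa [conjTranspose_eq_transpose_of_trivial, hDt] at this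
  have h := log_det_le_trace_sub_card hC
  rw [Matrix.trace_mul_comm, ← Matrix.mul_assoc, hDD] at h
  have e : A.det = B.det * (D * A * D).det := by
    rw [det_mul, det_mul]
    linear_combination A.det * (-hdet)
  rw [e, Real.log_mul hB.det_pos.ne' hC.det_pos.ne']
  linarith

lemma posDef_one_add_smul {n : Type*} [DecidableEq n] {A : Matrix n n ℝ} (hA : A.PosSemidef)
    {k : ℝ} (hk : 0 ≤ k) :
    (1 + k • A).PosDef :=
  PosDef.one.add_posSemidef (hA.smul hk)

/-- All eigenvalues are at least 1. The sign ensures that passing the potential through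
`ENNReal.ofReal` truncates nothing. -/
lemma log_det_one_add_smul_nonneg {A : Matrix n n ℝ} (hA : A.PosSemidef) {k : ℝ} (hk : 0 ≤ k) :
    0 ≤ Real.log (1 + k • A).det := by
  obtain ⟨U, hU, hU', hAU⟩ := exists_eq_conjDiag hA.isHermitian
  have h0 := hA.eigenvalues_nonneg
  have e : (1 + k • A : Matrix n n ℝ) =
      conjDiag U (fun i => 1 + k * hA.isHermitian.eigenvalues i) := by
    rw [conjDiag_add, conjDiag_smul, ← hAU, conjDiag_one hU]
  rw [e]
  refine Real.log_nonneg ?_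
  rw [conjDiag, det_mul_right_comm, hU, one_mul, det_diagonal]
  exact Finset.one_le_prod fun i _ => le_add_of_nonneg_right (mul_nonneg hk (h0 i))

/-- The decrease of the potential `log det (1 + k A)` when `A` is replaced by `A'` and `k + 1` by
`k`, up to the traces against the resolvent of `A`. -/
lemma log_det_potential {A A' : Matrix n n ℝ} (hA : A.PosSemidef) (hA' : A'.PosSemidef) {k : ℝ}
    (hk : 0 ≤ k) :
    Real.log (1 + k • A').det + (k + 1) * ((1 + (k + 1) • A)⁻¹ * A).trace ≤
      Real.log (1 + (k + 1) • A).det + k * ((1 + (k + 1) • A)⁻¹ * A').trace := by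
  have hB := posDef_one_add_smul hA (by linarith : 0 ≤ k + 1)
  have h := log_det_le_log_det_add_trace (posDef_one_add_smul hA' hk) hB
  have h1 : (1 + (k + 1) • A)⁻¹ * (1 + (k + 1) • A) = 1 :=
    nonsing_inv_mul _ (isUnit_iff_ne_zero.2 hB.det_pos.ne')
  -- The dimension equals tr B⁻¹ + (k+1) tr(B⁻¹A) for B = 1 + (k+1)A. The term tr B⁻¹ cancels
  -- against the tangent inequality and leaves only the traces with A and A'.
  have h2 := congrArg trace h1
  rw [Matrix.mul_add, Matrix.mul_one, Matrix.mul_smul, trace_add, trace_smul, trace_one,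
    smul_eq_mul] at h2
  rw [Matrix.mul_add, Matrix.mul_one, Matrix.mul_smul, trace_add, trace_smul, smul_eq_mul] at h
  linarith

lemma posSemidef_resolvent {A : Matrix n n ℝ} (hA : A.PosSemidef) {k : ℝ} (hk : 0 ≤ k) :
    ((1 + k • A)⁻¹).PosSemidef :=
  (posDef_one_add_smul hA hk).inv.posSemidef

/-- The dimension is the sum of the left side and the trace of the resolvent, which is nonnegative.
The bound keeps the traces finite when they are later cancelled in `ENNReal`. -/
lemma trace_resolvent_mul_le {A : Matrix n n ℝ} (hA : A.PosSemidef) {k : ℝ} (hk : 0 ≤ k) :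
    k * ((1 + k • A)⁻¹ * A).trace ≤ Fintype.card n := by
  have hB := posDef_one_add_smul hA hk
  have h1 : (1 + k • A)⁻¹ * (1 + k • A) = 1 :=
    nonsing_inv_mul _ (isUnit_iff_ne_zero.2 hB.det_pos.ne')
  have h2 := congrArg trace h1
  rw [Matrix.mul_add, Matrix.mul_one, Matrix.mul_smul, trace_add, trace_smul, trace_one,
    smul_eq_mul] at h2
  have := hB.inv.posSemidef.trace_nonneg
  linarith

/-- The expected decrease of the resolvent trace dominates the posterior variance along `v`. -/
lemma quadForm_le_trace_resolvent {A : Matrix n n ℝ} (hA : A.PosSemidef) (k : ℕ) {v : n → ℝ}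
    (hv : v ⬝ᵥ v ≤ 1) (hAv : v ⬝ᵥ A *ᵥ v ≤ 1 / 4) :
    (v ⬝ᵥ A *ᵥ v) / 2 ≤ ((1 + ((k : ℝ) + 1) • A)⁻¹ * A).trace +
      4 * k * ((A *ᵥ v) ⬝ᵥ (1 + ((k : ℝ) + 1) • A)⁻¹ *ᵥ (A *ᵥ v)) := by
  obtain ⟨U, hU, hU', hAU⟩ := exists_eq_conjDiag hA.isHermitian
  have h0 := hA.eigenvalues_nonneg
  set a := hA.isHermitian.eigenvalues
  set K : ℝ := (k : ℝ) + 1 with hK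
  have hk0 : (0 : ℝ) ≤ k := Nat.cast_nonneg k
  have hpos : ∀ i, 0 < 1 + K * a i := fun i => by have := h0 i; positivity
  have e : (1 + K • A : Matrix n n ℝ) = conjDiag U (fun i => 1 + K * a i) := by
    rw [conjDiag_add, conjDiag_smul, ← hAU, conjDiag_one hU]
  have eW : (1 + K • A : Matrix n n ℝ)⁻¹ = conjDiag U (fun i => (1 + K * a i)⁻¹) := by
    rw [e, inv_conjDiag hU hU' fun i => (hpos i).ne']
  have e1 : ((1 + K • A)⁻¹ * A).trace = ∑ i, (1 + K * a i)⁻¹ * a i := by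
    rw [eW, hAU, conjDiag_mul hU', trace_conjDiag hU']
  have e2 : (A *ᵥ v) ⬝ᵥ (1 + K • A)⁻¹ *ᵥ (A *ᵥ v) =
      ∑ i, (a i * ((1 + K * a i)⁻¹ * a i)) * (Uᵀ *ᵥ v) i ^ 2 := by
    have hAt : Aᵀ = A := by
      have := hA.isHermitian
      rwa [IsHermitian, conjTranspose_eq_transpose_of_trivial] at this
    have : (A *ᵥ v) ⬝ᵥ (1 + K • A)⁻¹ *ᵥ (A *ᵥ v) = v ⬝ᵥ (A * ((1 + K • A)⁻¹ * A)) *ᵥ v := by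
      rw [← mulVec_mulVec, ← mulVec_mulVec, dotProduct_mulVec v A, ← mulVec_transpose, hAt]
    rw [this, eW, hAU, conjDiag_mul hU', conjDiag_mul hU', dotProduct_conjDiag_mulVec]
    exact Finset.sum_congr rfl fun i _ => by ring
  have e3 : v ⬝ᵥ A *ᵥ v = ∑ i, a i * (Uᵀ *ᵥ v) i ^ 2 := by
    conv_lhs => rw [hAU, dotProduct_conjDiag_mulVec]
    exact Finset.sum_congr rfl fun i _ => by ring
  have hc := sum_sq_transpose_mulVec hU v
  have hc1 : ∀ i, (Uᵀ *ᵥ v) i ^ 2 ≤ 1 := fun i =>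
    (Finset.single_le_sum (f := fun i => (Uᵀ *ᵥ v) i ^ 2) (fun j _ => sq_nonneg _)
      (Finset.mem_univ i)).trans (hc.le.trans hv)
  rw [e1, e2]
  -- The comparison of eigenvalues term by term fails only for k = 0 and an eigenvalue above 1.
  -- There the trace alone is at least 1/2, which exceeds half of the variance bound 1/4.
  by_cases hbig : k = 0 ∧ ∃ i, 1 < a i
  · obtain ⟨rfl, i, hi⟩ := hbig
    have hK1 : K = 1 := by simp [hK]
    have hge : (1 / 2 : ℝ) ≤ (1 + K * a i)⁻¹ * a i := by
      rw [hK1, inv_mul_eq_div, div_le_div_iff₀ (by norm_num) (by linarith)]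
      linarith
    have := Finset.single_le_sum (f := fun i => (1 + K * a i)⁻¹ * a i)
      (fun j _ => mul_nonneg (inv_nonneg.2 (hpos j).le) (h0 j)) (Finset.mem_univ i)
    simp only [Nat.cast_zero, mul_zero, zero_mul, add_zero]
    have h3 : v ⬝ᵥ A *ᵥ v ≤ 1 / 4 := hAv
    have h4 := hge.trans this
    linarith
  · rw [e3, Finset.mul_sum, ← Finset.sum_add_distrib, Finset.sum_div]
    refine Finset.sum_le_sum fun i _ => ?_
    have hai := h0 i
    have hci := hc1 i
    have hc0 := sq_nonneg ((Uᵀ *ᵥ v) i)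
    set c := (Uᵀ *ᵥ v) i ^ 2
    -- The gain term contributes 8k and the denominator takes away k + 1; this leaves 7k - 1, which
    -- is negative only for k = 0.
    have key : 0 ≤ 1 + (7 * k - 1) * a i := by
      rcases Nat.eq_zero_or_pos k with rfl | hk
      · push Not at hbig
        have := hbig rfl i
        simp only [Nat.cast_zero]
        linarith
      · have : (1 : ℝ) ≤ k := by exact_mod_cast hk
        have : 0 ≤ (7 * (k : ℝ) - 1) * a i := mul_nonneg (by linarith) hai
        linarith
    have h1 : (1 + K * a i)⁻¹ * a i + 4 * k * (a i * ((1 + K * a i)⁻¹ * a i) * c) =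
        (1 + K * a i)⁻¹ * (a i * (1 + 4 * k * a i * c)) := by ring
    rw [h1, inv_mul_eq_div, le_div_iff₀ (hpos i)]
    have h2 : a i * (1 + 4 * k * a i * c) - a i * c / 2 * (1 + K * a i) =
        a i * ((1 - c) + c / 2 * (1 + (7 * k - 1) * a i)) := by rw [hK]; ring
    have h3 : 0 ≤ a i * ((1 - c) + c / 2 * (1 + (7 * k - 1) * a i)) :=
      mul_nonneg hai (add_nonneg (by linarith) (mul_nonneg (by linarith) key))
    linarith

/-- A weighted Cauchy-Schwarz inequality with weight matrix `(A + δ)⁻¹`. -/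
lemma exists_dual_weight {A : Matrix n n ℝ} (hA : A.PosSemidef) {δ : ℝ} (hδ : 0 < δ) :
    ∃ G : Matrix n n ℝ, G.PosSemidef ∧ (G * A).trace ≤ Fintype.card n ∧
      ∀ (ε : ℝ), 0 < ε → ∀ (c : ℝ) (a b : n → ℝ), c * (a ⬝ᵥ b) ≤
        (ε * c ^ 2 * (a ⬝ᵥ G *ᵥ a) + ε⁻¹ * (b ⬝ᵥ A *ᵥ b + δ * (b ⬝ᵥ b))) / 2 := by
  obtain ⟨U, hU, hU', hAU⟩ := exists_eq_conjDiag hA.isHermitian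
  have h0 := hA.eigenvalues_nonneg
  set l := hA.isHermitian.eigenvalues
  have hpos : ∀ i, 0 < l i + δ := fun i => add_pos_of_nonneg_of_pos (h0 i) hδ
  -- The shift δ makes A invertible, as a posterior covariance may be singular. It costs only δ(b ⬝ᵥ
  -- b) on the other side.
  refine ⟨conjDiag U fun i => (l i + δ)⁻¹, posSemidef_conjDiag U fun i => (inv_pos.2 (hpos i)).le,
    ?_, fun ε hε c a b => ?_⟩
  · rw [hAU, conjDiag_mul hU', trace_conjDiag hU', Fintype.card, Finset.card_eq_sum_ones,
      Nat.cast_sum]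
    refine Finset.sum_le_sum fun i _ => ?_
    rw [inv_mul_eq_div, Nat.cast_one, div_le_one (hpos i)]
    linarith
  · have e1 : a ⬝ᵥ b = ∑ i, (Uᵀ *ᵥ a) i * (Uᵀ *ᵥ b) i := by
      have h := dotProduct_conjDiag_mulVec U (fun _ => 1) a b
      rw [conjDiag_one hU, one_mulVec] at h
      simpa using h
    have e2 : b ⬝ᵥ A *ᵥ b + δ * (b ⬝ᵥ b) = ∑ i, (l i + δ) * (Uᵀ *ᵥ b) i ^ 2 := by
      conv_lhs => rw [hAU, dotProduct_conjDiag_mulVec, ← sum_sq_transpose_mulVec hU b,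
        Finset.mul_sum, ← Finset.sum_add_distrib]
      exact Finset.sum_congr rfl fun i _ => by ring
    rw [e1, e2, dotProduct_conjDiag_mulVec, Finset.mul_sum, Finset.mul_sum, Finset.mul_sum,
      ← Finset.sum_add_distrib, Finset.sum_div]
    refine Finset.sum_le_sum fun i _ => ?_
    set x := (Uᵀ *ᵥ a) i
    set y := (Uᵀ *ᵥ b) i
    have hw : 0 < ε * (l i + δ) := mul_pos hε (hpos i)
    -- Young's inequality in each eigendirection, with the complete square displayed.
    have key : 0 ≤ (ε * (l i + δ))⁻¹ * (ε * c * x - (l i + δ) * y) ^ 2 := by positivity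
    have e3 : (ε * (l i + δ))⁻¹ * (ε * c * x - (l i + δ) * y) ^ 2 =
        ε * c ^ 2 * ((l i + δ)⁻¹ * (x * x)) + ε⁻¹ * ((l i + δ) * y ^ 2) - 2 * (c * (x * y)) := by
      have := (hpos i).ne'
      field_simp
      ring
    linarith

end MatrixFacts

end LinearMixture

/-! ### Means, covariances and linear estimation in Euclidean space. -/

namespace LinearMixture

section Estimation

open Matrix

variable {d : ℕ}

/-- The coordinatewise mean of a measure on `ℝ^d`. -/
def meanVec (μ : Measure (EuclideanSpace ℝ (Fin d))) : Fin d → ℝ := fun i => ∫ x, x i ∂μ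

/-- The covariance matrix of a measure on `ℝ^d`. -/
def covMat (μ : Measure (EuclideanSpace ℝ (Fin d))) : Matrix (Fin d) (Fin d) ℝ :=
  Matrix.of fun i j => ∫ x, (x i - meanVec μ i) * (x j - meanVec μ j) ∂μ

/-- The deviation of `x` from the mean of `μ`. -/
def dev (μ : Measure (EuclideanSpace ℝ (Fin d))) (x : EuclideanSpace ℝ (Fin d)) : Fin d → ℝ :=
  fun i => x i - meanVec μ i

variable {μ : Measure (EuclideanSpace ℝ (Fin d))}

lemma quadForm_nonneg {n : Type*} [Fintype n] {W : Matrix n n ℝ} (hW : W.PosSemidef) (v : n → ℝ) :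
    0 ≤ v ⬝ᵥ W *ᵥ v := by
  simpa using hW.dotProduct_mulVec_nonneg v

lemma dotProduct_mulVec_comm_of_posSemidef {n : Type*} [Fintype n] {W : Matrix n n ℝ}
    (hW : W.PosSemidef) (a b : n → ℝ) : a ⬝ᵥ W *ᵥ b = b ⬝ᵥ W *ᵥ a := by
  have hWt : Wᵀ = W := by
    have := hW.isHermitian
    rwa [IsHermitian, conjTranspose_eq_transpose_of_trivial] at this
  rw [dotProduct_mulVec, ← mulVec_transpose, hWt, dotProduct_comm]

lemma memLp_apply (hμ : MemLp (fun x => x) 2 μ) (i : Fin d) : MemLp (fun x => x i) 2 μ := by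
  have hm : Measurable fun x : EuclideanSpace ℝ (Fin d) => x i := by fun_prop
  exact hμ.of_le hm.aestronglyMeasurable (ae_of_all _ fun x => PiLp.norm_apply_le x i)

lemma dotProduct_dev (ψ : Fin d → ℝ) (x : EuclideanSpace ℝ (Fin d)) :
    ψ ⬝ᵥ dev μ x = ψ ⬝ᵥ x.ofLp - ψ ⬝ᵥ meanVec μ := by
  rw [← dotProduct_sub]
  rfl

variable [IsProbabilityMeasure μ]

lemma memLp_dev (hμ : MemLp (fun x => x) 2 μ) (i : Fin d) : MemLp (fun x => dev μ x i) 2 μ :=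
  (memLp_apply hμ i).sub (memLp_const _)

lemma integrable_dev_mul (hμ : MemLp (fun x => x) 2 μ) (i j : Fin d) :
    Integrable (fun x => dev μ x i * dev μ x j) μ :=
  (memLp_dev hμ i).integrable_mul (memLp_dev hμ j)

lemma memLp_dotProduct_dev (hμ : MemLp (fun x => x) 2 μ) (a : Fin d → ℝ) :
    MemLp (fun x => a ⬝ᵥ dev μ x) 2 μ := by
  simp only [dotProduct]
  exact memLp_finsetSum _ fun i _ => (memLp_dev hμ i).const_mul (a i)

lemma integral_dotProduct_dev (hμ : MemLp (fun x => x) 2 μ) (a : Fin d → ℝ) :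
    ∫ x, a ⬝ᵥ dev μ x ∂μ = 0 := by
  simp only [dotProduct]
  rw [integral_finsetSum _ fun i _ =>
    ((memLp_dev hμ i).integrable one_le_two).const_mul (a i)]
  refine Finset.sum_eq_zero fun i _ => ?_
  rw [integral_const_mul]
  simp only [dev]
  rw [integral_sub ((memLp_apply hμ i).integrable one_le_two) (integrable_const _)]
  simp [meanVec]

lemma integral_dotProduct_dev_mul (hμ : MemLp (fun x => x) 2 μ) (a b : Fin d → ℝ) :
    ∫ x, (a ⬝ᵥ dev μ x) * (b ⬝ᵥ dev μ x) ∂μ = a ⬝ᵥ covMat μ *ᵥ b := by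
  simp only [dotProduct, mulVec, Finset.sum_mul_sum]
  have hi : ∀ i j, Integrable (fun x => a i * dev μ x i * (b j * dev μ x j)) μ := fun i j =>
    ((integrable_dev_mul hμ i j).const_mul (a i * b j)).congr (ae_of_all _ fun x => by ring)
  rw [integral_finsetSum _ fun i _ => integrable_finsetSum _ fun j _ => hi i j]
  · refine Finset.sum_congr rfl fun i _ => ?_
    rw [integral_finsetSum _ fun j _ => hi i j, Finset.mul_sum]
    · refine Finset.sum_congr rfl fun j _ => ?_
      simp only [covMat, of_apply]
      rw [mul_comm (∫ _, _ ∂μ) (b j), ← mul_assoc, ← integral_const_mul]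
      refine integral_congr_ae (ae_of_all _ fun x => ?_)
      simp only [dev]
      ring

lemma integrable_dotProduct_dev_mul (hμ : MemLp (fun x => x) 2 μ) (a b : Fin d → ℝ) :
    Integrable (fun x => (a ⬝ᵥ dev μ x) * (b ⬝ᵥ dev μ x)) μ :=
  (memLp_dotProduct_dev hμ a).integrable_mul (memLp_dotProduct_dev hμ b)

lemma covMat_comm (μ : Measure (EuclideanSpace ℝ (Fin d))) (i j : Fin d) :
    covMat μ i j = covMat μ j i := by
  simp only [covMat, of_apply, mul_comm]

lemma posSemidef_covMat (hμ : MemLp (fun x => x) 2 μ) : (covMat μ).PosSemidef := by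
  refine PosSemidef.of_dotProduct_mulVec_nonneg ?_ fun v => ?_
  · ext i j
    simpa using covMat_comm μ j i
  · rw [star_trivial, ← integral_dotProduct_dev_mul hμ]
    exact integral_nonneg fun x => mul_self_nonneg _

lemma quadForm_eq_sum {n : Type*} [Fintype n] (W : Matrix n n ℝ) (v : n → ℝ) :
    v ⬝ᵥ W *ᵥ v = ∑ i, ∑ j, W i j * (v i * v j) := by
  simp only [dotProduct, mulVec, Finset.mul_sum]
  exact Finset.sum_congr rfl fun i _ => Finset.sum_congr rfl fun j _ => by ring

lemma integrable_quadForm_dev (hμ : MemLp (fun x => x) 2 μ) (W : Matrix (Fin d) (Fin d) ℝ) :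
    Integrable (fun x => dev μ x ⬝ᵥ W *ᵥ dev μ x) μ := by
  simp only [quadForm_eq_sum]
  exact integrable_finsetSum _ fun i _ => integrable_finsetSum _ fun j _ =>
    (integrable_dev_mul hμ i j).const_mul _

lemma integral_quadForm_dev (hμ : MemLp (fun x => x) 2 μ) (W : Matrix (Fin d) (Fin d) ℝ) :
    ∫ x, dev μ x ⬝ᵥ W *ᵥ dev μ x ∂μ = (W * covMat μ).trace := by
  simp only [quadForm_eq_sum]
  refine (integral_finsetSum _ fun i _ => integrable_finsetSum _ fun j _ =>
    (integrable_dev_mul hμ i j).const_mul _).trans ?_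
  simp only [trace, diag, mul_apply]
  refine Finset.sum_congr rfl fun i _ => ?_
  refine (integral_finsetSum _ fun j _ => (integrable_dev_mul hμ i j).const_mul _).trans ?_
  refine Finset.sum_congr rfl fun j _ => ?_
  rw [integral_const_mul, covMat_comm]
  rfl

/-- Expansion of a quadratic form. -/
lemma quadForm_sub_smul {n : Type*} [Fintype n] {W : Matrix n n ℝ} (hW : W.PosSemidef)
    (a g : n → ℝ) (b : ℝ) :
    (a - b • g) ⬝ᵥ W *ᵥ (a - b • g) =
      a ⬝ᵥ W *ᵥ a - 2 * b * ((W *ᵥ g) ⬝ᵥ a) + b ^ 2 * (g ⬝ᵥ W *ᵥ g) := by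
  have h := dotProduct_mulVec_comm_of_posSemidef hW a g
  have h2 : (W *ᵥ g) ⬝ᵥ a = a ⬝ᵥ W *ᵥ g := dotProduct_comm _ _
  rw [h2]
  simp only [mulVec_sub, mulVec_smul, sub_dotProduct, dotProduct_sub, smul_dotProduct,
    dotProduct_smul, smul_eq_mul]
  rw [← h]
  ring

/-- The mean minimizes the expected weighted squared error. -/
lemma ofReal_trace_le_lintegral_quadForm (hμ : MemLp (fun x => x) 2 μ)
    {W : Matrix (Fin d) (Fin d) ℝ} (hW : W.PosSemidef) (c : Fin d → ℝ) :
    ENNReal.ofReal (W * covMat μ).trace ≤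
      ∫⁻ x, ENNReal.ofReal ((x.ofLp - c) ⬝ᵥ W *ᵥ (x.ofLp - c)) ∂μ := by
  have e : ∀ x : EuclideanSpace ℝ (Fin d), (x.ofLp - c) ⬝ᵥ W *ᵥ (x.ofLp - c) =
      dev μ x ⬝ᵥ W *ᵥ dev μ x - 2 * ((W *ᵥ (c - meanVec μ)) ⬝ᵥ dev μ x) +
        (c - meanVec μ) ⬝ᵥ W *ᵥ (c - meanVec μ) := by
    intro x
    have h := quadForm_sub_smul hW (dev μ x) (c - meanVec μ) 1
    have h2 : dev μ x - (1 : ℝ) • (c - meanVec μ) = x.ofLp - c := by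
      ext i
      simp [dev]
    rw [h2] at h
    rw [h]
    ring
  have hi1 := integrable_quadForm_dev hμ W
  have hi2 := ((memLp_dotProduct_dev hμ (W *ᵥ (c - meanVec μ))).integrable one_le_two).const_mul 2
  have hi : Integrable (fun x : EuclideanSpace ℝ (Fin d) =>
      (x.ofLp - c) ⬝ᵥ W *ᵥ (x.ofLp - c)) μ := by
    simp only [e]
    exact (hi1.sub hi2).add (integrable_const _)
  rw [← ofReal_integral_eq_lintegral_ofReal hi (ae_of_all _ fun x => quadForm_nonneg hW _)]
  refine ENNReal.ofReal_le_ofReal ?_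
  simp only [e]
  have hi12 : Integrable (fun x => dev μ x ⬝ᵥ W *ᵥ dev μ x -
      2 * ((W *ᵥ (c - meanVec μ)) ⬝ᵥ dev μ x)) μ := hi1.sub hi2
  rw [integral_add hi12 (integrable_const _), integral_sub hi1 hi2,
    integral_quadForm_dev hμ, integral_const_mul, integral_dotProduct_dev hμ]
  have := quadForm_nonneg hW (c - meanVec μ)
  simp only [mul_zero, sub_zero, integral_const, probReal_univ, smul_eq_mul, one_mul]
  linarith

lemma integral_dotProduct (hμ : MemLp (fun x => x) 2 μ) (ψ : Fin d → ℝ) :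
    Integrable (fun x : EuclideanSpace ℝ (Fin d) => ψ ⬝ᵥ x.ofLp) μ ∧
      ∫ x, ψ ⬝ᵥ x.ofLp ∂μ = ψ ⬝ᵥ meanVec μ := by
  have hi := (memLp_dotProduct_dev hμ ψ).integrable one_le_two
  have e : (fun x : EuclideanSpace ℝ (Fin d) => ψ ⬝ᵥ x.ofLp) =
      fun x => ψ ⬝ᵥ dev μ x + ψ ⬝ᵥ meanVec μ := by
    funext x
    rw [dotProduct_dev (μ := μ)]
    ring
  rw [e]
  refine ⟨?_, ?_⟩
  · exact hi.add (integrable_const _)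
  · rw [integral_add hi (integrable_const _), integral_dotProduct_dev hμ]
    simp

/-- A linear functional with values in `[0, 1]` has variance at most `1 / 4`. -/
lemma quadForm_covMat_le (hμ : MemLp (fun x => x) 2 μ) {ψ : Fin d → ℝ}
    (hψ : ∀ᵐ x ∂μ, ψ ⬝ᵥ x.ofLp ∈ Set.Icc (0 : ℝ) 1) : ψ ⬝ᵥ covMat μ *ᵥ ψ ≤ 1 / 4 := by
  obtain ⟨hi, hI⟩ := integral_dotProduct hμ ψ
  rw [← integral_dotProduct_dev_mul hμ]
  set m := ψ ⬝ᵥ meanVec μ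
  -- Since y² ≤ y on [0, 1], the square (y - m)² is at most (1 - 2m) y + m², whose mean is m(1 - m).
  have hle : ∫ x, (ψ ⬝ᵥ dev μ x) * (ψ ⬝ᵥ dev μ x) ∂μ ≤
      ∫ x, ((1 - 2 * m) * (ψ ⬝ᵥ x.ofLp) + m ^ 2) ∂μ := by
    refine integral_mono_ae (integrable_dotProduct_dev_mul hμ ψ ψ)
      ((hi.const_mul _).add (integrable_const _)) ?_
    filter_upwards [hψ] with x hx
    rw [dotProduct_dev (μ := μ)]
    change (ψ ⬝ᵥ x.ofLp - m) * (ψ ⬝ᵥ x.ofLp - m) ≤ (1 - 2 * m) * (ψ ⬝ᵥ x.ofLp) + m ^ 2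
    nlinarith [hx.1, hx.2]
  refine hle.trans ?_
  rw [integral_add (hi.const_mul _) (integrable_const _), integral_const_mul, hI]
  simp only [integral_const, probReal_univ, smul_eq_mul, one_mul]
  nlinarith [sq_nonneg (m - 1 / 2)]

/-- One linear observation `V(s)` with conditional mean `⟨ψ, x⟩`: the mean squared error of the
linear estimator with gain `4 Γ ψ`. -/
lemma lintegral_quadForm_linear_estimator {S : Type*} [MeasurableSpace S]
    (hμ : MemLp (fun x => x) 2 μ) {κ : Kernel (EuclideanSpace ℝ (Fin d)) S} [IsMarkovKernel κ]
    {V : S → ℝ} (hV : Measurable V) (hV01 : ∀ s, V s ∈ Set.Icc (0 : ℝ) 1) {ψ : Fin d → ℝ}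
    (hψ : ∀ᵐ x ∂μ, ∫ s, V s ∂(κ x) = ψ ⬝ᵥ x.ofLp) {W : Matrix (Fin d) (Fin d) ℝ}
    (hW : W.PosSemidef) {g : Fin d → ℝ} (hg : g = covMat μ *ᵥ ψ) :
    0 ≤ (W * covMat μ).trace - 4 * (g ⬝ᵥ W *ᵥ g) ∧ ∫⁻ x, ∫⁻ s, ENNReal.ofReal
      ((x.ofLp - (meanVec μ + (4 * (V s - ψ ⬝ᵥ meanVec μ)) • g)) ⬝ᵥ
        W *ᵥ (x.ofLp - (meanVec μ + (4 * (V s - ψ ⬝ᵥ meanVec μ)) • g))) ∂(κ x) ∂μ ≤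
      ENNReal.ofReal ((W * covMat μ).trace - 4 * (g ⬝ᵥ W *ᵥ g)) := by
  obtain ⟨hi, hI⟩ := integral_dotProduct hμ ψ
  set m := ψ ⬝ᵥ meanVec μ
  have hQg := quadForm_nonneg hW g
  set Qg := g ⬝ᵥ W *ᵥ g
  have e : ∀ (x : EuclideanSpace ℝ (Fin d)) (s : S),
      (x.ofLp - (meanVec μ + (4 * (V s - m)) • g)) ⬝ᵥ
        W *ᵥ (x.ofLp - (meanVec μ + (4 * (V s - m)) • g)) =
      dev μ x ⬝ᵥ W *ᵥ dev μ x - 8 * (V s - m) * ((W *ᵥ g) ⬝ᵥ dev μ x) +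
        16 * (V s - m) ^ 2 * Qg := by
    intro x s
    have h := quadForm_sub_smul hW (dev μ x) g (4 * (V s - m))
    have h2 : dev μ x - (4 * (V s - m)) • g = x.ofLp - (meanVec μ + (4 * (V s - m)) • g) := by
      ext i
      simp [dev]
      ring
    rw [h2] at h
    rw [h]
    ring
  -- b bounds the conditional mean of the error given x. The observation is replaced by its
  -- conditional mean ⟨ψ, x⟩, and its square is first bounded by itself.
  let b : EuclideanSpace ℝ (Fin d) → ℝ := fun x =>
    dev μ x ⬝ᵥ W *ᵥ dev μ x - 8 * ((ψ ⬝ᵥ dev μ x) * ((W *ᵥ g) ⬝ᵥ dev μ x)) +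
      16 * Qg * ((1 - 2 * m) * (ψ ⬝ᵥ x.ofLp) + m ^ 2)
  have hVi : ∀ x, Integrable V (κ x) := fun x =>
    Integrable.of_bound hV.aestronglyMeasurable 1 (ae_of_all _ fun s => by
      rw [Real.norm_eq_abs, abs_le]; constructor <;> linarith [(hV01 s).1, (hV01 s).2])
  have hin : ∀ᵐ x ∂μ, ∫⁻ s, ENNReal.ofReal
      ((x.ofLp - (meanVec μ + (4 * (V s - m)) • g)) ⬝ᵥ
        W *ᵥ (x.ofLp - (meanVec μ + (4 * (V s - m)) • g))) ∂(κ x) ≤ ENNReal.ofReal (b x) := by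
    filter_upwards [hψ] with x hx
    let c : ℝ := dev μ x ⬝ᵥ W *ᵥ dev μ x + 8 * m * ((W *ᵥ g) ⬝ᵥ dev μ x) + 16 * m ^ 2 * Qg
    let c' : ℝ := 16 * (1 - 2 * m) * Qg - 8 * ((W *ᵥ g) ⬝ᵥ dev μ x)
    have hci : Integrable (fun s => c' * V s + c) (κ x) :=
      ((hVi x).const_mul _).add (integrable_const _)
    have hpt : ∀ s, (x.ofLp - (meanVec μ + (4 * (V s - m)) • g)) ⬝ᵥ
        W *ᵥ (x.ofLp - (meanVec μ + (4 * (V s - m)) • g)) ≤ c' * V s + c := by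
      intro s
      rw [e]
      have : V s ^ 2 * Qg ≤ V s * Qg := by
        refine mul_le_mul_of_nonneg_right ?_ hQg
        nlinarith [(hV01 s).1, (hV01 s).2]
      simp only [c, c']
      linarith
    calc _ ≤ ∫⁻ s, ENNReal.ofReal (c' * V s + c) ∂(κ x) :=
          lintegral_mono fun s => ENNReal.ofReal_le_ofReal (hpt s)
      _ = ENNReal.ofReal (∫ s, (c' * V s + c) ∂(κ x)) :=
          (ofReal_integral_eq_lintegral_ofReal hci
            (ae_of_all _ fun s => (quadForm_nonneg hW _).trans (hpt s))).symm
      _ = ENNReal.ofReal (b x) := by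
          rw [integral_add ((hVi x).const_mul _) (integrable_const _), integral_const_mul, hx]
          simp only [integral_const, probReal_univ, smul_eq_mul, one_mul, c, c', b]
          rw [dotProduct_dev (μ := μ) ψ x]
          congr 1
          ring
  have hψ01 : ∀ᵐ x ∂μ, ψ ⬝ᵥ x.ofLp ∈ Set.Icc (0 : ℝ) 1 := by
    filter_upwards [hψ] with x hx
    rw [← hx]
    refine ⟨integral_nonneg fun s => (hV01 s).1, ?_⟩
    calc ∫ s, V s ∂(κ x) ≤ ∫ s, 1 ∂(κ x) :=
          integral_mono (hVi x) (integrable_const _) fun s => (hV01 s).2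
      _ = 1 := by simp
  have hi1 := integrable_quadForm_dev hμ W
  have hi2 := (integrable_dotProduct_dev_mul hμ ψ (W *ᵥ g)).const_mul 8
  have hi3 : Integrable (fun x : EuclideanSpace ℝ (Fin d) =>
      16 * Qg * ((1 - 2 * m) * (ψ ⬝ᵥ x.ofLp) + m ^ 2)) μ :=
    ((hi.const_mul _).add (integrable_const _)).const_mul _
  have hbi : Integrable b μ := (hi1.sub hi2).add hi3
  have hb0 : ∀ᵐ x ∂μ, 0 ≤ b x := by
    filter_upwards [hψ01] with x hx
    -- Replacing V(s) by its conditional mean yields a nonnegative squared error, and b exceeds that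
    -- error because (y - m)² ≤ (1 - 2m) y + m².
    have h1 := quadForm_nonneg hW (dev μ x - (4 * (ψ ⬝ᵥ dev μ x)) • g)
    rw [quadForm_sub_smul hW] at h1
    have h2 : (ψ ⬝ᵥ dev μ x) ^ 2 ≤ (1 - 2 * m) * (ψ ⬝ᵥ x.ofLp) + m ^ 2 := by
      rw [dotProduct_dev (μ := μ)]
      change (ψ ⬝ᵥ x.ofLp - m) ^ 2 ≤ _
      nlinarith [hx.1, hx.2]
    have h3 := mul_le_mul_of_nonneg_right h2 hQg
    simp only [b]
    change 0 ≤ _ - _ + _ * Qg at h1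
    linarith
  suffices hle : ∫ x, b x ∂μ ≤ (W * covMat μ).trace - 4 * Qg by
    refine ⟨(integral_nonneg_of_ae hb0).trans hle, (lintegral_mono_ae hin).trans ?_⟩
    rw [← ofReal_integral_eq_lintegral_ofReal hbi hb0]
    exact ENNReal.ofReal_le_ofReal hle
  simp only [b]
  have hi12 : Integrable (fun x => dev μ x ⬝ᵥ W *ᵥ dev μ x -
      8 * ((ψ ⬝ᵥ dev μ x) * ((W *ᵥ g) ⬝ᵥ dev μ x))) μ := hi1.sub hi2
  rw [integral_add hi12 hi3, integral_sub hi1 hi2, integral_quadForm_dev hμ,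
    integral_const_mul, integral_dotProduct_dev_mul hμ, integral_const_mul,
    integral_add (hi.const_mul _) (integrable_const _), integral_const_mul, hI,
    dotProduct_mulVec_comm_of_posSemidef (posSemidef_covMat hμ), ← hg, dotProduct_comm]
  simp only [integral_const, probReal_univ, smul_eq_mul, one_mul]
  -- The variance term is 16 m(1 - m) Qg ≤ 4 Qg. This explains the gain 4 = 1/(1/4): it minimizes
  -- -2cQg + c²Qg/4 over the gain c.
  change _ - 8 * Qg + _ ≤ _
  nlinarith [mul_nonneg hQg (sq_nonneg (m - 1 / 2))]

end Estimation

end LinearMixture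

/-! ### Conditional independence and its stability under messages. -/

namespace LinearMixture

section CondIndep

variable {T T' X Y Y' Z N : Type*} [MeasurableSpace T] [MeasurableSpace T'] [MeasurableSpace X]
  [MeasurableSpace Y] [MeasurableSpace Y'] [MeasurableSpace Z] [MeasurableSpace N]

/-- Under the law `μ` of `(t, x, y)`, the components `x` and `y` are conditionally independent
given `t`. -/
def IsCondIndep (μ : Measure (T × X × Y)) : Prop :=
  ∃ (m : Measure T) (P : Kernel T X) (Q : Kernel T Y), IsProbabilityMeasure m ∧
    IsMarkovKernel P ∧ IsMarkovKernel Q ∧ μ = m ⊗ₘ (P ×ₖ Q)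

lemma lintegral_compProd_prod {m : Measure T} [SFinite m] {P : Kernel T X} {Q : Kernel T Y}
    [IsSFiniteKernel P] [IsSFiniteKernel Q] {f : T × X × Y → ENNReal} (hf : Measurable f) :
    ∫⁻ p, f p ∂(m ⊗ₘ (P ×ₖ Q)) = ∫⁻ t, ∫⁻ x, ∫⁻ y, f (t, x, y) ∂Q t ∂P t ∂m := by
  rw [Measure.lintegral_compProd hf]
  refine lintegral_congr fun t => ?_
  rw [Kernel.prod_apply, lintegral_prod _ (by fun_prop)]

lemma IsCondIndep.swap {μ : Measure (T × X × Y)} (h : IsCondIndep μ) :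
    IsCondIndep (μ.map fun p => (p.1, p.2.2, p.2.1)) := by
  obtain ⟨m, P, Q, hm, hP, hQ, rfl⟩ := h
  refine ⟨m, Q, P, hm, hQ, hP, Measure.ext_of_lintegral _ fun f hf => ?_⟩
  rw [lintegral_map hf (by fun_prop), lintegral_compProd_prod (by fun_prop),
    lintegral_compProd_prod hf]
  refine lintegral_congr fun t => ?_
  exact lintegral_lintegral_swap (by fun_prop)

lemma IsCondIndep.map_right {μ : Measure (T × X × Y)} (h : IsCondIndep μ) {g : Y → Y'}
    (hg : Measurable g) : IsCondIndep (μ.map fun p => (p.1, p.2.1, g p.2.2)) := by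
  obtain ⟨m, P, Q, hm, hP, hQ, rfl⟩ := h
  refine ⟨m, P, Q.map g, hm, hP, Kernel.IsMarkovKernel.map _ hg,
    Measure.ext_of_lintegral _ fun f hf => ?_⟩
  have := Kernel.IsMarkovKernel.map Q hg
  rw [lintegral_map hf (by fun_prop), lintegral_compProd_prod (by fun_prop),
    lintegral_compProd_prod hf]
  refine lintegral_congr fun t => lintegral_congr fun x => ?_
  rw [Kernel.map_apply _ hg, lintegral_map (by fun_prop) hg]

/-- A further component drawn from a kernel that depends on `t` only joins the second one. -/
lemma IsCondIndep.prod_right {μ : Measure (T × X × Y)} (h : IsCondIndep μ) (K : Kernel T Z)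
    [IsMarkovKernel K] :
    IsCondIndep ((μ ⊗ₘ K.comap Prod.fst measurable_fst).map
      fun q => (q.1.1, q.1.2.1, (q.1.2.2, q.2))) := by
  obtain ⟨m, P, Q, hm, hP, hQ, rfl⟩ := h
  refine ⟨m, P, Q ×ₖ K, hm, hP, inferInstance, Measure.ext_of_lintegral _ fun f hf => ?_⟩
  rw [lintegral_map hf (by fun_prop), Measure.lintegral_compProd (by fun_prop),
    lintegral_compProd_prod, lintegral_compProd_prod hf]
  · refine lintegral_congr fun t => lintegral_congr fun x => ?_
    rw [Kernel.prod_apply, lintegral_prod _ (by fun_prop)]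
    rfl
  · exact Measurable.lintegral_kernel_prod_right'
      (κ := K.comap (Prod.fst : T × X × Y → T) measurable_fst) (by fun_prop)
      (f := fun q : (T × X × Y) × Z => f (q.1.1, q.1.2.1, (q.1.2.2, q.2)))

/-- Conditional independence is preserved when a message that is drawn from a kernel in `(t, x)`
is added to the conditioning variable `t`. -/
lemma IsCondIndep.message_left [StandardBorelSpace X] [Nonempty X] {μ : Measure (T × X × Y)}
    (h : IsCondIndep μ) (K : Kernel (T × X) N) [IsMarkovKernel K] {g : T × N → T'}
    (hg : Measurable g) {g' : T' → T × N} (hg' : Measurable g') (hgg : ∀ p, g' (g p) = p) :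
    IsCondIndep ((μ ⊗ₘ K.comap (fun p : T × X × Y => (p.1, p.2.1)) (by fun_prop)).map
      fun q => (g (q.1.1, q.2), q.1.2)) := by
  obtain ⟨m, P, Q, hm, hP, hQ, rfl⟩ := h
  -- The message changes the conditional law of its sender, which is recovered by disintegrating the
  -- law of ((t, n), x) along (t, n). The other party keeps its kernel. Only the sender's space has
  -- to be standard Borel here, so that arbitrary state and action spaces may serve as messages.
  let τ : Measure ((T × N) × X) := ((m ⊗ₘ P) ⊗ₘ K).map fun q => ((q.1.1, q.2), q.1.2)
  have hτm : Measurable fun q : (T × X) × N => ((q.1.1, q.2), q.1.2) := by fun_prop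
  have : IsProbabilityMeasure τ := Measure.isProbabilityMeasure_map hτm.aemeasurable
  refine ⟨τ.fst.map g, τ.condKernel.comap g' hg', Q.comap (fun t => (g' t).1) (by fun_prop),
    Measure.isProbabilityMeasure_map hg.aemeasurable, inferInstance, inferInstance,
    Measure.ext_of_lintegral _ fun f hf => ?_⟩
  have hF : Measurable fun r : (T × N) × X => ∫⁻ y, f (g r.1, r.2, y) ∂(Q r.1.1) :=
    Measurable.lintegral_kernel_prod_right'
      (κ := Q.comap (fun r : (T × N) × X => r.1.1) (by fun_prop))
      (f := fun q : ((T × N) × X) × Y => f (g q.1.1, q.1.2, q.2)) (by fun_prop)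
  have e1 : ∫⁻ p, f p ∂(τ.fst.map g ⊗ₘ ((τ.condKernel.comap g' hg') ×ₖ
      Q.comap (fun t => (g' t).1) (by fun_prop))) =
      ∫⁻ r, ∫⁻ y, f (g r.1, r.2, y) ∂(Q r.1.1) ∂τ := by
    rw [lintegral_compProd_prod hf, lintegral_map _ hg]
    · conv_rhs => rw [← τ.disintegrate τ.condKernel, Measure.lintegral_compProd hF]
      refine lintegral_congr fun r => ?_
      simp only [Kernel.comap_apply, hgg]
    · refine Measurable.lintegral_kernel_prod_right' (κ := τ.condKernel.comap g' hg')
        (f := fun q : T' × X => ∫⁻ y, f (q.1, q.2, y) ∂(Q.comap (fun t => (g' t).1)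
          (by fun_prop) q.1)) ?_
      exact Measurable.lintegral_kernel_prod_right'
        (κ := Q.comap (fun q : T' × X => (g' q.1).1) (by fun_prop))
        (f := fun q : (T' × X) × Y => f (q.1.1, q.1.2, q.2)) (by fun_prop)
  have hK : Measurable fun q : T × X × Y => ∫⁻ n, f (g (q.1, n), q.2) ∂(K (q.1, q.2.1)) :=
    Measurable.lintegral_kernel_prod_right'
      (κ := K.comap (fun p : T × X × Y => (p.1, p.2.1)) (by fun_prop))
      (f := fun q : (T × X × Y) × N => f (g (q.1.1, q.2), q.1.2)) (by fun_prop)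
  have hF2 : Measurable fun q : (T × X) × N => ∫⁻ y, f (g (q.1.1, q.2), q.1.2, y) ∂(Q q.1.1) :=
    hF.comp hτm
  rw [e1, lintegral_map hF hτm, Measure.lintegral_compProd hF2,
    Measure.lintegral_compProd hF2.lintegral_kernel_prod_right',
    lintegral_map hf (by fun_prop), Measure.lintegral_compProd (by fun_prop)]
  simp only [Kernel.comap_apply]
  rw [lintegral_compProd_prod hK]
  refine lintegral_congr fun t => lintegral_congr fun x => ?_
  exact lintegral_lintegral_swap (μ := Q t) (ν := K (t, x)) (f := fun y n => f (g (t, n), x, y))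
    (Measurable.aemeasurable (by fun_prop))

/-- Conditional independence is symmetric, so this is the previous statement with the two parties
exchanged. -/
lemma IsCondIndep.message_right [StandardBorelSpace Y] [Nonempty Y] {μ : Measure (T × X × Y)}
    (h : IsCondIndep μ) (K : Kernel (T × Y) N) [IsMarkovKernel K] {g : T × N → T'}
    (hg : Measurable g) {g' : T' → T × N} (hg' : Measurable g') (hgg : ∀ p, g' (g p) = p) :
    IsCondIndep ((μ ⊗ₘ K.comap (fun p : T × X × Y => (p.1, p.2.2)) (by fun_prop)).map
      fun q => (g (q.1.1, q.2), q.1.2)) := by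
  have : SFinite μ := by
    obtain ⟨m, P, Q, hm, hP, hQ, rfl⟩ := h
    infer_instance
  have h2 := (h.swap.message_left K hg hg' hgg).swap
  convert h2 using 1
  refine Measure.ext_of_lintegral _ fun f hf => ?_
  have hm1 : Measurable fun q : T × X × Y => ∫⁻ n, f (g (q.1, n), q.2) ∂(K (q.1, q.2.2)) :=
    Measurable.lintegral_kernel_prod_right'
      (κ := K.comap (fun p : T × X × Y => (p.1, p.2.2)) (by fun_prop))
      (f := fun q : (T × X × Y) × N => f (g (q.1.1, q.2), q.1.2)) (by fun_prop)
  have hm2 : Measurable fun q : T × Y × X =>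
      ∫⁻ n, f (g (q.1, n), q.2.2, q.2.1) ∂(K (q.1, q.2.1)) :=
    Measurable.lintegral_kernel_prod_right'
      (κ := K.comap (fun p : T × Y × X => (p.1, p.2.1)) (by fun_prop))
      (f := fun q : (T × Y × X) × N => f (g (q.1.1, q.2), q.1.2.2, q.1.2.1)) (by fun_prop)
  rw [lintegral_map hf (by fun_prop), Measure.lintegral_compProd (by fun_prop),
    lintegral_map hf (by fun_prop), lintegral_map (by fun_prop) (by fun_prop),
    Measure.lintegral_compProd (by fun_prop)]
  simp only [Kernel.comap_apply]
  rw [lintegral_map hm2 (by fun_prop)]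

/-- The conditional law of two conditionally independent components is a product. -/
lemma IsCondIndep.ae_eq_prod [StandardBorelSpace X] [Nonempty X] [StandardBorelSpace Y]
    [Nonempty Y] {m : Measure T} [IsProbabilityMeasure m] {η : Kernel T (X × Y)}
    [IsMarkovKernel η] (h : IsCondIndep (m ⊗ₘ η)) :
    ∃ (P : Kernel T X) (Q : Kernel T Y), IsMarkovKernel P ∧ IsMarkovKernel Q ∧
      m ⊗ₘ η = m ⊗ₘ (P ×ₖ Q) ∧ ∀ᵐ t ∂m, η t = (P t).prod (Q t) := by
  obtain ⟨m', P, Q, hm, hP, hQ, e⟩ := h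
  have hm' : m = m' := by
    have := congrArg Measure.fst e
    rwa [Measure.fst_compProd, Measure.fst_compProd] at this
  subst hm'
  refine ⟨P, Q, hP, hQ, e, ?_⟩
  -- Disintegrations into a standard Borel space are unique almost everywhere, so η and the product
  -- kernel agree.
  have h1 := eq_condKernel_of_measure_eq_compProd (ρ := m ⊗ₘ η) η (by rw [Measure.fst_compProd])
  have h2 := eq_condKernel_of_measure_eq_compProd (ρ := m ⊗ₘ η) (P ×ₖ Q)
    (by rw [Measure.fst_compProd]; exact e)
  rw [Measure.fst_compProd] at h1 h2
  filter_upwards [h1, h2] with t h1 h2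
  rw [h1, ← h2, Kernel.prod_apply]

end CondIndep

end LinearMixture

/-! ### Transition kernels and laws of the observations of one episode. -/

namespace LinearMixture

variable {S A : Type*} [MeasurableSpace S] [MeasurableSpace A] {H d : ℕ}

lemma Planner.measurable_policy_apply (pl : Planner S A H d) (Θ : Param H d) (h : Fin H) :
    Measurable (pl.policy Θ h) :=
  (pl.measurable_policy h).comp measurable_prodMk_left

namespace Model

variable (M : Model S A H d)

/-- The transition kernel of stage `h` depends on the parameter through `θ_h` only. -/
lemma transition_congr {h : Fin H} {Θ Θ' : Param H d} (e : Θ h = Θ' h) (x : S × A) :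
    M.transition h (Θ, x) = M.transition h (Θ', x) := by
  have e1 : M.mixture h (Θ, x) = M.mixture h (Θ', x) := by
    rw [mixture, Kernel.withDensity_apply _ (M.measurable_density h),
      Kernel.withDensity_apply _ (M.measurable_density h), Kernel.prodMkLeft_apply,
      Kernel.prodMkLeft_apply]
    simp only [e]
  rw [transition, Kernel.piecewise_apply, Kernel.piecewise_apply]
  simp only [Set.mem_ofPred_eq, e1, Kernel.const_apply]

/-- The density is linear in θ_h, and the inner product commutes with the integral. This makes the
value of the next state a noisy linear observation of θ_h. -/
lemma integral_transition_of_isProper {Θ : Param H d} (hΘ : M.IsProper Θ) (h : Fin H)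
    (x : S × A) {V : S → ℝ} (hV : Measurable V) (hV01 : ∀ s, V s ∈ Set.Icc (0 : ℝ) 1) :
    ∫ s, V s ∂(M.transition h (Θ, x)) = inner ℝ (Θ h) (M.valueFeature V h x) := by
  have hφ : Measurable (M.φ h x) := (M.measurable_φ h).comp measurable_prodMk_left
  have hVφ : Integrable (fun s => V s • M.φ h x s) (M.ν h x) :=
    (M.integrable_φ h x).bdd_smul 1 hV.aestronglyMeasurable (ae_of_all _ fun s => by
      rw [Real.norm_eq_abs, abs_le]; constructor <;> linarith [(hV01 s).1, (hV01 s).2])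
  rw [M.transition_of_isProper hΘ, integral_withDensity_eq_integral_toReal_smul
    (by fun_prop) (ae_of_all _ fun s => ENNReal.ofReal_lt_top), valueFeature,
    ← integral_inner hVφ]
  refine integral_congr_ae ?_
  filter_upwards [(hΘ h x).1] with s hs
  rw [ENNReal.toReal_ofReal hs, inner_smul_right, smul_eq_mul, mul_comm]

/-- The kernel that draws the next state after the observations of stage `h`. -/
def stepKernel (M : Model S A H d) (Θ : Param H d) {π : Fin H → S → A}
    (hπ : ∀ h, Measurable (π h)) (h : ℕ) (hh : h + 1 ≤ H) : Kernel (Obs S A h) S :=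
  (M.transition ⟨h, hh⟩).comap (fun o => (Θ, (o.2, π ⟨h, hh⟩ o.2)))
    (measurable_const.prodMk (measurable_snd.prodMk ((hπ ⟨h, hh⟩).comp measurable_snd)))

instance (Θ : Param H d) {π : Fin H → S → A} (hπ : ∀ h, Measurable (π h)) (h : ℕ)
    (hh : h + 1 ≤ H) : IsMarkovKernel (M.stepKernel Θ hπ h hh) := by
  unfold stepKernel; infer_instance

lemma obsLaw_succ (Θ : Param H d) {π : Fin H → S → A} (hπ : ∀ h, Measurable (π h)) (h : ℕ)
    (hh : h + 1 ≤ H) [IsProbabilityMeasure (M.obsLaw Θ π h (Nat.le_of_succ_le hh))] :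
    M.obsLaw Θ π (h + 1) hh =
      (M.obsLaw Θ π h (Nat.le_of_succ_le hh) ⊗ₘ M.stepKernel Θ hπ h hh).map
        fun q => q.1.extend (π ⟨h, hh⟩ q.1.2) q.2 := by
  have hm : Measurable fun q : Obs S A h × S => q.1.extend (π ⟨h, hh⟩ q.1.2) q.2 :=
    Obs.measurable_extend.comp ((measurable_fst.prodMk ((hπ ⟨h, hh⟩).comp
      (measurable_snd.comp measurable_fst))).prodMk measurable_snd)
  let η : Kernel (Obs S A h) (Obs S A (h + 1)) :=
    (Kernel.id ×ₖ M.stepKernel Θ hπ h hh).map fun q => q.1.extend (π ⟨h, hh⟩ q.1.2) q.2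
  have hη : (fun o : Obs S A h => (M.transition ⟨h, hh⟩ (Θ, (o.2, π ⟨h, hh⟩ o.2))).map
      fun s' => o.extend (π ⟨h, hh⟩ o.2) s') = η := by
    funext o
    rw [Kernel.map_apply _ hm, Kernel.prod_apply, Kernel.id_apply, Measure.dirac_prod,
      Measure.map_map hm measurable_prodMk_left]
    rfl
  rw [obsLaw, hη, Measure.compProd_eq_comp_prod, Measure.map_comp _ _ hm]

lemma isProbabilityMeasure_obsLaw (Θ : Param H d) {π : Fin H → S → A}
    (hπ : ∀ h, Measurable (π h)) (h : ℕ) (hh : h ≤ H) :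
    IsProbabilityMeasure (M.obsLaw Θ π h hh) := by
  induction h with
  | zero =>
    exact Measure.isProbabilityMeasure_map (measurable_const.prodMk measurable_id).aemeasurable
  | succ h ih =>
    have := ih (Nat.le_of_succ_le hh)
    rw [M.obsLaw_succ Θ hπ]
    exact Measure.isProbabilityMeasure_map (Obs.measurable_extend.comp
      ((measurable_fst.prodMk ((hπ ⟨h, hh⟩).comp (measurable_snd.comp measurable_fst))).prodMk
        measurable_snd)).aemeasurable

/-- The law of the observations up to stage `h` depends on `θ_0, …, θ_{h-1}` only. -/
lemma obsLaw_congr {Θ Θ' : Param H d} (π : Fin H → S → A) (h : ℕ) (hh : h ≤ H)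
    (e : ∀ i : Fin H, (i : ℕ) < h → Θ i = Θ' i) : M.obsLaw Θ π h hh = M.obsLaw Θ' π h hh := by
  induction h with
  | zero => rfl
  | succ h ih =>
    rw [obsLaw, obsLaw, ih (Nat.le_of_succ_le hh) fun i hi => e i (Nat.lt_succ_of_lt hi)]
    congr 1
    funext o
    rw [M.transition_congr (e ⟨h, hh⟩ (Nat.lt_succ_self h))]

lemma measurable_extend_policy {h : ℕ} {a : S → A} (ha : Measurable a) :
    Measurable fun q : Obs S A h × S => q.1.extend (a q.1.2) q.2 :=
  Obs.measurable_extend.comp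
    ((measurable_fst.prodMk (ha.comp (measurable_snd.comp measurable_fst))).prodMk measurable_snd)

lemma lintegral_obsLaw_succ (Θ : Param H d) {π : Fin H → S → A} (hπ : ∀ h, Measurable (π h))
    (h : ℕ) (hh : h + 1 ≤ H) {f : Obs S A (h + 1) → ENNReal} (hf : Measurable f) :
    ∫⁻ o, f o ∂(M.obsLaw Θ π (h + 1) hh) =
      ∫⁻ o, ∫⁻ s, f (o.extend (π ⟨h, hh⟩ o.2) s)
        ∂(M.transition ⟨h, hh⟩ (Θ, (o.2, π ⟨h, hh⟩ o.2)))
        ∂(M.obsLaw Θ π h (Nat.le_of_succ_le hh)) := by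
  have := M.isProbabilityMeasure_obsLaw Θ hπ h (Nat.le_of_succ_le hh)
  have hm := measurable_extend_policy (h := h) (hπ ⟨h, hh⟩)
  rw [M.obsLaw_succ Θ hπ, lintegral_map hf hm,
    Measure.lintegral_compProd
      (f := fun q : Obs S A h × S => f (q.1.extend (π ⟨h, hh⟩ q.1.2) q.2)) (hf.comp hm)]
  rfl

lemma integral_obsLaw_succ (Θ : Param H d) {π : Fin H → S → A} (hπ : ∀ h, Measurable (π h))
    (h : ℕ) (hh : h + 1 ≤ H) {f : Obs S A (h + 1) → ℝ} (hf : Measurable f) {C : ℝ}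
    (hC : ∀ o, |f o| ≤ C) :
    ∫ o, f o ∂(M.obsLaw Θ π (h + 1) hh) =
      ∫ o, ∫ s, f (o.extend (π ⟨h, hh⟩ o.2) s)
        ∂(M.transition ⟨h, hh⟩ (Θ, (o.2, π ⟨h, hh⟩ o.2)))
        ∂(M.obsLaw Θ π h (Nat.le_of_succ_le hh)) := by
  have := M.isProbabilityMeasure_obsLaw Θ hπ h (Nat.le_of_succ_le hh)
  have hm := measurable_extend_policy (h := h) (hπ ⟨h, hh⟩)
  rw [M.obsLaw_succ Θ hπ, integral_map hm.aemeasurable hf.aestronglyMeasurable,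
    Measure.integral_compProd]
  · rfl
  · exact Integrable.of_bound (hf.comp hm).aestronglyMeasurable C (ae_of_all _ fun q => hC _)

/-- The state of stage `i ≤ h` in the observations up to stage `h`. -/
def _root_.LinearMixture.Obs.state {h : ℕ} (o : Obs S A h) (i : ℕ) : S :=
  if hi : i < h then (o.1 ⟨i, hi⟩).1 else o.2

omit [MeasurableSpace S] [MeasurableSpace A] in
lemma _root_.LinearMixture.Obs.state_extend {h : ℕ} (o : Obs S A h) (a : A) (s : S) {i : ℕ}
    (hi : i ≤ h) : (o.extend a s).state i = o.state i := by
  unfold Obs.state Obs.extend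
  rcases hi.lt_or_eq with hi | rfl
  · rw [dif_pos (Nat.lt_succ_of_lt hi), dif_pos hi]
    have : (⟨i, Nat.lt_succ_of_lt hi⟩ : Fin (h + 1)) = Fin.castSucc ⟨i, hi⟩ := rfl
    simp only [this, Fin.snoc_castSucc]
  · rw [dif_pos (Nat.lt_succ_self i), dif_neg (lt_irrefl i)]
    have : (⟨i, Nat.lt_succ_self i⟩ : Fin (i + 1)) = Fin.last i := rfl
    simp only [this, Fin.snoc_last]

omit [MeasurableSpace S] [MeasurableSpace A] in
lemma _root_.LinearMixture.Obs.state_extend_self {h : ℕ} (o : Obs S A h) (a : A) (s : S) :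
    (o.extend a s).state (h + 1) = s := by
  simp [Obs.state, Obs.extend]

lemma _root_.LinearMixture.Obs.measurable_state {h : ℕ} (i : ℕ) :
    Measurable fun o : Obs S A h => o.state i := by
  unfold Obs.state
  by_cases hi : i < h
  · simp only [dif_pos hi]
    fun_prop
  · simp only [dif_neg hi]
    fun_prop

/-- The joint law of the state-action pair of stage `h` and the next state. -/
lemma lintegral_obsLaw_stage (Θ : Param H d) {π : Fin H → S → A} (hπ : ∀ h, Measurable (π h))
    (h : Fin H) {f : (S × A) × S → ENNReal} (hf : Measurable f) (j : ℕ) (hj : j ≤ H)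
    (hhj : (h : ℕ) < j) :
    ∫⁻ o, f (o.1 ⟨h, hhj⟩, o.state (h + 1)) ∂(M.obsLaw Θ π j hj) =
      ∫⁻ o, ∫⁻ s, f ((o.2, π h o.2), s) ∂(M.transition h (Θ, (o.2, π h o.2)))
        ∂(M.obsLaw Θ π h h.2.le) := by
  induction j with
  | zero => exact absurd hhj (Nat.not_lt_zero _)
  | succ j ih =>
    have hmj : Measurable fun o : Obs S A (j + 1) => f (o.1 ⟨h, hhj⟩, o.state (h + 1)) := by
      refine hf.comp (Measurable.prodMk ?_ (Obs.measurable_state _))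
      fun_prop
    rw [M.lintegral_obsLaw_succ Θ hπ j hj hmj]
    rcases (Nat.lt_succ_iff.1 hhj).lt_or_eq with hlt | heq
    · rw [← ih (Nat.le_of_succ_le hj) hlt]
      refine lintegral_congr fun o => ?_
      have : (⟨h, hhj⟩ : Fin (j + 1)) = Fin.castSucc ⟨h, hlt⟩ := rfl
      simp only [Obs.state_extend _ _ _ (Nat.succ_le_of_lt hlt), this]
      simp only [Obs.extend, Fin.snoc_castSucc, lintegral_const, measure_univ, mul_one]
    · obtain ⟨h, hh⟩ := h
      obtain rfl : h = j := heq
      refine lintegral_congr fun o => lintegral_congr fun s => ?_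
      have : (⟨h, hhj⟩ : Fin (h + 1)) = Fin.last h := rfl
      simp only [Obs.state_extend_self, this]
      simp only [Obs.extend, Fin.snoc_last]

end Model

end LinearMixture

/-! ### Value functions, the Bellman equation and the simulation lemma. -/

namespace LinearMixture

variable {S A : Type*} [MeasurableSpace S] [MeasurableSpace A] {H d : ℕ}

namespace Model

variable (M : Model S A H d) (pl : Planner S A H d)

/-- The kernel `(Θ, Θ') ↦` law of the observations up to stage `h` in `M(Θ)` under the policy
planned for `Θ'`. -/
def obsKernel (h : ℕ) (hh : h ≤ H) : Kernel (Param H d × Param H d) (Obs S A h) where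
  toFun p := M.obsLaw p.1 (pl.policy p.2) h hh
  measurable' := by
    obtain ⟨κ, -, hκ⟩ := M.exists_obsKernel pl h hh
    have e : (fun p : Param H d × Param H d => M.obsLaw p.1 (pl.policy p.2) h hh) = κ :=
      funext fun p => (hκ p).symm
    rw [e]
    exact κ.measurable

lemma obsKernel_apply (h : ℕ) (hh : h ≤ H) (p : Param H d × Param H d) :
    M.obsKernel pl h hh p = M.obsLaw p.1 (pl.policy p.2) h hh := rfl

instance (h : ℕ) (hh : h ≤ H) : IsMarkovKernel (M.obsKernel pl h hh) :=
  ⟨fun p => M.isProbabilityMeasure_obsLaw p.1 (pl.measurable_policy_apply p.2) h hh⟩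

/-- The value of the last `n` stages in `M(Θ)` under the policy planned for `Θ`. -/
def valueToGo : ℕ → Param H d → S → ℝ
  | 0 => fun _ _ => 0
  | n + 1 => fun Θ s =>
      -- Recursion on the number of remaining stages: n + 1 of them start at stage H - 1 - n. The
      -- default 0 is never reached from `stageValue`, where at most H stages remain.
      if hn : n < H then
        M.R ⟨H - 1 - n, by omega⟩ (s, pl.policy Θ ⟨H - 1 - n, by omega⟩ s) +
          ∫ s', valueToGo n Θ s' ∂(M.transition ⟨H - 1 - n, by omega⟩
            (Θ, (s, pl.policy Θ ⟨H - 1 - n, by omega⟩ s)))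
      else 0

/-- The state value function of stage `i` in `M(Θ)` under the policy planned for `Θ`. -/
def stageValue (i : ℕ) (Θ : Param H d) (s : S) : ℝ := M.valueToGo pl (H - i) Θ s

lemma measurable_valueToGo (n : ℕ) :
    Measurable fun p : Param H d × S => M.valueToGo pl n p.1 p.2 := by
  induction n with
  | zero => exact measurable_const
  | succ n ih =>
    simp only [valueToGo]
    by_cases hn : n < H
    · simp only [dif_pos hn]
      have hx : Measurable fun p : Param H d × S =>
          (p.2, pl.policy p.1 ⟨H - 1 - n, by omega⟩ p.2) :=
        measurable_snd.prodMk (pl.measurable_policy _)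
      refine ((M.measurable_R _).comp hx).add ?_
      exact (StronglyMeasurable.integral_kernel_prod_right'
        (κ := (M.transition ⟨H - 1 - n, by omega⟩).comap _ (measurable_fst.prodMk hx))
        (f := fun q : (Param H d × S) × S => M.valueToGo pl n q.1.1 q.2)
        (ih.comp ((measurable_fst.comp measurable_fst).prodMk
          measurable_snd)).stronglyMeasurable).measurable
    · simp only [dif_neg hn]
      exact measurable_const

lemma valueToGo_mem (n : ℕ) (Θ : Param H d) (s : S) :
    M.valueToGo pl n Θ s ∈ Set.Icc (0 : ℝ) n := by
  induction n generalizing s with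
  | zero => simp [valueToGo]
  | succ n ih =>
    simp only [valueToGo]
    split_ifs with hn
    · have hR := M.R_mem ⟨H - 1 - n, by omega⟩ (s, pl.policy Θ ⟨H - 1 - n, by omega⟩ s)
      set κ := M.transition ⟨H - 1 - n, by omega⟩
        (Θ, (s, pl.policy Θ ⟨H - 1 - n, by omega⟩ s))
      have h0 : 0 ≤ ∫ s', M.valueToGo pl n Θ s' ∂κ := integral_nonneg fun s' => (ih s').1
      have h1 : ∫ s', M.valueToGo pl n Θ s' ∂κ ≤ n := by
        calc _ ≤ ∫ _, (n : ℝ) ∂κ := by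
              refine integral_mono_of_nonneg (ae_of_all _ fun s' => (ih s').1)
                (integrable_const _) (ae_of_all _ fun s' => (ih s').2)
          _ = n := by simp
      constructor
      · linarith [hR.1]
      · push_cast
        linarith [hR.2]
    · simp only [Set.mem_Icc, le_refl, true_and]
      positivity

lemma measurable_stageValue (i : ℕ) :
    Measurable fun p : Param H d × S => M.stageValue pl i p.1 p.2 :=
  M.measurable_valueToGo pl _

lemma measurable_stageValue_apply (i : ℕ) (Θ : Param H d) : Measurable (M.stageValue pl i Θ) :=
  (M.measurable_stageValue pl i).comp measurable_prodMk_left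

lemma stageValue_mem (i : ℕ) (Θ : Param H d) (s : S) :
    M.stageValue pl i Θ s ∈ Set.Icc (0 : ℝ) (H - i : ℕ) :=
  M.valueToGo_mem pl _ Θ s

lemma abs_stageValue_le (i : ℕ) (Θ : Param H d) (s : S) : |M.stageValue pl i Θ s| ≤ H := by
  obtain ⟨h0, h1⟩ := M.stageValue_mem pl i Θ s
  rw [abs_of_nonneg h0]
  exact h1.trans (by exact_mod_cast Nat.sub_le H i)

/-- The Bellman equation. -/
lemma stageValue_eq (h : Fin H) (Θ : Param H d) (s : S) :
    M.stageValue pl h Θ s = M.R h (s, pl.policy Θ h s) +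
      ∫ s', M.stageValue pl (h + 1) Θ s' ∂(M.transition h (Θ, (s, pl.policy Θ h s))) := by
  obtain ⟨h, hh⟩ := h
  obtain ⟨n, hn⟩ : ∃ n, H - h = n + 1 := ⟨H - h - 1, by omega⟩
  have hn' : H - (h + 1) = n := by omega
  have hnH : n < H := by omega
  have hi : (⟨H - 1 - n, by omega⟩ : Fin H) = ⟨h, hh⟩ := Fin.ext (by simp; omega)
  simp only [stageValue, hn, hn', valueToGo, dif_pos hnH, hi]

/-- The largest possible value after stage `h`. -/
def scale (h : Fin H) : ℝ := ((H - (h + 1) : ℕ) : ℝ)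

/-- The state value function of stage `h + 1`, normalized to take values in `[0, 1]`. -/
def nextValue (h : Fin H) (Θ : Param H d) (s : S) : ℝ :=
  M.stageValue pl (h + 1) Θ s / scale h

lemma stageValue_succ_eq (h : Fin H) (Θ : Param H d) (s : S) :
    M.stageValue pl (h + 1) Θ s = scale h * M.nextValue pl h Θ s := by
  unfold nextValue
  -- After the last stage the scale is 0 and the normalized value is the junk quotient 0; the value
  -- itself also vanishes there.
  rcases eq_or_ne (scale h) 0 with h0 | h0
  · have := M.stageValue_mem pl (h + 1) Θ s
    change _ ∈ Set.Icc 0 (scale h) at this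
    rw [h0] at this ⊢
    rw [zero_mul]
    exact le_antisymm this.2 this.1
  · field_simp

lemma nextValue_mem (h : Fin H) (Θ : Param H d) (s : S) :
    M.nextValue pl h Θ s ∈ Set.Icc (0 : ℝ) 1 := by
  have h1 := M.stageValue_mem pl (h + 1) Θ s
  exact ⟨div_nonneg h1.1 (Nat.cast_nonneg _), div_le_one_of_le₀ h1.2 (Nat.cast_nonneg _)⟩

lemma measurable_nextValue (h : Fin H) :
    Measurable fun p : Param H d × S => M.nextValue pl h p.1 p.2 :=
  (M.measurable_stageValue pl _).div_const _

lemma measurable_nextValue_apply (h : Fin H) (Θ : Param H d) : Measurable (M.nextValue pl h Θ) :=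
  (M.measurable_nextValue pl h).comp measurable_prodMk_left

/-- The value-correlated feature of the normalized value function after stage `h`. -/
def nextFeature (h : Fin H) (Θ : Param H d) (x : S × A) : EuclideanSpace ℝ (Fin d) :=
  M.valueFeature (M.nextValue pl h Θ) h x

lemma measurable_nextFeature (h : Fin H) :
    Measurable fun p : Param H d × (S × A) => M.nextFeature pl h p.1 p.2 := by
  refine (StronglyMeasurable.integral_kernel_prod_right'
    (κ := Kernel.prodMkLeft (Param H d) (M.ν h))
    (f := fun q : (Param H d × (S × A)) × S =>
      M.nextValue pl h q.1.1 q.2 • M.φ h q.1.2 q.2) ?_).measurable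
  have h1 : Measurable fun q : (Param H d × (S × A)) × S => M.nextValue pl h q.1.1 q.2 :=
    (M.measurable_nextValue pl h).comp
      ((measurable_fst.comp measurable_fst).prodMk measurable_snd)
  have h2 : Measurable fun q : (Param H d × (S × A)) × S => M.φ h q.1.2 q.2 :=
    (M.measurable_φ h).comp ((measurable_snd.comp measurable_fst).prodMk measurable_snd)
  exact (h1.smul h2).stronglyMeasurable

variable {M} in
lemma norm_nextFeature_le (hM : M.BoundedFeatures) (h : Fin H) (Θ : Param H d) (x : S × A) :
    ‖M.nextFeature pl h Θ x‖ ≤ 1 :=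
  hM _ (M.measurable_nextValue_apply pl h Θ) (M.nextValue_mem pl h Θ) h x

lemma integral_nextValue_of_isProper {Θ : Param H d} (hΘ : M.IsProper Θ) (Θ' : Param H d)
    (h : Fin H) (x : S × A) :
    ∫ s, M.nextValue pl h Θ' s ∂(M.transition h (Θ, x)) =
      inner ℝ (Θ h) (M.nextFeature pl h Θ' x) :=
  M.integral_transition_of_isProper hΘ h x (M.measurable_nextValue_apply pl h Θ')
    (M.nextValue_mem pl h Θ')

/-- The mean rewards collected before stage `j`. -/
def partialReward (j : ℕ) (hj : j ≤ H) (o : Obs S A j) : ℝ :=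
  ∑ i : Fin j, M.R (Fin.castLE hj i) (o.1 i)

lemma measurable_partialReward (j : ℕ) (hj : j ≤ H) : Measurable (M.partialReward j hj) := by
  refine Finset.measurable_sum _ fun i _ => (M.measurable_R _).comp ?_
  fun_prop

lemma abs_partialReward_le (j : ℕ) (hj : j ≤ H) (o : Obs S A j) :
    |M.partialReward j hj o| ≤ j := by
  refine (Finset.abs_sum_le_sum_abs _ _).trans ?_
  calc _ ≤ ∑ _i : Fin j, (1 : ℝ) := Finset.sum_le_sum fun i _ => by
        have := M.R_mem (Fin.castLE hj i) (o.1 i)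
        rw [abs_of_nonneg this.1]
        exact this.2
    _ = j := by simp

lemma partialReward_extend (j : ℕ) (hj : j + 1 ≤ H) (o : Obs S A j) (a : A) (s : S) :
    M.partialReward (j + 1) hj (o.extend a s) =
      M.partialReward j (Nat.le_of_succ_le hj) o + M.R ⟨j, hj⟩ (o.2, a) := by
  unfold partialReward
  rw [Fin.sum_univ_castSucc]
  simp only [Obs.extend, Fin.snoc_castSucc, Fin.snoc_last]
  rfl

/-- The one-stage difference of the value functions of `Θ'` under the transition kernels of `Θ'`
and of `Θ`. -/
def bellmanError (h : Fin H) (Θ Θ' : Param H d) (o : Obs S A h) : ℝ :=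
  ∫ s, M.stageValue pl (h + 1) Θ' s ∂(M.transition h (Θ', (o.2, pl.policy Θ' h o.2))) -
    ∫ s, M.stageValue pl (h + 1) Θ' s ∂(M.transition h (Θ, (o.2, pl.policy Θ' h o.2)))

lemma measurable_integral_stageValue (i : ℕ) (h : Fin H) (Θ Θ' : Param H d) :
    Measurable fun s : S => ∫ s', M.stageValue pl i Θ' s'
      ∂(M.transition h (Θ, (s, pl.policy Θ' h s))) := by
  refine (StronglyMeasurable.integral_kernel_prod_right'
    (κ := (M.transition h).comap (fun s : S => (Θ, (s, pl.policy Θ' h s)))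
      (measurable_const.prodMk (measurable_id.prodMk (pl.measurable_policy_apply Θ' h))))
    (f := fun q : S × S => M.stageValue pl i Θ' q.2)
    ((M.measurable_stageValue_apply pl i Θ').comp measurable_snd).stronglyMeasurable).measurable

lemma abs_integral_stageValue_le (i : ℕ) (Θ' : Param H d) (κ : Measure S)
    [IsProbabilityMeasure κ] : |∫ s', M.stageValue pl i Θ' s' ∂κ| ≤ H := by
  have := norm_integral_le_of_norm_le_const (μ := κ)
    (ae_of_all _ fun s => (Real.norm_eq_abs _).trans_le (M.abs_stageValue_le pl i Θ' s))
  simpa using this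

/-- One step of a telescoping sum. The Bellman equation moves the reward of stage j into the
collected rewards. The remaining value was computed with the transitions of Θ', whereas the state
moves by those of Θ; the Bellman error is the discrepancy. -/
lemma integral_partialReward_add_stageValue (Θ Θ' : Param H d) (j : ℕ) (hj : j + 1 ≤ H) :
    ∫ o, (M.partialReward j (Nat.le_of_succ_le hj) o + M.stageValue pl j Θ' o.2)
        ∂(M.obsLaw Θ (pl.policy Θ') j (Nat.le_of_succ_le hj)) =
      ∫ o, (M.partialReward (j + 1) hj o + M.stageValue pl (j + 1) Θ' o.2)
        ∂(M.obsLaw Θ (pl.policy Θ') (j + 1) hj) +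
      ∫ o, M.bellmanError pl ⟨j, hj⟩ Θ Θ' o
        ∂(M.obsLaw Θ (pl.policy Θ') j (Nat.le_of_succ_le hj)) := by
  have hπ := pl.measurable_policy_apply Θ'
  have := M.isProbabilityMeasure_obsLaw Θ hπ j (Nat.le_of_succ_le hj)
  set μ := M.obsLaw Θ (pl.policy Θ') j (Nat.le_of_succ_le hj)
  have hsv : ∀ (κ : Measure S) [IsProbabilityMeasure κ],
      Integrable (M.stageValue pl (j + 1) Θ') κ := fun κ _ =>
    Integrable.of_bound (M.measurable_stageValue_apply pl _ Θ').aestronglyMeasurable H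
      (ae_of_all _ fun s => M.abs_stageValue_le pl _ Θ' s)
  rw [M.integral_obsLaw_succ Θ hπ j hj (C := H + H)]
  · have hin : ∀ o : Obs S A j, ∫ s, (M.partialReward (j + 1) hj
        (o.extend (pl.policy Θ' ⟨j, hj⟩ o.2) s) +
          M.stageValue pl (j + 1) Θ' (o.extend (pl.policy Θ' ⟨j, hj⟩ o.2) s).2)
          ∂(M.transition ⟨j, hj⟩ (Θ, (o.2, pl.policy Θ' ⟨j, hj⟩ o.2))) =
        M.partialReward j (Nat.le_of_succ_le hj) o +
          M.R ⟨j, hj⟩ (o.2, pl.policy Θ' ⟨j, hj⟩ o.2) +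
          ∫ s, M.stageValue pl (j + 1) Θ' s
            ∂(M.transition ⟨j, hj⟩ (Θ, (o.2, pl.policy Θ' ⟨j, hj⟩ o.2))) := by
      intro o
      simp only [partialReward_extend]
      have := integral_add (μ := M.transition ⟨j, hj⟩ (Θ, (o.2, pl.policy Θ' ⟨j, hj⟩ o.2)))
        (integrable_const (M.partialReward j (Nat.le_of_succ_le hj) o +
          M.R ⟨j, hj⟩ (o.2, pl.policy Θ' ⟨j, hj⟩ o.2))) (hsv _)
      rw [integral_const, probReal_univ, one_smul] at this
      exact this
    simp only [hin]
    rw [← integral_add]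
    · refine integral_congr_ae (ae_of_all _ fun o => ?_)
      have := M.stageValue_eq pl ⟨j, hj⟩ Θ' o.2
      simp only [bellmanError]
      rw [this]
      ring
    · refine Integrable.of_bound (Measurable.aestronglyMeasurable ?_) (H + 1 + H)
        (ae_of_all _ fun o => ?_)
      · refine ((M.measurable_partialReward _ _).add ((M.measurable_R _).comp
          (measurable_snd.prodMk ((hπ _).comp measurable_snd)))).add ?_
        exact (M.measurable_integral_stageValue pl (j + 1) ⟨j, hj⟩ Θ Θ').comp measurable_snd
      · rw [Real.norm_eq_abs]
        refine (abs_add_le _ _).trans (add_le_add ((abs_add_le _ _).trans (add_le_add ?_ ?_)) ?_)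
        · exact (M.abs_partialReward_le _ _ o).trans
            (by exact_mod_cast Nat.le_of_succ_le hj)
        · have := M.R_mem ⟨j, hj⟩ (o.2, pl.policy Θ' ⟨j, hj⟩ o.2)
          rw [abs_of_nonneg this.1]
          exact this.2
        · exact M.abs_integral_stageValue_le pl _ _ _
    · refine Integrable.of_bound (Measurable.aestronglyMeasurable ?_) (H + H)
        (ae_of_all _ fun o => ?_)
      · exact ((M.measurable_integral_stageValue pl (j + 1) ⟨j, hj⟩ Θ' Θ').comp
          measurable_snd).sub
          ((M.measurable_integral_stageValue pl (j + 1) ⟨j, hj⟩ Θ Θ').comp measurable_snd)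
      · rw [Real.norm_eq_abs]
        exact (abs_sub _ _).trans (add_le_add (M.abs_integral_stageValue_le pl _ _ _)
          (M.abs_integral_stageValue_le pl _ _ _))
  · exact (M.measurable_partialReward _ _).add
      ((M.measurable_stageValue_apply pl _ Θ').comp measurable_snd)
  · intro o
    exact (abs_add_le _ _).trans (add_le_add ((M.abs_partialReward_le _ _ o).trans
      (by exact_mod_cast hj)) (M.abs_stageValue_le pl _ Θ' _))

/-- Telescoping over all stages: at stage 0 nothing has been collected, and at stage H no value is
left. The left side does not involve Θ, so two choices of Θ can be compared. -/
lemma value_add_sum_bellmanError (Θ Θ' : Param H d) :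
    ∫ s, M.stageValue pl 0 Θ' s ∂M.ρ = M.value Θ (pl.policy Θ') +
      ∑ h : Fin H, ∫ o, M.bellmanError pl h Θ Θ' o
        ∂(M.obsLaw Θ (pl.policy Θ') h h.2.le) := by
  have key : ∀ (j : ℕ) (hj : j ≤ H), ∫ s, M.stageValue pl 0 Θ' s ∂M.ρ =
      ∫ o, (M.partialReward j hj o + M.stageValue pl j Θ' o.2)
        ∂(M.obsLaw Θ (pl.policy Θ') j hj) +
      ∑ i : Fin j, ∫ o, M.bellmanError pl (Fin.castLE hj i) Θ Θ' o
        ∂(M.obsLaw Θ (pl.policy Θ') i (i.2.le.trans hj)) := by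
    intro j
    induction j with
    | zero =>
      intro hj
      rw [obsLaw, integral_map]
      · simp [partialReward]
      · exact (measurable_const.prodMk measurable_id).aemeasurable
      · exact ((M.measurable_partialReward _ _).add
          ((M.measurable_stageValue_apply pl _ Θ').comp measurable_snd)).aestronglyMeasurable
    | succ j ih =>
      intro hj
      rw [ih (Nat.le_of_succ_le hj), M.integral_partialReward_add_stageValue pl Θ Θ' j hj,
        Fin.sum_univ_castSucc, add_assoc, add_comm (∑ _, _)]
      rfl
  have h := key H le_rfl
  have h0 : ∀ s, M.stageValue pl H Θ' s = 0 := fun s => by simp [stageValue, valueToGo]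
  simp only [h0, add_zero] at h
  exact h

/-- The simulation lemma: the values of a policy in two MDPs differ by the sum of the expected
one-stage differences. -/
lemma value_sub_value {Θ Θ' : Param H d} (hΘ : M.IsProper Θ) (hΘ' : M.IsProper Θ') :
    M.value Θ' (pl.policy Θ') - M.value Θ (pl.policy Θ') =
      ∑ h : Fin H, ∫ o, scale h * inner ℝ (Θ' h - Θ h)
          (M.nextFeature pl h Θ' (o.2, pl.policy Θ' h o.2))
        ∂(M.obsLaw Θ (pl.policy Θ') h h.2.le) := by
  have h1 := M.value_add_sum_bellmanError pl Θ Θ'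
  -- When both parameters coincide the Bellman errors vanish, which identifies the left side as the
  -- value in M(Θ').
  have h2 := M.value_add_sum_bellmanError pl Θ' Θ'
  have h3 : ∀ h : Fin H, ∫ o, M.bellmanError pl h Θ' Θ' o
      ∂(M.obsLaw Θ' (pl.policy Θ') h h.2.le) = 0 := fun h => by simp [bellmanError]
  simp only [h3, Finset.sum_const_zero, add_zero] at h2
  rw [← h2, h1, add_sub_cancel_left]
  refine Finset.sum_congr rfl fun h _ => integral_congr_ae (ae_of_all _ fun o => ?_)
  simp only [bellmanError, stageValue_succ_eq, integral_const_mul]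
  rw [M.integral_nextValue_of_isProper pl hΘ, M.integral_nextValue_of_isProper pl hΘ',
    inner_sub_left]
  ring

end Model

end LinearMixture

/-! ### Features in coordinates and the prediction variance. -/

namespace LinearMixture

open Matrix

variable {S A : Type*} [MeasurableSpace S] [MeasurableSpace A] {H d : ℕ}

/-- The parameter `Θ` with the component `θ_h` erased. -/
def Param.erase (h : Fin H) (Θ : Param H d) : Param H d := Function.update Θ h 0

lemma Param.measurable_erase (h : Fin H) : Measurable (Param.erase (d := d) h) := by
  refine measurable_pi_lambda _ fun i => ?_
  rcases eq_or_ne i h with rfl | hi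
  · simp [Param.erase]
  · simp only [Param.erase, Function.update_of_ne hi]
    fun_prop

lemma Param.erase_of_ne {h i : Fin H} (hi : i ≠ h) (Θ : Param H d) : Param.erase h Θ i = Θ i :=
  Function.update_of_ne hi _ _

/-- The law of `θ_h`. -/
def marginal (P : Measure (Param H d)) (h : Fin H) : Measure (EuclideanSpace ℝ (Fin d)) :=
  P.map fun Θ => Θ h

instance (P : Measure (Param H d)) [IsProbabilityMeasure P] (h : Fin H) :
    IsProbabilityMeasure (marginal P h) :=
  Measure.isProbabilityMeasure_map (measurable_pi_apply h).aemeasurable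

lemma memLp_marginal {P : Measure (Param H d)} {h : Fin H}
    (hP : MemLp (fun Θ : Param H d => Θ h) 2 P) : MemLp (fun x => x) 2 (marginal P h) :=
  (memLp_map_measure_iff aestronglyMeasurable_id (measurable_pi_apply h).aemeasurable).2 hP

namespace Model

variable (M : Model S A H d) (pl : Planner S A H d)

/-- The coordinates of the value-correlated feature of the normalized value function. -/
def featVec (h : Fin H) (Θ : Param H d) (x : S × A) : Fin d → ℝ := (M.nextFeature pl h Θ x).ofLp

lemma measurable_featVec (h : Fin H) (i : Fin d) :
    Measurable fun p : Param H d × (S × A) => M.featVec pl h p.1 p.2 i := by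
  have : Measurable fun v : EuclideanSpace ℝ (Fin d) => v i := by fun_prop
  exact this.comp (M.measurable_nextFeature pl h)

/-- The state-action pair of stage `h` under the policy planned for `Θ'`. -/
def stageInput (h : Fin H) (q : (Param H d × Param H d) × Obs S A h) : S × A :=
  (q.2.2, pl.policy q.1.2 h q.2.2)

lemma measurable_stageInput (h : Fin H) : Measurable (stageInput pl h) := by
  have h2 : Measurable fun q : (Param H d × Param H d) × Obs S A h => q.2.2 := by fun_prop
  have h3 : Measurable fun q : (Param H d × Param H d) × Obs S A h => q.1.2 := by fun_prop
  exact h2.prodMk ((pl.measurable_policy h).comp (h3.prodMk h2))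

variable {M} in
lemma featVec_dotProduct_self_le (hM : M.BoundedFeatures) (h : Fin H) (Θ : Param H d)
    (x : S × A) : M.featVec pl h Θ x ⬝ᵥ M.featVec pl h Θ x ≤ 1 := by
  have h1 := norm_nextFeature_le pl hM h Θ x
  have h2 : M.featVec pl h Θ x ⬝ᵥ M.featVec pl h Θ x = ‖M.nextFeature pl h Θ x‖ ^ 2 := by
    rw [EuclideanSpace.norm_sq_eq, dotProduct]
    refine Finset.sum_congr rfl fun i _ => ?_
    rw [Real.norm_eq_abs, sq_abs, sq]
    rfl
  rw [h2]
  exact pow_le_one₀ (norm_nonneg _) h1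

lemma inner_nextFeature (h : Fin H) (Θ : Param H d) (x : S × A)
    (v : EuclideanSpace ℝ (Fin d)) :
    inner ℝ v (M.nextFeature pl h Θ x) = M.featVec pl h Θ x ⬝ᵥ v.ofLp := by
  rw [EuclideanSpace.inner_eq_star_dotProduct, star_trivial]
  rfl

/-- The prediction variance of `⟨θ_h, φ_V(x)⟩` under `P`. -/
def predVar (P : Measure (Param H d)) (h : Fin H) (Θ : Param H d) (x : S × A) : ℝ :=
  M.featVec pl h Θ x ⬝ᵥ covMat (marginal P h) *ᵥ M.featVec pl h Θ x

lemma measurable_predVar (P : Measure (Param H d)) (h : Fin H) :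
    Measurable fun p : Param H d × (S × A) => M.predVar pl P h p.1 p.2 := by
  simp only [predVar, quadForm_eq_sum]
  exact Finset.measurable_sum _ fun i _ => Finset.measurable_sum _ fun j _ =>
    ((M.measurable_featVec pl h i).mul (M.measurable_featVec pl h j)).const_mul _

section Posterior

variable {P : Measure (Param H d)}

/-- The transition kernel of stage `h` as a kernel in `θ_h`. -/
def coordTransition (h : Fin H) : Kernel (EuclideanSpace ℝ (Fin d) × (S × A)) S :=
  (M.transition h).comap (fun q => ((fun _ => q.1 : Param H d), q.2))
    ((measurable_pi_lambda _ fun _ => measurable_fst).prodMk measurable_snd)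

instance (h : Fin H) : IsMarkovKernel (M.coordTransition h) := by
  unfold coordTransition; infer_instance

lemma coordTransition_apply (h : Fin H) (Θ : Param H d) (x : S × A) :
    M.coordTransition h (Θ h, x) = M.transition h (Θ, x) := by
  rw [coordTransition, Kernel.comap_apply]
  exact M.transition_congr (Θ := fun _ => Θ h) (Θ' := Θ) rfl x

/-- Properness concerns the whole parameter, but both sides depend on θ_h only, so the identity
passes to the marginal law. -/
lemma ae_marginal_integral_nextValue (hproper : ∀ᵐ Θ ∂P, M.IsProper Θ)
    (h : Fin H) (Θ' : Param H d) (x : S × A) :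
    ∀ᵐ θ ∂(marginal P h), ∫ s, M.nextValue pl h Θ' s ∂(M.coordTransition h (θ, x)) =
      M.featVec pl h Θ' x ⬝ᵥ θ.ofLp := by
  have hm : Measurable fun θ : EuclideanSpace ℝ (Fin d) =>
      ∫ s, M.nextValue pl h Θ' s ∂(M.coordTransition h (θ, x)) :=
    (StronglyMeasurable.integral_kernel_prod_right'
      (κ := (M.coordTransition h).comap (fun θ => (θ, x)) measurable_prodMk_right)
      (f := fun q : EuclideanSpace ℝ (Fin d) × S => M.nextValue pl h Θ' q.2)
      ((M.measurable_nextValue_apply pl h Θ').comp measurable_snd).stronglyMeasurable).measurable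
  have hm2 : Measurable fun θ : EuclideanSpace ℝ (Fin d) => M.featVec pl h Θ' x ⬝ᵥ θ.ofLp := by
    simp only [dotProduct]
    fun_prop
  refine (ae_map_iff (measurable_pi_apply h).aemeasurable (measurableSet_eq_fun hm hm2)).2 ?_
  filter_upwards [hproper] with Θ hΘ
  rw [coordTransition_apply, M.integral_nextValue_of_isProper pl hΘ, inner_nextFeature]

lemma ae_marginal_dotProduct_mem (hproper : ∀ᵐ Θ ∂P, M.IsProper Θ)
    (h : Fin H) (Θ' : Param H d) (x : S × A) :
    ∀ᵐ θ ∂(marginal P h), M.featVec pl h Θ' x ⬝ᵥ θ.ofLp ∈ Set.Icc (0 : ℝ) 1 := by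
  filter_upwards [M.ae_marginal_integral_nextValue pl hproper h Θ' x] with θ hθ
  rw [← hθ]
  refine ⟨integral_nonneg fun s => (M.nextValue_mem pl h Θ' s).1, ?_⟩
  have : ∫ s, M.nextValue pl h Θ' s ∂(M.coordTransition h (θ, x)) ≤
      ∫ _, (1 : ℝ) ∂(M.coordTransition h (θ, x)) :=
    integral_mono_of_nonneg (ae_of_all _ fun s => (M.nextValue_mem pl h Θ' s).1)
      (integrable_const _) (ae_of_all _ fun s => (M.nextValue_mem pl h Θ' s).2)
  simpa using this

/-- For a proper parameter the inner product of θ_h with the feature is a mean of a function with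
values in [0, 1]. Its variance is therefore at most 1/4. -/
lemma predVar_mem [IsProbabilityMeasure P] (hproper : ∀ᵐ Θ ∂P, M.IsProper Θ) {h : Fin H}
    (hmoment : MemLp (fun Θ : Param H d => Θ h) 2 P) (Θ' : Param H d) (x : S × A) :
    M.predVar pl P h Θ' x ∈ Set.Icc (0 : ℝ) (1 / 4) :=
  ⟨quadForm_nonneg (posSemidef_covMat (memLp_marginal hmoment)) _,
    quadForm_covMat_le (memLp_marginal hmoment)
      (M.ae_marginal_dotProduct_mem pl hproper h Θ' x)⟩

end Posterior

end Model

end LinearMixture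

/-! ### The decoupling inequality. -/

namespace LinearMixture

open Matrix

variable {S A : Type*} [MeasurableSpace S] [MeasurableSpace A] {H d : ℕ}

namespace Model

variable (M : Model S A H d) (pl : Planner S A H d)

/-- The expected prediction variance at stage `h` of an episode in which the true and the planning
parameters are drawn independently from `P`. -/
def expPredVar (P : Measure (Param H d)) (h : Fin H) : ENNReal :=
  ∫⁻ p, ∫⁻ o, ENNReal.ofReal (M.predVar pl P h p.2 (stageInput pl h (p, o)))
    ∂(M.obsKernel pl h h.2.le p) ∂(P.prod P)

lemma measurable_predVar_stageInput (P : Measure (Param H d)) (h : Fin H) :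
    Measurable fun q : (Param H d × Param H d) × Obs S A h =>
      M.predVar pl P h q.1.2 (stageInput pl h q) :=
  (M.measurable_predVar pl P h).comp
    ((measurable_snd.comp measurable_fst).prodMk (measurable_stageInput pl h))

/-- The expected value difference contributed by stage `h`. -/
def stageGap (h : Fin H) (p : Param H d × Param H d) : ℝ :=
  ∫ o, scale h * inner ℝ (p.2 h - p.1 h) (M.nextFeature pl h p.2 (stageInput pl h (p, o)))
    ∂(M.obsKernel pl h h.2.le p)

lemma measurable_stageGap (h : Fin H) : Measurable (M.stageGap pl h) := by
  refine (StronglyMeasurable.integral_kernel_prod_right' (κ := M.obsKernel pl h h.2.le)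
    (f := fun q : (Param H d × Param H d) × Obs S A h => scale h *
      inner ℝ (q.1.2 h - q.1.1 h) (M.nextFeature pl h q.1.2 (stageInput pl h q))) ?_).measurable
  refine Measurable.stronglyMeasurable (Measurable.const_mul (Measurable.inner ?_ ?_) _)
  · fun_prop
  · exact (M.measurable_nextFeature pl h).comp
      ((measurable_snd.comp measurable_fst).prodMk (measurable_stageInput pl h))

section Posterior

variable {P : Measure (Param H d)} [IsProbabilityMeasure P]

lemma integral_predVar (hproper : ∀ᵐ Θ ∂P, M.IsProper Θ) {h : Fin H}
    (hmoment : MemLp (fun Θ : Param H d => Θ h) 2 P) :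
    Integrable (fun p : Param H d × Param H d => ∫ o, M.predVar pl P h p.2 (stageInput pl h (p, o))
        ∂(M.obsKernel pl h h.2.le p)) (P.prod P) ∧
      ∫ p, ∫ o, M.predVar pl P h p.2 (stageInput pl h (p, o)) ∂(M.obsKernel pl h h.2.le p)
        ∂(P.prod P) = (M.expPredVar pl P h).toReal := by
  have hb := M.predVar_mem pl hproper hmoment
  have hm := M.measurable_predVar_stageInput pl P h
  have hi : ∀ p, Integrable (fun o => M.predVar pl P h p.2 (stageInput pl h (p, o)))
      (M.obsKernel pl h h.2.le p) := fun p =>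
    Integrable.of_bound (hm.comp measurable_prodMk_left).aestronglyMeasurable (1 / 4)
      (ae_of_all _ fun o => by rw [Real.norm_eq_abs, abs_of_nonneg (hb _ _).1]; exact (hb _ _).2)
  have hu0 : ∀ p : Param H d × Param H d, 0 ≤ ∫ o, M.predVar pl P h p.2 (stageInput pl h (p, o))
      ∂(M.obsKernel pl h h.2.le p) := fun p => integral_nonneg fun o => (hb _ _).1
  have hum : Measurable fun p : Param H d × Param H d =>
      ∫ o, M.predVar pl P h p.2 (stageInput pl h (p, o)) ∂(M.obsKernel pl h h.2.le p) :=
    (StronglyMeasurable.integral_kernel_prod_right' (κ := M.obsKernel pl h h.2.le)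
      (f := fun q => M.predVar pl P h q.1.2 (stageInput pl h q)) hm.stronglyMeasurable).measurable
  have hui : Integrable (fun p : Param H d × Param H d =>
      ∫ o, M.predVar pl P h p.2 (stageInput pl h (p, o)) ∂(M.obsKernel pl h h.2.le p))
      (P.prod P) := by
    refine Integrable.of_bound hum.aestronglyMeasurable (1 / 4) (ae_of_all _ fun p => ?_)
    have := norm_integral_le_of_norm_le_const (μ := M.obsKernel pl h h.2.le p) (C := 1 / 4)
      (f := fun o => M.predVar pl P h p.2 (stageInput pl h (p, o)))
      (ae_of_all _ fun o => by rw [Real.norm_eq_abs, abs_of_nonneg (hb _ _).1]; exact (hb _ _).2)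
    simpa using this
  refine ⟨hui, ?_⟩
  rw [integral_eq_lintegral_of_nonneg_ae (ae_of_all _ hu0) hum.aestronglyMeasurable, expPredVar]
  congr 1
  refine lintegral_congr fun p => ?_
  rw [ofReal_integral_eq_lintegral_ofReal (hi p) (ae_of_all _ fun o => (hb _ _).1)]

/-- The decoupling inequality: the difference of two independent draws from the posterior along
an arbitrarily correlated feature is controlled by the prediction variance. -/
lemma integral_stageGap_le (hM : M.BoundedFeatures) (hproper : ∀ᵐ Θ ∂P, M.IsProper Θ) {h : Fin H}
    (hmoment : MemLp (fun Θ : Param H d => Θ h) 2 P) {ε : ℝ} (hε : 0 < ε) :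
    Integrable (M.stageGap pl h) (P.prod P) ∧ ∫ p, M.stageGap pl h p ∂(P.prod P) ≤
      ε * d * scale h ^ 2 + (M.expPredVar pl P h).toReal / (2 * ε) := by
  set μ := marginal P h with hμdef
  have hμ : MemLp (fun x => x) 2 μ := memLp_marginal hmoment
  have hΓ := posSemidef_covMat hμ
  obtain ⟨hui, hu⟩ := M.integral_predVar pl hproper hmoment
  have hb := M.predVar_mem pl hproper hmoment
  have hm1 : MemLp (fun p : Param H d × Param H d => p.1 h) 2 (P.prod P) :=
    hmoment.comp_measurePreserving measurePreserving_fst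
  have hm2 : MemLp (fun p : Param H d × Param H d => p.2 h) 2 (P.prod P) :=
    hmoment.comp_measurePreserving measurePreserving_snd
  have hgi : Integrable (M.stageGap pl h) (P.prod P) := by
    refine Integrable.mono' (((hm2.sub hm1).integrable one_le_two).norm.const_mul (scale h))
      (M.measurable_stageGap pl h).aestronglyMeasurable (ae_of_all _ fun p => ?_)
    have h0 : (0 : ℝ) ≤ scale h := Nat.cast_nonneg _
    have := norm_integral_le_of_norm_le_const (μ := M.obsKernel pl h h.2.le p)
      (C := scale h * ‖p.2 h - p.1 h‖)
      (f := fun o => scale h * inner ℝ (p.2 h - p.1 h)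
        (M.nextFeature pl h p.2 (stageInput pl h (p, o))))
      (ae_of_all _ fun o => by
        rw [norm_mul, Real.norm_of_nonneg h0]
        refine mul_le_mul_of_nonneg_left ((norm_inner_le_norm _ _).trans ?_) h0
        exact mul_le_of_le_one_right (norm_nonneg _) (norm_nextFeature_le pl hM h _ _))
    simpa [stageGap] using this
  refine ⟨hgi, le_of_forall_pos_le_add fun η hη => ?_⟩
  -- With δ = 2εη the regularization costs at most η, because the feature has norm at most 1; η is
  -- arbitrary.
  have hδ : 0 < 2 * ε * η := by positivity
  obtain ⟨G, hG, hGtr, hGle⟩ := exists_dual_weight hΓ hδ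
  let a : Param H d × Param H d → ℝ := fun p =>
    dev μ (p.2 h) ⬝ᵥ G *ᵥ dev μ (p.2 h) + dev μ (p.1 h) ⬝ᵥ G *ᵥ dev μ (p.1 h) -
      2 * ((G *ᵥ dev μ (p.1 h)) ⬝ᵥ dev μ (p.2 h))
  let u : Param H d × Param H d → ℝ := fun p =>
    ∫ o, M.predVar pl P h p.2 (stageInput pl h (p, o)) ∂(M.obsKernel pl h h.2.le p)
  have ha : ∀ p : Param H d × Param H d,
      (p.2 h - p.1 h).ofLp ⬝ᵥ G *ᵥ (p.2 h - p.1 h).ofLp = a p := by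
    intro p
    have h1 := quadForm_sub_smul hG (dev μ (p.2 h)) (dev μ (p.1 h)) 1
    have h2 : dev μ (p.2 h) - (1 : ℝ) • dev μ (p.1 h) = (p.2 h - p.1 h).ofLp := by
      ext i
      simp [dev]
    rw [h2] at h1
    rw [h1]
    simp only [a]
    ring
  have hdQ : ∀ (f : Param H d × Param H d → Param H d), MeasurePreserving f (P.prod P) P →
      Integrable (fun p => dev μ (f p h) ⬝ᵥ G *ᵥ dev μ (f p h)) (P.prod P) ∧
        ∫ p, dev μ (f p h) ⬝ᵥ G *ᵥ dev μ (f p h) ∂(P.prod P) = (G * covMat μ).trace := by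
    intro f hf
    have hmp : MeasurePreserving (fun p => f p h) (P.prod P) μ :=
      MeasurePreserving.comp ⟨measurable_pi_apply h, rfl⟩ hf
    have hi := integrable_quadForm_dev hμ G
    refine ⟨hmp.integrable_comp_of_integrable hi, ?_⟩
    have hae : AEStronglyMeasurable (fun x => dev μ x ⬝ᵥ G *ᵥ dev μ x)
        ((P.prod P).map fun p => f p h) := by
      rw [hmp.map_eq]; exact hi.aestronglyMeasurable
    rw [← integral_quadForm_dev hμ G, ← integral_map hmp.measurable.aemeasurable hae, hmp.map_eq]
  have hmp : MeasurePreserving (fun Θ : Param H d => Θ h) P μ := ⟨measurable_pi_apply h, rfl⟩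
  have hcoord : ∀ i, Integrable (fun Θ : Param H d => dev μ (Θ h) i) P := fun i =>
    hmp.integrable_comp_of_integrable (g := fun x => dev μ x i)
      ((memLp_dev hμ i).integrable one_le_two)
  have hcoord0 : ∀ i, ∫ Θ : Param H d, dev μ (Θ h) i ∂P = 0 := by
    intro i
    have h1 := integral_dotProduct_dev hμ (Pi.single i 1)
    simp only [single_one_dotProduct] at h1
    rw [← h1, hμdef, marginal, integral_map (measurable_pi_apply h).aemeasurable]
    exact ((memLp_dev hμ i).aestronglyMeasurable)
  -- The two draws are independent and the deviations are centered, so the cross term has mean zero.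
  -- The weighted square of their difference thus has mean 2 tr(GΓ) ≤ 2d.
  have hcross : Integrable (fun p : Param H d × Param H d =>
      (G *ᵥ dev μ (p.1 h)) ⬝ᵥ dev μ (p.2 h)) (P.prod P) ∧
      ∫ p : Param H d × Param H d, (G *ᵥ dev μ (p.1 h)) ⬝ᵥ dev μ (p.2 h) ∂(P.prod P) = 0 := by
    have e : ∀ p : Param H d × Param H d, (G *ᵥ dev μ (p.1 h)) ⬝ᵥ dev μ (p.2 h) =
        ∑ i, ∑ j, (G i j * dev μ (p.1 h) j) * dev μ (p.2 h) i := by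
      intro p
      simp only [dotProduct, mulVec, Finset.sum_mul]
    have hij : ∀ i j, Integrable (fun p : Param H d × Param H d =>
        (G i j * dev μ (p.1 h) j) * dev μ (p.2 h) i) (P.prod P) := fun i j =>
      ((hcoord j).const_mul (G i j)).mul_prod (hcoord i)
    simp only [e]
    refine ⟨integrable_finsetSum _ fun i _ => integrable_finsetSum _ fun j _ => hij i j, ?_⟩
    rw [integral_finsetSum _ fun i _ => integrable_finsetSum _ fun j _ => hij i j]
    refine Finset.sum_eq_zero fun i _ => ?_
    rw [integral_finsetSum _ fun j _ => hij i j]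
    refine Finset.sum_eq_zero fun j _ => ?_
    have := integral_prod_mul (μ := P) (ν := P) (fun Θ : Param H d => G i j * dev μ (Θ h) j)
      (fun Θ : Param H d => dev μ (Θ h) i)
    rw [this, hcoord0 i, mul_zero]
  obtain ⟨hi1, he1⟩ := hdQ Prod.snd measurePreserving_snd
  obtain ⟨hi2, he2⟩ := hdQ Prod.fst measurePreserving_fst
  have hi12 : Integrable (fun p : Param H d × Param H d =>
      dev μ (p.2 h) ⬝ᵥ G *ᵥ dev μ (p.2 h) + dev μ (p.1 h) ⬝ᵥ G *ᵥ dev μ (p.1 h)) (P.prod P) :=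
    hi1.add hi2
  have hai : Integrable a (P.prod P) := hi12.sub (hcross.1.const_mul 2)
  have hae : ∫ p, a p ∂(P.prod P) = 2 * (G * covMat μ).trace := by
    simp only [a]
    rw [integral_sub hi12 (hcross.1.const_mul 2), integral_add hi1 hi2, integral_const_mul,
      hcross.2, he1, he2]
    ring
  have hpt : ∀ p, M.stageGap pl h p ≤
      ε * scale h ^ 2 / 2 * a p + (ε⁻¹ / 2 * u p + η) := by
    intro p
    have hvi : Integrable (fun o => M.predVar pl P h p.2 (stageInput pl h (p, o)))
        (M.obsKernel pl h h.2.le p) :=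
      Integrable.of_bound ((M.measurable_predVar_stageInput pl P h).comp
        measurable_prodMk_left).aestronglyMeasurable (1 / 4) (ae_of_all _ fun o => by
          rw [Real.norm_eq_abs, abs_of_nonneg (hb _ _).1]; exact (hb _ _).2)
    have hfm : Measurable fun o : Obs S A h => scale h * inner ℝ (p.2 h - p.1 h)
        (M.nextFeature pl h p.2 (stageInput pl h (p, o))) :=
      (Measurable.inner measurable_const ((M.measurable_nextFeature pl h).comp
        (measurable_const.prodMk ((measurable_stageInput pl h).comp
          measurable_prodMk_left)))).const_mul _
    have hfi : Integrable (fun o : Obs S A h => scale h * inner ℝ (p.2 h - p.1 h)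
        (M.nextFeature pl h p.2 (stageInput pl h (p, o)))) (M.obsKernel pl h h.2.le p) := by
      refine Integrable.of_bound hfm.aestronglyMeasurable (scale h * ‖p.2 h - p.1 h‖)
        (ae_of_all _ fun o => ?_)
      have h0 : (0 : ℝ) ≤ scale h := Nat.cast_nonneg _
      rw [norm_mul, Real.norm_of_nonneg h0]
      refine mul_le_mul_of_nonneg_left ((norm_inner_le_norm _ _).trans ?_) h0
      exact mul_le_of_le_one_right (norm_nonneg _) (norm_nextFeature_le pl hM h _ _)
    have hri := (hvi.const_mul (ε⁻¹ / 2)).add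
      (integrable_const (μ := M.obsKernel pl h h.2.le p) (ε * scale h ^ 2 / 2 * a p + η))
    have := integral_mono hfi hri fun o => ?_
    · refine this.trans_eq ?_
      have h2 := integral_add (hvi.const_mul (ε⁻¹ / 2))
        (integrable_const (μ := M.obsKernel pl h h.2.le p) (ε * scale h ^ 2 / 2 * a p + η))
      refine h2.trans ?_
      rw [integral_const_mul, integral_const, probReal_univ, one_smul]
      simp only [u]
      ring
    · change scale h * inner ℝ (p.2 h - p.1 h) (M.nextFeature pl h p.2 (stageInput pl h (p, o))) ≤
        ε⁻¹ / 2 * M.predVar pl P h p.2 (stageInput pl h (p, o)) +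
          (ε * scale h ^ 2 / 2 * a p + η)
      rw [inner_nextFeature, dotProduct_comm]
      refine (hGle ε hε (scale h) _ _).trans ?_
      rw [ha]
      have h1 := featVec_dotProduct_self_le pl hM h p.2 (stageInput pl h (p, o))
      change (_ + ε⁻¹ * (M.predVar pl P h p.2 (stageInput pl h (p, o)) + _)) / 2 ≤ _
      have h2 : ε⁻¹ * (2 * ε * η * (M.featVec pl h p.2 (stageInput pl h (p, o)) ⬝ᵥ
          M.featVec pl h p.2 (stageInput pl h (p, o)))) ≤ 2 * η := by
        have : ε⁻¹ * (2 * ε * η) = 2 * η := by field_simp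
        rw [← mul_assoc, this]
        exact mul_le_of_le_one_right (by positivity) h1
      linarith
  have hri2 : Integrable (fun p => ε⁻¹ / 2 * u p + η) (P.prod P) :=
    (hui.const_mul _).add (integrable_const _)
  calc ∫ p, M.stageGap pl h p ∂(P.prod P)
      ≤ ∫ p, (ε * scale h ^ 2 / 2 * a p + (ε⁻¹ / 2 * u p + η)) ∂(P.prod P) :=
        integral_mono hgi ((hai.const_mul _).add hri2) hpt
    _ = ε * scale h ^ 2 * (G * covMat μ).trace +
          ((M.expPredVar pl P h).toReal / (2 * ε) + η) := by
        rw [integral_add (hai.const_mul _) hri2, integral_add (hui.const_mul _)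
          (integrable_const _), integral_const_mul, integral_const_mul, hae, hu, integral_const,
          probReal_univ, one_smul]
        field_simp
    _ ≤ _ := by
        have h1 : ε * scale h ^ 2 * (G * covMat μ).trace ≤ ε * scale h ^ 2 * d := by
          refine mul_le_mul_of_nonneg_left ?_ (by positivity)
          simpa using hGtr
        linarith

end Posterior

end Model

end LinearMixture

/-! ### Mean squared error of the linear estimator over one episode. -/

namespace LinearMixture

open Matrix

variable {S A : Type*} [MeasurableSpace S] [MeasurableSpace A] {H d : ℕ}

namespace Model

variable (M : Model S A H d) (pl : Planner S A H d)

lemma lintegral_obsKernel_stage (h : Fin H) {f : (S × A) × S → ENNReal} (hf : Measurable f)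
    (p : Param H d × Param H d) :
    ∫⁻ o, f (o.1 h, o.state (h + 1)) ∂(M.obsKernel pl H le_rfl p) =
      ∫⁻ o, ∫⁻ s, f (stageInput pl h (p, o), s)
        ∂(M.coordTransition h (p.1 h, stageInput pl h (p, o))) ∂(M.obsKernel pl h h.2.le p) := by
  simp only [coordTransition_apply]
  exact M.lintegral_obsLaw_stage p.1 (pl.measurable_policy_apply p.2) h hf H le_rfl h.2

/-- The observations up to stage h are produced by the transitions of earlier stages only, which do
not read θ_h. -/
lemma obsKernel_erase (h : Fin H) (p : Param H d × Param H d) :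
    M.obsKernel pl h h.2.le (Param.erase h p.1, p.2) = M.obsKernel pl h h.2.le p :=
  M.obsLaw_congr _ _ _ fun _ hi => Param.erase_of_ne (fun e => by simp [e] at hi) _

/-- The linear estimator of `θ_h`, under the prior `P`, from the next state `z.2` observed at the
state-action pair `z.1`, with respect to the value function of `Θ`. -/
def estimator (P : Measure (Param H d)) (h : Fin H) (Θ : Param H d) (z : (S × A) × S) :
    Fin d → ℝ :=
  meanVec (marginal P h) +
    (4 * (M.nextValue pl h Θ z.2 - M.featVec pl h Θ z.1 ⬝ᵥ meanVec (marginal P h))) •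
      (covMat (marginal P h) *ᵥ M.featVec pl h Θ z.1)

/-- The squared error of the linear estimator in the norm of `W`. -/
def sqError (W : Matrix (Fin d) (Fin d) ℝ) (P : Measure (Param H d)) (h : Fin H)
    (θ : EuclideanSpace ℝ (Fin d)) (Θ : Param H d) (z : (S × A) × S) : ENNReal :=
  ENNReal.ofReal ((θ.ofLp - M.estimator pl P h Θ z) ⬝ᵥ
    W *ᵥ (θ.ofLp - M.estimator pl P h Θ z))

lemma measurable_sqError (W : Matrix (Fin d) (Fin d) ℝ) (P : Measure (Param H d)) (h : Fin H) :
    Measurable fun q : (EuclideanSpace ℝ (Fin d) × Param H d) × ((S × A) × S) =>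
      M.sqError pl W P h q.1.1 q.1.2 q.2 := by
  have hf : ∀ i, Measurable fun q : (EuclideanSpace ℝ (Fin d) × Param H d) × ((S × A) × S) =>
      M.featVec pl h q.1.2 q.2.1 i := fun i =>
    (M.measurable_featVec pl h i).comp ((measurable_snd.comp measurable_fst).prodMk
      (measurable_fst.comp measurable_snd))
  have hv : Measurable fun q : (EuclideanSpace ℝ (Fin d) × Param H d) × ((S × A) × S) =>
      M.nextValue pl h q.1.2 q.2.2 :=
    (M.measurable_nextValue pl h).comp ((measurable_snd.comp measurable_fst).prodMk
      (measurable_snd.comp measurable_snd))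
  have hi : ∀ i, Measurable fun q : (EuclideanSpace ℝ (Fin d) × Param H d) × ((S × A) × S) =>
      (q.1.1.ofLp - M.estimator pl P h q.1.2 q.2) i := by
    intro i
    simp only [estimator, Pi.sub_apply, Pi.add_apply, Pi.smul_apply, smul_eq_mul, dotProduct,
      mulVec]
    fun_prop
  simp only [sqError, quadForm_eq_sum]
  refine ENNReal.measurable_ofReal.comp ?_
  exact Finset.measurable_sum _ fun i _ => Finset.measurable_sum _ fun j _ =>
    ((hi i).mul (hi j)).const_mul _

/-- The bound on the mean squared error of the linear estimator. -/
def errorBound (W : Matrix (Fin d) (Fin d) ℝ) (P : Measure (Param H d)) (h : Fin H)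
    (Θ : Param H d) (x : S × A) : ℝ :=
  (W * covMat (marginal P h)).trace -
    4 * ((covMat (marginal P h) *ᵥ M.featVec pl h Θ x) ⬝ᵥ
      W *ᵥ (covMat (marginal P h) *ᵥ M.featVec pl h Θ x))

lemma measurable_errorBound (W : Matrix (Fin d) (Fin d) ℝ) (P : Measure (Param H d))
    (h : Fin H) : Measurable fun p : Param H d × (S × A) => M.errorBound pl W P h p.1 p.2 := by
  have hf := M.measurable_featVec pl h
  simp only [errorBound, dotProduct, mulVec]
  fun_prop

lemma measurable_errorBound_stageInput (W : Matrix (Fin d) (Fin d) ℝ) (P : Measure (Param H d))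
    (h : Fin H) : Measurable fun q : (Param H d × Param H d) × Obs S A h =>
      M.errorBound pl W P h q.1.2 (stageInput pl h q) := by
  have h1 : Measurable fun q : (Param H d × Param H d) × Obs S A h =>
      (q.1.2, stageInput pl h q) :=
    (measurable_snd.comp measurable_fst).prodMk (measurable_stageInput pl h)
  have h2 := M.measurable_errorBound pl W P h
  have h3 := h2.comp h1
  simp only [Function.comp_def] at h3
  exact h3

variable {P : Measure (Param H d)} [IsProbabilityMeasure P]

/-- At a fixed input this is the estimate for one linear observation. The sign of the bound is
recorded so that sums can be taken inside `ENNReal.ofReal`. -/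
lemma lintegral_sqError_marginal (hproper : ∀ᵐ Θ ∂P, M.IsProper Θ) {h : Fin H}
    (hmoment : MemLp (fun Θ : Param H d => Θ h) 2 P) {W : Matrix (Fin d) (Fin d) ℝ}
    (hW : W.PosSemidef) (Θ : Param H d) (x : S × A) :
    0 ≤ M.errorBound pl W P h Θ x ∧
      ∫⁻ θ, ∫⁻ s, M.sqError pl W P h θ Θ (x, s) ∂(M.coordTransition h (θ, x)) ∂(marginal P h) ≤
        ENNReal.ofReal (M.errorBound pl W P h Θ x) :=
  lintegral_quadForm_linear_estimator
    (κ := (M.coordTransition h).comap (fun θ => (θ, x)) measurable_prodMk_right)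
    (memLp_marginal hmoment) (M.measurable_nextValue_apply pl h Θ) (M.nextValue_mem pl h Θ)
    (M.ae_marginal_integral_nextValue pl hproper h Θ x) hW rfl

/-- Under a posterior with independent components, the input of stage `h` is independent of
`θ_h`, so that `θ_h` may be integrated out first. -/
lemma lintegral_obsKernel_of_indepFun {h : Fin H}
    (hindep : IndepFun (fun Θ : Param H d => Θ h) (Param.erase h) P)
    {f : (EuclideanSpace ℝ (Fin d) × Param H d) × ((S × A) × S) → ENNReal} (hf : Measurable f) :
    ∫⁻ p, ∫⁻ o, f ((p.1 h, p.2), (o.1 h, o.state (h + 1)))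
        ∂(M.obsKernel pl H le_rfl p) ∂(P.prod P) =
      ∫⁻ p, ∫⁻ o, ∫⁻ θ, ∫⁻ s, f ((θ, p.2), (stageInput pl h (p, o), s))
        ∂(M.coordTransition h (θ, stageInput pl h (p, o))) ∂(marginal P h)
        ∂(M.obsKernel pl h h.2.le p) ∂(P.prod P) := by
  let g : (EuclideanSpace ℝ (Fin d) × Param H d) × (S × A) → ENNReal := fun q =>
    ∫⁻ s, f (q.1, (q.2, s)) ∂(M.coordTransition h (q.1.1, q.2))
  have hg : Measurable g :=
    Measurable.lintegral_kernel_prod_right'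
      (κ := (M.coordTransition h).comap
        (fun q : (EuclideanSpace ℝ (Fin d) × Param H d) × (S × A) => (q.1.1, q.2)) (by fun_prop))
      (f := fun q : ((EuclideanSpace ℝ (Fin d) × Param H d) × (S × A)) × S =>
        f (q.1.1, (q.1.2, q.2))) (by fun_prop)
  -- In Φ the value of θ_h used at stage h is separated from the parameter that generated the input.
  -- Since the latter may be erased at h, independence allows integration over θ_h alone.
  let Φ : EuclideanSpace ℝ (Fin d) × (Param H d × Param H d) → ENNReal := fun q =>
    ∫⁻ o, g ((q.1, q.2.2), stageInput pl h (q.2, o)) ∂(M.obsKernel pl h h.2.le q.2)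
  have hin := measurable_stageInput (S := S) (A := A) pl h
  have hgin : Measurable fun r : (EuclideanSpace ℝ (Fin d) × (Param H d × Param H d)) × Obs S A h =>
      g ((r.1.1, r.1.2.2), stageInput pl h (r.1.2, r.2)) := by fun_prop
  have hΦ : Measurable Φ :=
    Measurable.lintegral_kernel_prod_right'
      (κ := (M.obsKernel pl h h.2.le).comap
        (fun q : EuclideanSpace ℝ (Fin d) × (Param H d × Param H d) => q.2) measurable_snd)
      (f := fun r => g ((r.1.1, r.1.2.2), stageInput pl h (r.1.2, r.2))) hgin
  have hcongr := M.obsKernel_erase pl h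
  have e1 : ∀ p : Param H d × Param H d,
      ∫⁻ o, f ((p.1 h, p.2), (o.1 h, o.state (h + 1))) ∂(M.obsKernel pl H le_rfl p) =
        Φ (p.1 h, (Param.erase h p.1, p.2)) := by
    intro p
    have := M.lintegral_obsKernel_stage pl h (f := fun z => f ((p.1 h, p.2), z)) (by fun_prop) p
    rw [this]
    simp only [Φ, hcongr]
    rfl
  have hXY : Measurable fun Θ : Param H d => (Θ h, Param.erase h Θ) :=
    (measurable_pi_apply h).prodMk (Param.measurable_erase h)
  have hΦ1 : Measurable fun p : Param H d × Param H d => Φ (p.1 h, (Param.erase h p.1, p.2)) :=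
    hΦ.comp (((measurable_pi_apply h).comp measurable_fst).prodMk
      (((Param.measurable_erase h).comp measurable_fst).prodMk measurable_snd))
  have hΦ2 : Measurable fun q : EuclideanSpace ℝ (Fin d) × Param H d =>
      ∫⁻ Θ', Φ (q.1, (q.2, Θ')) ∂P :=
    Measurable.lintegral_prod_right' (f := fun r : (EuclideanSpace ℝ (Fin d) × Param H d) ×
      Param H d => Φ (r.1.1, (r.1.2, r.2))) (by fun_prop)
  have hΦ3 : Measurable fun q : (Param H d × Param H d) × Obs S A h => ∫⁻ θ,
      g ((θ, q.1.2), stageInput pl h q) ∂(marginal P h) :=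
    Measurable.lintegral_prod_right' (f := fun r : ((Param H d × Param H d) × Obs S A h) ×
      EuclideanSpace ℝ (Fin d) => g ((r.2, r.1.1.2), stageInput pl h r.1)) (by fun_prop)
  simp only [e1]
  rw [lintegral_prod _ hΦ1.aemeasurable, lintegral_prod _
    (Measurable.lintegral_kernel_prod_right' (κ := M.obsKernel pl h h.2.le) hΦ3).aemeasurable]
  calc ∫⁻ Θ, ∫⁻ Θ', Φ (Θ h, (Param.erase h Θ, Θ')) ∂P ∂P
      = ∫⁻ q, ∫⁻ Θ', Φ (q.1, (q.2, Θ')) ∂P ∂(P.map fun Θ : Param H d => (Θ h, Param.erase h Θ)) :=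
        (lintegral_map hΦ2 hXY).symm
    _ = ∫⁻ r, ∫⁻ θ, ∫⁻ Θ', Φ (θ, (r, Θ')) ∂P ∂(marginal P h) ∂(P.map (Param.erase h)) := by
        have := Measure.isProbabilityMeasure_map (μ := P) (Param.measurable_erase h).aemeasurable
        rw [(indepFun_iff_map_prod_eq_prod_map_map (measurable_pi_apply h).aemeasurable
          (Param.measurable_erase h).aemeasurable).1 hindep, lintegral_prod_symm _ hΦ2.aemeasurable]
        rfl
    _ = ∫⁻ Θ, ∫⁻ θ, ∫⁻ Θ', Φ (θ, (Param.erase h Θ, Θ')) ∂P ∂(marginal P h) ∂P := by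
        rw [lintegral_map _ (Param.measurable_erase h)]
        exact Measurable.lintegral_prod_left' (f := fun q : EuclideanSpace ℝ (Fin d) × Param H d =>
          ∫⁻ Θ', Φ (q.1, (q.2, Θ')) ∂P) hΦ2
    _ = ∫⁻ Θ, ∫⁻ Θ', ∫⁻ θ, Φ (θ, (Param.erase h Θ, Θ')) ∂(marginal P h) ∂P ∂P := by
        refine lintegral_congr fun Θ => lintegral_lintegral_swap ?_
        exact (hΦ.comp (g := Φ) (f := fun q : EuclideanSpace ℝ (Fin d) × Param H d =>
          (q.1, (Param.erase h Θ, q.2))) (by fun_prop)).aemeasurable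
    _ = _ := by
        refine lintegral_congr fun Θ => lintegral_congr fun Θ' => ?_
        simp only [Φ, hcongr (Θ, Θ')]
        refine lintegral_lintegral_swap ?_
        exact (hgin.comp (f := fun q : EuclideanSpace ℝ (Fin d) × Obs S A h =>
          ((q.1, (Param.erase h Θ, Θ')), q.2)) (by fun_prop)).aemeasurable

/-- The mean squared error, over one episode, of the linear estimator of `θ_h`. -/
lemma lintegral_sqError_le (hproper : ∀ᵐ Θ ∂P, M.IsProper Θ) {h : Fin H}
    (hmoment : MemLp (fun Θ : Param H d => Θ h) 2 P)
    (hindep : IndepFun (fun Θ : Param H d => Θ h) (Param.erase h) P)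
    {W : Matrix (Fin d) (Fin d) ℝ} (hW : W.PosSemidef) :
    ∫⁻ p, ∫⁻ o, M.sqError pl W P h (p.1 h) p.2 (o.1 h, o.state (h + 1))
        ∂(M.obsKernel pl H le_rfl p) ∂(P.prod P) ≤
      ∫⁻ p, ∫⁻ o, ENNReal.ofReal (M.errorBound pl W P h p.2 (stageInput pl h (p, o)))
        ∂(M.obsKernel pl h h.2.le p) ∂(P.prod P) := by
  refine (M.lintegral_obsKernel_of_indepFun pl hindep (M.measurable_sqError pl W P h)).trans_le ?_
  exact lintegral_mono fun p => lintegral_mono fun o =>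
    (M.lintegral_sqError_marginal pl hproper hmoment hW p.2 _).2

/-- This is `quadForm_le_trace_resolvent` arranged without subtraction: (k+1) tr(WΓ) minus k times
the error bound leaves tr(WΓ) + 4k(Γψ)ᵀW(Γψ). -/
lemma errorBound_add_predVar_le (hM : M.BoundedFeatures)
    (hproper : ∀ᵐ Θ ∂P, M.IsProper Θ) {h : Fin H}
    (hmoment : MemLp (fun Θ : Param H d => Θ h) 2 P) (k : ℕ) (Θ : Param H d) (x : S × A) :
    (k : ENNReal) * ENNReal.ofReal
        (M.errorBound pl (1 + ((k : ℝ) + 1) • covMat (marginal P h))⁻¹ P h Θ x) +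
      2⁻¹ * ENNReal.ofReal (M.predVar pl P h Θ x) ≤
    (k + 1) * ENNReal.ofReal
      ((1 + ((k : ℝ) + 1) • covMat (marginal P h))⁻¹ * covMat (marginal P h)).trace := by
  have hΓ := posSemidef_covMat (memLp_marginal hmoment)
  have hW := posSemidef_resolvent hΓ (by positivity : (0 : ℝ) ≤ (k : ℝ) + 1)
  have hb0 := (M.lintegral_sqError_marginal pl hproper hmoment hW Θ x).1
  have hq := M.predVar_mem pl hproper hmoment Θ x
  have hkey := quadForm_le_trace_resolvent hΓ k (featVec_dotProduct_self_le pl hM h Θ x) hq.2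
  have ek : (k : ENNReal) = ENNReal.ofReal k := (ENNReal.ofReal_natCast k).symm
  have ek1 : (k : ENNReal) + 1 = ENNReal.ofReal (k + 1) := by
    rw [ENNReal.ofReal_add (Nat.cast_nonneg k) zero_le_one, ENNReal.ofReal_one, ← ek]
  have e2 : (2⁻¹ : ENNReal) = ENNReal.ofReal 2⁻¹ := by
    rw [ENNReal.ofReal_inv_of_pos two_pos, ENNReal.ofReal_ofNat]
  rw [ek1, ek, e2, ← ENNReal.ofReal_mul (Nat.cast_nonneg k), ← ENNReal.ofReal_mul (by norm_num),
    ← ENNReal.ofReal_mul (by positivity), ← ENNReal.ofReal_add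
      (mul_nonneg (Nat.cast_nonneg k) hb0) (mul_nonneg (by norm_num) hq.1)]
  refine ENNReal.ofReal_le_ofReal ?_
  change M.predVar pl P h Θ x / 2 ≤ _ at hkey
  simp only [errorBound]
  linarith

lemma lintegral_compProd_add_le {α β : Type*} [MeasurableSpace α] [MeasurableSpace β]
    {μ : Measure α} [IsProbabilityMeasure μ] {κ : Kernel α β} [IsMarkovKernel κ]
    {f g : α × β → ENNReal} (hf : Measurable f) (hg : Measurable g) {a b c : ENNReal}
    (h : ∀ q, a * f q + b * g q ≤ c) :
    a * ∫⁻ x, ∫⁻ y, f (x, y) ∂(κ x) ∂μ + b * ∫⁻ x, ∫⁻ y, g (x, y) ∂(κ x) ∂μ ≤ c := by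
  rw [← Measure.lintegral_compProd hf, ← Measure.lintegral_compProd hg,
    ← lintegral_const_mul _ hf, ← lintegral_const_mul _ hg,
    ← lintegral_add_left (hf.const_mul _)]
  refine (lintegral_mono h).trans_eq ?_
  rw [lintegral_const, measure_univ, mul_one]

lemma lintegral_sqError_add_expPredVar_le_of_forall
    (hproper : ∀ᵐ Θ ∂P, M.IsProper Θ) {h : Fin H}
    (hmoment : MemLp (fun Θ : Param H d => Θ h) 2 P)
    (hindep : IndepFun (fun Θ : Param H d => Θ h) (Param.erase h) P)
    {W : Matrix (Fin d) (Fin d) ℝ} (hW : W.PosSemidef) {a b c : ENNReal}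
    (hle : ∀ Θ x, a * ENNReal.ofReal (M.errorBound pl W P h Θ x) +
      b * ENNReal.ofReal (M.predVar pl P h Θ x) ≤ c) :
    a * ∫⁻ p, ∫⁻ o, M.sqError pl W P h (p.1 h) p.2 (o.1 h, o.state (h + 1))
        ∂(M.obsKernel pl H le_rfl p) ∂(P.prod P) + b * M.expPredVar pl P h ≤ c := by
  have hm1 : Measurable fun q : (Param H d × Param H d) × Obs S A h => ENNReal.ofReal
      (M.errorBound pl W P h q.1.2 (stageInput pl h q)) :=
    (M.measurable_errorBound_stageInput pl W P h).ennreal_ofReal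
  have hm2 : Measurable fun q : (Param H d × Param H d) × Obs S A h => ENNReal.ofReal
      (M.predVar pl P h q.1.2 (stageInput pl h q)) :=
    (M.measurable_predVar_stageInput pl P h).ennreal_ofReal
  have hsq := M.lintegral_sqError_le pl hproper hmoment hindep hW
  refine (add_le_add_left (mul_le_mul_right hsq a) _).trans ?_
  exact lintegral_compProd_add_le (κ := M.obsKernel pl h h.2.le) hm1 hm2
    fun q => hle q.1.2 (stageInput pl h q)

/-- One episode decreases the resolvent trace by at least half the expected prediction variance. -/
lemma lintegral_sqError_add_expPredVar_le (hM : M.BoundedFeatures)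
    (hproper : ∀ᵐ Θ ∂P, M.IsProper Θ) {h : Fin H}
    (hmoment : MemLp (fun Θ : Param H d => Θ h) 2 P)
    (hindep : IndepFun (fun Θ : Param H d => Θ h) (Param.erase h) P) (k : ℕ) :
    k * ∫⁻ p, ∫⁻ o, M.sqError pl (1 + ((k : ℝ) + 1) • covMat (marginal P h))⁻¹ P h (p.1 h) p.2
        (o.1 h, o.state (h + 1)) ∂(M.obsKernel pl H le_rfl p) ∂(P.prod P) +
      2⁻¹ * M.expPredVar pl P h ≤
    (k + 1) * ENNReal.ofReal
      ((1 + ((k : ℝ) + 1) • covMat (marginal P h))⁻¹ * covMat (marginal P h)).trace := by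
  have hW := posSemidef_resolvent (posSemidef_covMat (memLp_marginal hmoment))
    (by positivity : (0 : ℝ) ≤ (k : ℝ) + 1)
  exact M.lintegral_sqError_add_expPredVar_le_of_forall pl hproper hmoment hindep hW
    (M.errorBound_add_predVar_le pl hM hproper hmoment k)

end Model

end LinearMixture

/-! ### An episode as a two-party protocol between θ_h and everything else. -/

namespace LinearMixture

variable {S A : Type*} [MeasurableSpace S] [MeasurableSpace A] {H d : ℕ}

/-- Conditional independence is preserved by an injective change of the conditioning variable. -/
lemma IsCondIndep.map_left {T T' X Y : Type*} [MeasurableSpace T] [MeasurableSpace T']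
    [MeasurableSpace X] [MeasurableSpace Y] {μ : Measure (T × X × Y)} (h : IsCondIndep μ)
    {g : T → T'} (hg : Measurable g) {g' : T' → T} (hg' : Measurable g')
    (hgg : ∀ t, g' (g t) = t) : IsCondIndep (μ.map fun p => (g p.1, p.2)) := by
  obtain ⟨m, P, Q, hm, hP, hQ, rfl⟩ := h
  refine ⟨m.map g, P.comap g' hg', Q.comap g' hg', Measure.isProbabilityMeasure_map hg.aemeasurable,
    inferInstance, inferInstance, Measure.ext_of_lintegral _ fun f hf => ?_⟩
  have : IsProbabilityMeasure (m.map g) := Measure.isProbabilityMeasure_map hg.aemeasurable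
  have hm1 : Measurable fun q : T' × X => ∫⁻ y, f (q.1, q.2, y) ∂(Q.comap g' hg' q.1) :=
    Measurable.lintegral_kernel_prod_right'
      (κ := Q.comap (fun q : T' × X => g' q.1) (by fun_prop))
      (f := fun q : (T' × X) × Y => f (q.1.1, q.1.2, q.2)) (by fun_prop)
  rw [lintegral_map hf (by fun_prop), lintegral_compProd_prod (by fun_prop),
    lintegral_compProd_prod hf, lintegral_map hm1.lintegral_kernel_prod_right' hg]
  refine lintegral_congr fun t => ?_
  simp only [Kernel.comap_apply, hgg]

/-- Undo the extension of the observations by one stage. -/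
def Obs.unextend {T : Type*} {j : ℕ} (p : T × Obs S A (j + 1)) : ((T × Obs S A j) × A) × S :=
  (((p.1, (fun i => p.2.1 i.castSucc, (p.2.1 (Fin.last j)).1)), (p.2.1 (Fin.last j)).2), p.2.2)

lemma Obs.measurable_unextend {T : Type*} [MeasurableSpace T] {j : ℕ} :
    Measurable (Obs.unextend : T × Obs S A (j + 1) → ((T × Obs S A j) × A) × S) := by
  unfold Obs.unextend
  fun_prop

omit [MeasurableSpace S] [MeasurableSpace A] in
lemma Obs.unextend_extend {T : Type*} {j : ℕ} (q : ((T × Obs S A j) × A) × S) :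
    Obs.unextend (q.1.1.1, Obs.extend q.1.1.2 q.1.2 q.2) = q := by
  simp only [Obs.unextend, Obs.extend, Fin.snoc_castSucc, Fin.snoc_last]

namespace Model

variable (M : Model S A H d) (pl : Planner S A H d)

section Stages

variable {T : Type*} [MeasurableSpace T] (m : Measure T)
  (post : Kernel T (Param H d))

/-- The joint law of the history together with the observations up to stage `j` of the next
episode, of `θ_h`, and of the remaining components together with the planning parameter. -/
def stageLaw (h : Fin H) (j : ℕ) (hj : j ≤ H) :
    Measure ((T × Obs S A j) × EuclideanSpace ℝ (Fin d) × (Param H d × Param H d)) :=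
  ((m ⊗ₘ (post ×ₖ post)) ⊗ₘ (M.obsKernel pl j hj).comap Prod.snd measurable_snd).map
    fun q => ((q.1.1, q.2), q.1.2.1 h, (Param.erase h q.1.2.1, q.1.2.2))

lemma measurable_stageVars (h : Fin H) (j : ℕ) :
    Measurable fun q : (T × (Param H d × Param H d)) × Obs S A j =>
      (((q.1.1, q.2), q.1.2.1 h, (Param.erase h q.1.2.1, q.1.2.2)) :
        (T × Obs S A j) × EuclideanSpace ℝ (Fin d) × (Param H d × Param H d)) := by
  have := Param.measurable_erase (d := d) h
  fun_prop

variable [IsProbabilityMeasure m] [IsMarkovKernel post]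

lemma lintegral_stageLaw (h : Fin H) (j : ℕ) (hj : j ≤ H)
    {f : (T × Obs S A j) × EuclideanSpace ℝ (Fin d) × (Param H d × Param H d) → ENNReal}
    (hf : Measurable f) :
    ∫⁻ q, f q ∂(M.stageLaw pl m post h j hj) =
      ∫⁻ t, ∫⁻ p, ∫⁻ o, f ((t, o), p.1 h, (Param.erase h p.1, p.2)) ∂(M.obsKernel pl j hj p)
        ∂((post t).prod (post t)) ∂m := by
  have hm := measurable_stageVars (S := S) (A := A) (T := T) (d := d) h j
  have hfm : Measurable fun q : (T × (Param H d × Param H d)) × Obs S A j =>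
      f ((q.1.1, q.2), q.1.2.1 h, (Param.erase h q.1.2.1, q.1.2.2)) := hf.comp hm
  rw [stageLaw, lintegral_map hf hm, Measure.lintegral_compProd hfm, Measure.lintegral_compProd]
  · refine lintegral_congr fun t => ?_
    rw [Kernel.prod_apply]
    rfl
  · exact Measurable.lintegral_kernel_prod_right'
      (κ := (M.obsKernel pl j hj).comap Prod.snd measurable_snd) hfm

/-- The planning parameter is drawn from the history alone, so it may join the second party. The
initial state is a message that depends on neither party. -/
lemma isCondIndep_stageLaw_zero {h : Fin H}
    (hci : IsCondIndep ((m ⊗ₘ post).map fun p => (p.1, p.2 h, Param.erase h p.2))) :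
    IsCondIndep (M.stageLaw pl m post h 0 (Nat.zero_le _)) := by
  have her := Param.measurable_erase (d := d) h
  have hm0 : Measurable fun s : S => ((Fin.elim0, s) : Obs S A 0) :=
    measurable_const.prodMk measurable_id
  have hprob : IsProbabilityMeasure (M.ρ.map fun s : S => ((Fin.elim0, s) : Obs S A 0)) :=
    Measure.isProbabilityMeasure_map hm0.aemeasurable
  have h1 := (hci.prod_right post).message_right
    (Kernel.const (T × (Param H d × Param H d)) (M.ρ.map fun s : S => ((Fin.elim0, s) : Obs S A 0)))
    (g := id) measurable_id (g' := id) measurable_id fun _ => rfl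
  convert h1 using 1
  refine Measure.ext_of_lintegral _ fun f hf => ?_
  have e : ∀ p, M.obsKernel pl 0 (Nat.zero_le _) p =
      M.ρ.map fun s => ((Fin.elim0, s) : Obs S A 0) :=
    fun p => rfl
  rw [M.lintegral_stageLaw pl m post h 0 _ hf, lintegral_map hf (by fun_prop)]
  simp only [id]
  have hp1 : IsProbabilityMeasure ((m ⊗ₘ post).map fun p => (p.1, p.2 h, Param.erase h p.2)) :=
    Measure.isProbabilityMeasure_map (Measurable.aemeasurable (by fun_prop))
  set ζ := M.ρ.map fun s : S => ((Fin.elim0, s) : Obs S A 0)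
  have hF : Measurable fun q : T × EuclideanSpace ℝ (Fin d) × (Param H d × Param H d) =>
      ∫⁻ o, f ((q.1, o), q.2) ∂ζ :=
    Measurable.lintegral_prod_right' (f := fun r : (T × EuclideanSpace ℝ (Fin d) ×
      (Param H d × Param H d)) × Obs S A 0 => f ((r.1.1, r.2), r.1.2)) (by fun_prop)
  have hF2 : Measurable fun q : T × EuclideanSpace ℝ (Fin d) × Param H d =>
      ∫⁻ Θ', ∫⁻ o, f ((q.1, o), q.2.1, (q.2.2, Θ')) ∂ζ ∂(post q.1) :=
    Measurable.lintegral_kernel_prod_right'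
      (κ := post.comap (fun q : T × EuclideanSpace ℝ (Fin d) × Param H d => q.1) measurable_fst)
      (f := fun r : (T × EuclideanSpace ℝ (Fin d) × Param H d) × Param H d =>
        ∫⁻ o, f ((r.1.1, o), r.1.2.1, (r.1.2.2, r.2)) ∂ζ)
      (hF.comp (f := fun r : (T × EuclideanSpace ℝ (Fin d) × Param H d) × Param H d =>
        (r.1.1, r.1.2.1, (r.1.2.2, r.2))) (by fun_prop))
  rw [Measure.lintegral_compProd (by fun_prop)]
  simp only [Kernel.comap_apply, Kernel.const_apply]
  rw [lintegral_map hF (by fun_prop), Measure.lintegral_compProd (by fun_prop)]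
  simp only [Kernel.comap_apply]
  have hF3 : Measurable fun a : T × Param H d =>
      ∫⁻ Θ', ∫⁻ o, f ((a.1, o), a.2 h, (Param.erase h a.2, Θ')) ∂ζ ∂(post a.1) :=
    hF2.comp (f := fun a : T × Param H d => (a.1, a.2 h, Param.erase h a.2)) (by fun_prop)
  rw [lintegral_map hF2 (by fun_prop), Measure.lintegral_compProd hF3]
  refine lintegral_congr fun t => ?_
  simp only [e]
  rw [lintegral_prod]
  refine (hF.comp (f := fun p : Param H d × Param H d =>
    (t, p.1 h, (Param.erase h p.1, p.2))) (by fun_prop)).aemeasurable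

/-- The action of stage `j` is a message of the holder of the planning parameter. -/
def actionKernel (T : Type*) [MeasurableSpace T] (i : Fin H) (j : ℕ) :
    Kernel ((T × Obs S A j) × (Param H d × Param H d)) A :=
  Kernel.deterministic (fun q => pl.policy q.2.2 i q.1.2.2)
    ((pl.measurable_policy i).comp (f := fun q : (T × Obs S A j) × (Param H d × Param H d) =>
      (q.2.2, q.1.2.2)) (by fun_prop))

instance (T : Type*) [MeasurableSpace T] (i : Fin H) (j : ℕ) :
    IsMarkovKernel (actionKernel (S := S) (d := d) pl T i j) := by
  unfold actionKernel; infer_instance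

/-- The action is deterministic given the transcript and the planning parameter, so its message
integrates to a substitution. The result has the same form as in `lintegral_stageLaw_succ`. -/
lemma lintegral_action_message {j : ℕ} (i : Fin H)
    (μ : Measure ((T × Obs S A j) × EuclideanSpace ℝ (Fin d) × (Param H d × Param H d)))
    [SFinite μ]
    (K : Kernel (((T × Obs S A j) × A) × EuclideanSpace ℝ (Fin d) × (Param H d × Param H d)) S)
    [IsMarkovKernel K]
    {f : (T × Obs S A (j + 1)) × EuclideanSpace ℝ (Fin d) × (Param H d × Param H d) → ENNReal}
    (hf : Measurable f) :
    ∫⁻ q, f q ∂((((μ ⊗ₘ (actionKernel pl T i j).comap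
        (fun p : (T × Obs S A j) × EuclideanSpace ℝ (Fin d) × (Param H d × Param H d) =>
          (p.1, p.2.2)) (by fun_prop)).map fun q => (id (q.1.1, q.2), q.1.2)) ⊗ₘ K).map
        fun q => ((q.1.1.1.1, Obs.extend q.1.1.1.2 q.1.1.2 q.2), q.1.2)) =
      ∫⁻ q, ∫⁻ s, f ((q.1.1, Obs.extend q.1.2 (pl.policy q.2.2.2 i q.1.2.2) s), q.2)
        ∂(K ((q.1, pl.policy q.2.2.2 i q.1.2.2), q.2)) ∂μ := by
  have hg : Measurable fun q : (((T × Obs S A j) × A) × EuclideanSpace ℝ (Fin d) ×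
      (Param H d × Param H d)) × S =>
      ((q.1.1.1.1, Obs.extend q.1.1.1.2 q.1.1.2 q.2), q.1.2) := by
    have := Obs.measurable_extend (S := S) (A := A) (h := j) |>.comp
      (f := fun q : (((T × Obs S A j) × A) × EuclideanSpace ℝ (Fin d) ×
        (Param H d × Param H d)) × S => ((q.1.1.1.2, q.1.1.2), q.2)) (by fun_prop)
    simp only [Function.comp_def] at this
    exact Measurable.prodMk (Measurable.prodMk (by fun_prop) this) (by fun_prop)
  have hfg := hf.comp hg
  simp only [Function.comp_def] at hfg
  have hF : Measurable fun q : ((T × Obs S A j) × A) × EuclideanSpace ℝ (Fin d) ×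
      (Param H d × Param H d) => ∫⁻ s, f ((q.1.1.1, Obs.extend q.1.1.2 q.1.2 s), q.2) ∂(K q) :=
    Measurable.lintegral_kernel_prod_right' (κ := K) hfg
  have hF2 := hF.comp (f := fun q : ((T × Obs S A j) × EuclideanSpace ℝ (Fin d) ×
    (Param H d × Param H d)) × A => ((q.1.1, q.2), q.1.2)) (by fun_prop)
  simp only [Function.comp_def] at hF2
  have hm : Measurable fun q : ((T × Obs S A j) × EuclideanSpace ℝ (Fin d) ×
    (Param H d × Param H d)) × A => (((q.1.1, q.2) : (T × Obs S A j) × A), q.1.2) := by fun_prop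
  simp only [id]
  rw [lintegral_map hf hg, Measure.lintegral_compProd hfg, lintegral_map hF hm,
    Measure.lintegral_compProd hF2]
  refine lintegral_congr fun q => ?_
  have h3 := hF2.comp (measurable_prodMk_left (x := q))
  simp only [Function.comp_def] at h3
  rw [Kernel.comap_apply, actionKernel, Kernel.deterministic_apply]
  exact lintegral_dirac' _ h3

/-- The kernel K stands for the transition of stage j, read off from whichever party owns θ_j.
Keeping it abstract covers the cases j = h and j ≠ h together. -/
lemma lintegral_stageLaw_succ (h : Fin H) (j : ℕ) (hj : j + 1 ≤ H)
    {f : (T × Obs S A (j + 1)) × EuclideanSpace ℝ (Fin d) × (Param H d × Param H d) → ENNReal}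
    (hf : Measurable f)
    (K : Kernel (((T × Obs S A j) × A) × EuclideanSpace ℝ (Fin d) × (Param H d × Param H d)) S)
    [IsMarkovKernel K]
    (hK : ∀ (t : T) (o : Obs S A j) (a : A) (p : Param H d × Param H d),
      K (((t, o), a), p.1 h, (Param.erase h p.1, p.2)) =
        M.transition ⟨j, hj⟩ (p.1, (o.2, a))) :
    ∫⁻ q, f q ∂(M.stageLaw pl m post h (j + 1) hj) =
      ∫⁻ q, ∫⁻ s, f ((q.1.1, Obs.extend q.1.2 (pl.policy q.2.2.2 ⟨j, hj⟩ q.1.2.2) s), q.2)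
        ∂(K ((q.1, pl.policy q.2.2.2 ⟨j, hj⟩ q.1.2.2), q.2))
        ∂(M.stageLaw pl m post h j (Nat.le_of_succ_le hj)) := by
  have hact : Measurable fun q : (T × Obs S A j) × EuclideanSpace ℝ (Fin d) ×
      (Param H d × Param H d) => pl.policy q.2.2.2 ⟨j, hj⟩ q.1.2.2 :=
    (pl.measurable_policy ⟨j, hj⟩).comp (f := fun q : (T × Obs S A j) ×
      EuclideanSpace ℝ (Fin d) × (Param H d × Param H d) => (q.2.2.2, q.1.2.2)) (by fun_prop)
  have hg : Measurable fun r : ((T × Obs S A j) × EuclideanSpace ℝ (Fin d) ×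
      (Param H d × Param H d)) × S =>
      ((r.1.1.1, Obs.extend r.1.1.2 (pl.policy r.1.2.2.2 ⟨j, hj⟩ r.1.1.2.2) r.2), r.1.2) := by
    have := Obs.measurable_extend (S := S) (A := A) (h := j) |>.comp
      (f := fun r : ((T × Obs S A j) × EuclideanSpace ℝ (Fin d) × (Param H d × Param H d)) × S =>
        ((r.1.1.2, pl.policy r.1.2.2.2 ⟨j, hj⟩ r.1.1.2.2), r.2))
        (Measurable.prodMk (Measurable.prodMk (by fun_prop) (hact.comp measurable_fst))
          measurable_snd)
    simp only [Function.comp_def] at this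
    exact Measurable.prodMk (Measurable.prodMk (by fun_prop) this) (by fun_prop)
  have hfg := hf.comp hg
  simp only [Function.comp_def] at hfg
  have hF : Measurable fun q : (T × Obs S A j) × EuclideanSpace ℝ (Fin d) ×
      (Param H d × Param H d) =>
      ∫⁻ s, f ((q.1.1, Obs.extend q.1.2 (pl.policy q.2.2.2 ⟨j, hj⟩ q.1.2.2) s), q.2)
        ∂(K ((q.1, pl.policy q.2.2.2 ⟨j, hj⟩ q.1.2.2), q.2)) :=
    Measurable.lintegral_kernel_prod_right'
      (κ := K.comap (fun q : (T × Obs S A j) × EuclideanSpace ℝ (Fin d) ×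
        (Param H d × Param H d) => ((q.1, pl.policy q.2.2.2 ⟨j, hj⟩ q.1.2.2), q.2))
        (by fun_prop)) hfg
  rw [M.lintegral_stageLaw pl m post h _ _ hf, M.lintegral_stageLaw pl m post h _ _ hF]
  refine lintegral_congr fun t => lintegral_congr fun p => ?_
  have h3 := hf.comp (f := fun o : Obs S A (j + 1) =>
    ((t, o), p.1 h, (Param.erase h p.1, p.2))) (by fun_prop)
  simp only [Function.comp_def] at h3
  rw [obsKernel_apply, M.lintegral_obsLaw_succ p.1 (pl.measurable_policy_apply p.2) j hj h3]
  simp only [hK]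
  rfl

instance (h : Fin H) (j : ℕ) (hj : j ≤ H) : IsProbabilityMeasure (M.stageLaw pl m post h j hj) :=
  Measure.isProbabilityMeasure_map (measurable_stageVars h j).aemeasurable

/-- Given the history and the observations of the current episode, `θ_h` is independent of the
remaining components together with the planning parameter. -/
lemma isCondIndep_stageLaw {h : Fin H}
    (hci : IsCondIndep ((m ⊗ₘ post).map fun p => (p.1, p.2 h, Param.erase h p.2)))
    (j : ℕ) (hj : j ≤ H) : IsCondIndep (M.stageLaw pl m post h j hj) := by
  induction j with
  | zero => exact M.isCondIndep_stageLaw_zero pl m post hci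
  | succ j ih =>
    have h1 := (ih (Nat.le_of_succ_le hj)).message_right (actionKernel pl T ⟨j, hj⟩ j)
      (g := id) measurable_id (g' := id) measurable_id fun _ => rfl
    have hg : Measurable fun q : ((T × Obs S A j) × A) × S =>
        (q.1.1.1, Obs.extend q.1.1.2 q.1.2 q.2) := by
      have := Obs.measurable_extend (S := S) (A := A) (h := j) |>.comp
        (f := fun q : ((T × Obs S A j) × A) × S => ((q.1.1.2, q.1.2), q.2)) (by fun_prop)
      simp only [Function.comp_def] at this
      exact Measurable.prodMk (by fun_prop) this
    -- The next state is a message of θ_h at stage h, and of the holder of the other components at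
    -- every other stage.
    by_cases hjh : (⟨j, hj⟩ : Fin H) = h
    · let K : Kernel (((T × Obs S A j) × A) × EuclideanSpace ℝ (Fin d)) S :=
        (M.coordTransition ⟨j, hj⟩).comap (fun q => (q.2, (q.1.1.2.2, q.1.2))) (by fun_prop)
      have h2 := h1.message_left K hg Obs.measurable_unextend Obs.unextend_extend
      convert h2 using 1
      refine Measure.ext_of_lintegral _ fun f hf => ?_
      rw [lintegral_action_message pl ⟨j, hj⟩ _ (K.comap (fun p => (p.1, p.2.1)) (by fun_prop)) hf,
        M.lintegral_stageLaw_succ pl m post h j hj hf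
          (K.comap (fun p => (p.1, p.2.1)) (by fun_prop))]
      intro t o a p
      rw [Kernel.comap_apply, Kernel.comap_apply, ← hjh]
      exact M.coordTransition_apply _ _ _
    · let K : Kernel (((T × Obs S A j) × A) × (Param H d × Param H d)) S :=
        (M.transition ⟨j, hj⟩).comap (fun q => (q.2.1, (q.1.1.2.2, q.1.2))) (by fun_prop)
      have h2 := h1.message_right K hg Obs.measurable_unextend Obs.unextend_extend
      convert h2 using 1
      refine Measure.ext_of_lintegral _ fun f hf => ?_
      rw [lintegral_action_message pl ⟨j, hj⟩ _ (K.comap (fun p => (p.1, p.2.2)) (by fun_prop)) hf,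
        M.lintegral_stageLaw_succ pl m post h j hj hf
          (K.comap (fun p => (p.1, p.2.2)) (by fun_prop))]
      intro t o a p
      rw [Kernel.comap_apply, Kernel.comap_apply]
      exact M.transition_congr (Param.erase_of_ne hjh _) _

end Stages

end Model

end LinearMixture

/-! ### Measurable dependence of posterior moments and errors on the history. -/

namespace LinearMixture

open Matrix

variable {S A : Type*} [MeasurableSpace S] [MeasurableSpace A] {H d : ℕ}

section MeasurableMatrix

variable {T n : Type*} [MeasurableSpace T]

lemma measurable_trace_mul [Fintype n] {B C : T → Matrix n n ℝ}
    (hB : ∀ i j, Measurable fun t => B t i j) (hC : ∀ i j, Measurable fun t => C t i j) :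
    Measurable fun t => (B t * C t).trace := by
  simp only [trace, diag_apply, mul_apply]
  exact Finset.measurable_sum _ fun i _ => Finset.measurable_sum _ fun j _ => (hB i j).mul (hC j i)

lemma measurable_one_add_smul_apply [DecidableEq n] {B : T → Matrix n n ℝ}
    (hB : ∀ i j, Measurable fun t => B t i j) (k : ℝ) (i j : n) :
    Measurable fun t => (1 + k • B t) i j := by
  simp only [Matrix.add_apply, Matrix.smul_apply]
  exact ((hB i j).const_smul k).const_add _

variable [Fintype n] [DecidableEq n]

lemma measurable_det {B : T → Matrix n n ℝ} (hB : ∀ i j, Measurable fun t => B t i j) :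
    Measurable fun t => (B t).det := by
  simp only [det_apply]
  exact Finset.measurable_sum _ fun σ _ => (Finset.measurable_prod _ fun i _ => hB _ _).const_smul _

/-- By the adjugate formula every entry of the inverse is a quotient of determinants; the convention
for singular matrices is measurable as well. -/
lemma measurable_inv_apply {B : T → Matrix n n ℝ} (hB : ∀ i j, Measurable fun t => B t i j)
    (i j : n) : Measurable fun t => (B t)⁻¹ i j := by
  simp only [Matrix.inv_def, Matrix.smul_apply, adjugate_apply, Ring.inverse_eq_inv', smul_eq_mul]
  refine (measurable_det hB).inv.mul (measurable_det fun k l => ?_)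
  by_cases hk : k = j
  · simp [hk, updateRow_self]
  · simp only [updateRow_ne hk]
    exact hB k l

end MeasurableMatrix

section MeasurablePosterior

variable {T : Type*} [MeasurableSpace T] (post : Kernel T (Param H d)) [IsSFiniteKernel post]

lemma measurable_meanVec_marginal (h : Fin H) (i : Fin d) :
    Measurable fun t => meanVec (marginal (post t) h) i := by
  have e : ∀ t, meanVec (marginal (post t) h) i = ∫ Θ, Θ h i ∂(post t) := fun t => by
    rw [meanVec, marginal, integral_map (measurable_pi_apply h).aemeasurable
      (Measurable.aestronglyMeasurable (by fun_prop))]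
  simp only [e]
  refine (StronglyMeasurable.integral_kernel_prod_right' (κ := post)
    (f := fun q : T × Param H d => q.2 h i) ?_).measurable
  exact Measurable.stronglyMeasurable (by fun_prop)

lemma measurable_covMat_marginal (h : Fin H) (i j : Fin d) :
    Measurable fun t => covMat (marginal (post t) h) i j := by
  have hm := measurable_meanVec_marginal post h
  have e : ∀ t, covMat (marginal (post t) h) i j =
      ∫ Θ, (Θ h i - meanVec (marginal (post t) h) i) *
        (Θ h j - meanVec (marginal (post t) h) j) ∂(post t) := fun t => by
    rw [covMat, of_apply, marginal, integral_map (measurable_pi_apply h).aemeasurable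
      (Measurable.aestronglyMeasurable (by fun_prop))]
  simp only [e]
  refine (StronglyMeasurable.integral_kernel_prod_right' (κ := post)
    (f := fun q : T × Param H d => (q.2 h i - meanVec (marginal (post q.1) h) i) *
        (q.2 h j - meanVec (marginal (post q.1) h) j)) ?_).measurable
  exact Measurable.stronglyMeasurable
    (((by fun_prop : Measurable fun q : T × Param H d => q.2 h i).sub
        ((hm i).comp measurable_fst)).mul
      ((by fun_prop : Measurable fun q : T × Param H d => q.2 h j).sub
        ((hm j).comp measurable_fst)))

namespace Model

variable (M : Model S A H d) (pl : Planner S A H d)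

lemma measurable_expPredVar (h : Fin H) : Measurable fun t => M.expPredVar pl (post t) h := by
  have hf : ∀ i, Measurable fun q : (T × (Param H d × Param H d)) × Obs S A h =>
      M.featVec pl h q.1.2.2 (stageInput pl h (q.1.2, q.2)) i := fun i =>
    (M.measurable_featVec pl h i).comp
      (f := fun q : (T × (Param H d × Param H d)) × Obs S A h =>
        (q.1.2.2, stageInput pl h (q.1.2, q.2)))
      (Measurable.prodMk (by fun_prop) ((measurable_stageInput pl h).comp
        (f := fun q : (T × (Param H d × Param H d)) × Obs S A h => (q.1.2, q.2)) (by fun_prop)))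
  have hc : ∀ i j, Measurable fun q : (T × (Param H d × Param H d)) × Obs S A h =>
      covMat (marginal (post q.1.1) h) i j := fun i j =>
    (measurable_covMat_marginal post h i j).comp (measurable_fst.comp measurable_fst)
  have h1 : Measurable fun q : (T × (Param H d × Param H d)) × Obs S A h =>
      ENNReal.ofReal (M.predVar pl (post q.1.1) h q.1.2.2 (stageInput pl h (q.1.2, q.2))) := by
    simp only [predVar, quadForm_eq_sum]
    refine ENNReal.measurable_ofReal.comp ?_
    exact Finset.measurable_sum _ fun i _ => Finset.measurable_sum _ fun j _ =>
      (hc i j).mul ((hf i).mul (hf j))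
  have h2 := h1.lintegral_kernel_prod_right'
    (κ := (M.obsKernel pl h h.2.le).comap (Prod.snd : T × (Param H d × Param H d) → _)
      measurable_snd)
  have h3 := h2.lintegral_kernel_prod_right' (κ := post ×ₖ post)
  simpa only [Kernel.prod_apply, Kernel.comap_apply, expPredVar] using h3

lemma measurable_sqError_posterior {W : T → Matrix (Fin d) (Fin d) ℝ}
    (hW : ∀ i j, Measurable fun t => W t i j) (h : Fin H) :
    Measurable fun q : T × (EuclideanSpace ℝ (Fin d) × Param H d) × ((S × A) × S) =>
      M.sqError pl (W q.1) (post q.1) h q.2.1.1 q.2.1.2 q.2.2 := by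
  have hf : ∀ i, Measurable fun q : T × (EuclideanSpace ℝ (Fin d) × Param H d) ×
      ((S × A) × S) => M.featVec pl h q.2.1.2 q.2.2.1 i := fun i =>
    (M.measurable_featVec pl h i).comp (f := fun q : T × (EuclideanSpace ℝ (Fin d) × Param H d) ×
      ((S × A) × S) => (q.2.1.2, q.2.2.1)) (by fun_prop)
  have hv : Measurable fun q : T × (EuclideanSpace ℝ (Fin d) × Param H d) × ((S × A) × S) =>
      M.nextValue pl h q.2.1.2 q.2.2.2 :=
    (M.measurable_nextValue pl h).comp (f := fun q : T × (EuclideanSpace ℝ (Fin d) × Param H d) ×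
      ((S × A) × S) => (q.2.1.2, q.2.2.2)) (by fun_prop)
  have hc : ∀ i j, Measurable fun q : T × (EuclideanSpace ℝ (Fin d) × Param H d) ×
      ((S × A) × S) => covMat (marginal (post q.1) h) i j := fun i j =>
    (measurable_covMat_marginal post h i j).comp measurable_fst
  have hm : ∀ i, Measurable fun q : T × (EuclideanSpace ℝ (Fin d) × Param H d) ×
      ((S × A) × S) => meanVec (marginal (post q.1) h) i := fun i =>
    (measurable_meanVec_marginal post h i).comp measurable_fst
  have hw : ∀ i j, Measurable fun q : T × (EuclideanSpace ℝ (Fin d) × Param H d) ×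
      ((S × A) × S) => W q.1 i j := fun i j => (hW i j).comp measurable_fst
  have hi : ∀ i, Measurable fun q : T × (EuclideanSpace ℝ (Fin d) × Param H d) ×
      ((S × A) × S) =>
      (q.2.1.1.ofLp - M.estimator pl (post q.1) h q.2.1.2 q.2.2) i := by
    intro i
    simp only [estimator, Pi.sub_apply, Pi.add_apply, Pi.smul_apply, smul_eq_mul, dotProduct,
      mulVec]
    have h1 : Measurable fun q : T × (EuclideanSpace ℝ (Fin d) × Param H d) ×
      ((S × A) × S) => q.2.1.1.ofLp i := by fun_prop
    exact h1.sub ((hm i).add (((hv.sub (Finset.measurable_sum _ fun j _ =>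
      (hf j).mul (hm j))).const_mul 4).mul
      (Finset.measurable_sum _ fun j _ => (hc i j).mul (hf j))))
  simp only [sqError, quadForm_eq_sum]
  exact ENNReal.measurable_ofReal.comp (Finset.measurable_sum _ fun i _ =>
    Finset.measurable_sum _ fun j _ => (hw i j).mul ((hi i).mul (hi j)))

end Model

end MeasurablePosterior

end LinearMixture

/-! ### Optimality of the conditional mean, and almost sure properties of posteriors. -/

namespace LinearMixture

open Matrix

variable {S A : Type*} [MeasurableSpace S] [MeasurableSpace A] {H d : ℕ}

lemma map_compProd_eq_compProd_map {T X Y : Type*} [MeasurableSpace T] [MeasurableSpace X]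
    [MeasurableSpace Y] (m : Measure T) [SFinite m] (K : Kernel T X) [IsSFiniteKernel K]
    {g : X → Y} (hg : Measurable g) :
    (m ⊗ₘ K).map (fun p => (p.1, g p.2)) = m ⊗ₘ K.map g := by
  refine Measure.ext_of_lintegral _ fun f hf => ?_
  rw [lintegral_map hf (by fun_prop), Measure.lintegral_compProd (by fun_prop),
    Measure.lintegral_compProd hf]
  refine lintegral_congr fun t => ?_
  rw [Kernel.map_apply _ hg, lintegral_map (by fun_prop) hg]

/-- Among all estimators, the conditional mean minimizes the expected squared error. -/
lemma IsCondIndep.lintegral_trace_le {T Y : Type*} [MeasurableSpace T] [MeasurableSpace Y]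
    {ν : Measure (T × EuclideanSpace ℝ (Fin d) × Y)} (hν : IsCondIndep ν) {m : Measure T}
    [IsProbabilityMeasure m] {K : Kernel T (EuclideanSpace ℝ (Fin d))} [IsMarkovKernel K]
    (hK : ν.map (fun p => (p.1, p.2.1)) = m ⊗ₘ K) {W : T → Matrix (Fin d) (Fin d) ℝ}
    (hW : ∀ᵐ t ∂m, (W t).PosSemidef) (hmem : ∀ᵐ t ∂m, MemLp (fun x => x) 2 (K t))
    {F : T × EuclideanSpace ℝ (Fin d) × Y → ENNReal} (hF : Measurable F)
    {c : T → Y → Fin d → ℝ} (hFc : ∀ t x y, F (t, x, y) =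
      ENNReal.ofReal ((x.ofLp - c t y) ⬝ᵥ W t *ᵥ (x.ofLp - c t y))) :
    ∫⁻ t, ENNReal.ofReal (W t * covMat (K t)).trace ∂m ≤ ∫⁻ p, F p ∂ν := by
  obtain ⟨m', P, Q, hm, hP, hQ, rfl⟩ := hν
  have e1 : (m' ⊗ₘ (P ×ₖ Q)).map (fun p => (p.1, p.2.1)) = m' ⊗ₘ P := by
    rw [map_compProd_eq_compProd_map _ _ measurable_fst, ← Kernel.fst_eq, Kernel.fst_prod]
  rw [e1] at hK
  have hm' : m' = m := by
    have := congrArg Measure.fst hK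
    rwa [Measure.fst_compProd, Measure.fst_compProd] at this
  subst hm'
  have hPK := Kernel.ae_eq_of_compProd_eq hK
  rw [lintegral_compProd_prod hF]
  refine lintegral_mono_ae ?_
  filter_upwards [hW, hmem, hPK] with t hW hmem hPK
  -- Conditional independence lets y be fixed first without changing the law of x. The estimator is
  -- then a constant, which cannot beat the mean.
  rw [hPK, lintegral_lintegral_swap (by fun_prop)]
  calc ENNReal.ofReal (W t * covMat (K t)).trace
      = ∫⁻ _y, ENNReal.ofReal (W t * covMat (K t)).trace ∂(Q t) := by simp
    _ ≤ _ := lintegral_mono fun y => by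
        simp only [hFc]
        exact ofReal_trace_le_lintegral_quadForm hmem hW _

section AlmostSure

variable {T : Type*} [MeasurableSpace T] {m : Measure T} [IsProbabilityMeasure m]
  {post : Kernel T (Param H d)} [IsMarkovKernel post]

-- The second moment under the mixture is the average of those under the components, so almost every
-- one of them is finite.
omit [IsProbabilityMeasure m] [IsMarkovKernel post] in
lemma ae_memLp_of_comp {h : Fin H} (hmem : MemLp (fun Θ : Param H d => Θ h) 2 (post ∘ₘ m)) :
    ∀ᵐ t ∂m, MemLp (fun Θ : Param H d => Θ h) 2 (post t) := by
  have hm : Measurable fun Θ : Param H d => ‖Θ h‖ₑ ^ (2 : ENNReal).toReal := by fun_prop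
  have h1 := lintegral_rpow_enorm_lt_top_of_eLpNorm_lt_top (by simp) (by simp) hmem.2
  rw [Measure.lintegral_bind post.aemeasurable hm.aemeasurable] at h1
  filter_upwards [ae_lt_top hm.lintegral_kernel h1.ne] with t ht
  refine ⟨(measurable_pi_apply h).aestronglyMeasurable, ?_⟩
  rw [eLpNorm_lt_top_iff_lintegral_rpow_enorm_lt_top (by simp) (by simp)]
  exact ht

/-- Conditional independence as a statement about the joint law becomes independence under almost
every posterior, since the spaces of the two components are standard Borel. -/
lemma ae_indepFun_of_isCondIndep {h : Fin H}
    (hci : IsCondIndep ((m ⊗ₘ post).map fun p => (p.1, p.2 h, Param.erase h p.2))) :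
    ∀ᵐ t ∂m, IndepFun (fun Θ : Param H d => Θ h) (Param.erase h) (post t) := by
  have her := Param.measurable_erase (d := d) h
  have hg : Measurable fun Θ : Param H d => (Θ h, Param.erase h Θ) := by fun_prop
  have := Kernel.IsMarkovKernel.map post hg
  rw [map_compProd_eq_compProd_map m post hg] at hci
  obtain ⟨P, Q, hP, hQ, -, hae⟩ := hci.ae_eq_prod
  filter_upwards [hae] with t ht
  rw [Kernel.map_apply _ hg] at ht
  rw [indepFun_iff_map_prod_eq_prod_map_map (measurable_pi_apply h).aemeasurable
    her.aemeasurable, ht]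
  have h1 := congrArg Measure.fst ht
  have h2 := congrArg Measure.snd ht
  rw [Measure.fst_prod, Measure.fst_map_prodMk her] at h1
  rw [Measure.snd_prod, Measure.snd_map_prodMk (measurable_pi_apply h)] at h2
  rw [h1, h2]

end AlmostSure

end LinearMixture

/-! ### Decrease of the log-determinant potential over one episode. -/

namespace LinearMixture

open Matrix

variable {S A : Type*} [MeasurableSpace S] [MeasurableSpace A] {H d : ℕ}

/-- The log-determinant potential of the covariance matrix of `θ_h` under `P`. -/
def logDet (k : ℝ) (P : Measure (Param H d)) (h : Fin H) : ENNReal :=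
  ENNReal.ofReal (Real.log (1 + k • covMat (marginal P h)).det)

lemma measurable_logDet {T : Type*} [MeasurableSpace T] (post : Kernel T (Param H d))
    [IsSFiniteKernel post] (k : ℝ) (h : Fin H) : Measurable fun t => logDet k (post t) h :=
  (measurable_det (measurable_one_add_smul_apply (measurable_covMat_marginal post h) k)).log
    |>.ennreal_ofReal

lemma logDet_add_le {P P' : Measure (Param H d)} [IsProbabilityMeasure P]
    [IsProbabilityMeasure P'] {h : Fin H}
    (hP : MemLp (fun Θ : Param H d => Θ h) 2 P) (hP' : MemLp (fun Θ : Param H d => Θ h) 2 P')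
    (k : ℕ) :
    logDet k P' h + (k + 1) * ENNReal.ofReal
        ((1 + ((k : ℝ) + 1) • covMat (marginal P h))⁻¹ * covMat (marginal P h)).trace ≤
      logDet (k + 1) P h + k * ENNReal.ofReal
        ((1 + ((k : ℝ) + 1) • covMat (marginal P h))⁻¹ * covMat (marginal P' h)).trace := by
  have hA := posSemidef_covMat (memLp_marginal hP)
  have hA' := posSemidef_covMat (memLp_marginal hP')
  have h0 := log_det_potential hA hA' (Nat.cast_nonneg (α := ℝ) k)
  have e1 : ((k : ENNReal) + 1) = ENNReal.ofReal ((k : ℝ) + 1) := by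
    rw [ENNReal.ofReal_add (by positivity) zero_le_one, ENNReal.ofReal_natCast, ENNReal.ofReal_one]
  have e2 : (k : ENNReal) = ENNReal.ofReal (k : ℝ) := (ENNReal.ofReal_natCast k).symm
  have hk1 : (0 : ℝ) ≤ (k : ℝ) + 1 := by positivity
  have hW := posSemidef_resolvent hA hk1
  have htr : 0 ≤ ((1 + ((k : ℝ) + 1) • covMat (marginal P h))⁻¹ * covMat (marginal P h)).trace := by
    rw [← integral_quadForm_dev (memLp_marginal hP)]
    exact integral_nonneg fun x => quadForm_nonneg hW _
  rw [logDet, logDet, e1, e2, ← ENNReal.ofReal_mul hk1, ← ENNReal.ofReal_mul (by positivity),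
    ← ENNReal.ofReal_add (log_det_one_add_smul_nonneg hA' (by positivity)) (by positivity)]
  exact (ENNReal.ofReal_le_ofReal h0).trans ENNReal.ofReal_add_le

namespace Model

variable (M : Model S A H d) (pl : Planner S A H d)

section Step

variable {T : Type*} [MeasurableSpace T] (m : Measure T) (post : Kernel T (Param H d))
  [IsProbabilityMeasure m] [IsMarkovKernel post]

/-- The joint law of the history together with the observations of the next episode and of the
true parameter. -/
def stepLaw : Measure ((T × Obs S A H) × Param H d) :=
  ((m ⊗ₘ (post ×ₖ post)) ⊗ₘ (M.obsKernel pl H le_rfl).comap Prod.snd measurable_snd).map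
    fun q => ((q.1.1, q.2), q.1.2.1)

lemma lintegral_stepLaw {f : (T × Obs S A H) × Param H d → ENNReal} (hf : Measurable f) :
    ∫⁻ q, f q ∂(M.stepLaw pl m post) =
      ∫⁻ t, ∫⁻ p, ∫⁻ o, f ((t, o), p.1) ∂(M.obsKernel pl H le_rfl p)
        ∂((post t).prod (post t)) ∂m := by
  have hfm : Measurable fun q : (T × (Param H d × Param H d)) × Obs S A H =>
      f ((q.1.1, q.2), q.1.2.1) := by fun_prop
  rw [stepLaw, lintegral_map hf (by fun_prop), Measure.lintegral_compProd hfm,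
    Measure.lintegral_compProd]
  · refine lintegral_congr fun t => ?_
    rw [Kernel.prod_apply]
    rfl
  · exact Measurable.lintegral_kernel_prod_right'
      (κ := (M.obsKernel pl H le_rfl).comap Prod.snd measurable_snd) hfm

/-- Both sides describe the same episode once the planning parameter is forgotten. -/
lemma map_stepLaw (h : Fin H) :
    (M.stepLaw pl m post).map (fun q => (q.1, q.2 h, Param.erase h q.2)) =
      (M.stageLaw pl m post h H le_rfl).map fun q => (q.1, q.2.1, q.2.2.1) := by
  have her := Param.measurable_erase (d := d) h
  refine Measure.ext_of_lintegral _ fun f hf => ?_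
  rw [lintegral_map hf (by fun_prop), lintegral_map hf (by fun_prop), lintegral_stepLaw _ _ _ _
    (by fun_prop), lintegral_stageLaw _ _ _ _ _ _ _ (by fun_prop)]

variable {m post} {m' : Measure (T × Obs S A H)} {post' : Kernel (T × Obs S A H) (Param H d)}

/-- If `θ_h` and the other components are independent under the posterior, then this remains true
after one more episode. -/
lemma isCondIndep_step (hstep : m' ⊗ₘ post' = M.stepLaw pl m post) {h : Fin H}
    (hci : IsCondIndep ((m ⊗ₘ post).map fun p => (p.1, p.2 h, Param.erase h p.2))) :
    IsCondIndep ((m' ⊗ₘ post').map fun p => (p.1, p.2 h, Param.erase h p.2)) := by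
  rw [hstep, map_stepLaw]
  exact (M.isCondIndep_stageLaw pl m post hci H le_rfl).map_right measurable_fst

variable [IsProbabilityMeasure m'] [IsMarkovKernel post']

lemma lintegral_fst_step (hstep : m' ⊗ₘ post' = M.stepLaw pl m post) {f : T → ENNReal}
    (hf : Measurable f) : ∫⁻ q, f q.1 ∂m' = ∫⁻ t, f t ∂m := by
  have h1 : ∫⁻ q, f q.1.1 ∂(m' ⊗ₘ post') = ∫⁻ q, f q.1.1 ∂(M.stepLaw pl m post) := by rw [hstep]
  rw [lintegral_stepLaw _ _ _ _ (by fun_prop), Measure.lintegral_compProd (by fun_prop)] at h1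
  simpa using h1

/-- Averaging the posterior over the history gives back the same law of the parameter, which is why
moments need be controlled under that law only. -/
lemma comp_step (hstep : m' ⊗ₘ post' = M.stepLaw pl m post) : post' ∘ₘ m' = post ∘ₘ m := by
  refine Measure.ext_of_lintegral _ fun f hf => ?_
  have h1 : ∫⁻ q, f q.2 ∂(m' ⊗ₘ post') = ∫⁻ q, f q.2 ∂(M.stepLaw pl m post) := by rw [hstep]
  rw [lintegral_stepLaw _ _ _ _ (by fun_prop), Measure.lintegral_compProd (by fun_prop)] at h1
  rw [Measure.lintegral_bind post'.aemeasurable hf.aemeasurable,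
    Measure.lintegral_bind post.aemeasurable hf.aemeasurable, h1]
  refine lintegral_congr fun t => ?_
  simp only [lintegral_const, measure_univ, mul_one]
  rw [lintegral_prod _ (by fun_prop)]
  simp

/-- The new covariance is that of θ_h given the history and the new episode alone. An estimator that
also knows the planning parameter still cannot beat it, because given those observations that
parameter carries no information on θ_h. -/
lemma lintegral_trace_step_le (hstep : m' ⊗ₘ post' = M.stepLaw pl m post) {h : Fin H}
    (hci : IsCondIndep ((m ⊗ₘ post).map fun p => (p.1, p.2 h, Param.erase h p.2)))
    (hmoment : MemLp (fun Θ : Param H d => Θ h) 2 (post ∘ₘ m))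
    {W : T → Matrix (Fin d) (Fin d) ℝ} (hWm : ∀ i j, Measurable fun t => W t i j)
    (hW : ∀ᵐ t ∂m, (W t).PosSemidef) :
    ∫⁻ q, ENNReal.ofReal (W q.1 * covMat (marginal (post' q) h)).trace ∂m' ≤
      ∫⁻ t, ∫⁻ p, ∫⁻ o, M.sqError pl (W t) (post t) h (p.1 h) p.2 (o.1 h, o.state (h + 1))
        ∂(M.obsKernel pl H le_rfl p) ∂((post t).prod (post t)) ∂m := by
  have her := Param.measurable_erase (d := d) h
  have hst := Obs.measurable_state (S := S) (A := A) (h := H) (h + 1)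
  have hpi : Measurable fun Θ : Param H d => Θ h := measurable_pi_apply h
  have hF := (M.measurable_sqError_posterior post pl hWm h).comp
    (f := fun q : (T × Obs S A H) × EuclideanSpace ℝ (Fin d) × (Param H d × Param H d) =>
      (q.1.1, (q.2.1, q.2.2.2), (q.1.2.1 h, q.1.2.state (h + 1)))) (by fun_prop)
  simp only [Function.comp_def] at hF
  have e := M.lintegral_stageLaw pl m post h H le_rfl hF
  dsimp only at e
  rw [← e]
  have := Kernel.IsMarkovKernel.map post' hpi
  have hqm : ∀ q, post'.map (fun Θ => Θ h) q = marginal (post' q) h := fun q =>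
    Kernel.map_apply _ hpi q
  have hmem := ae_memLp_of_comp (m := m') (post := post') (h := h) (by rwa [M.comp_step pl hstep])
  have hK : (M.stageLaw pl m post h H le_rfl).map (fun p => (p.1, p.2.1)) =
      m' ⊗ₘ post'.map fun Θ => Θ h := by
    rw [← map_compProd_eq_compProd_map m' post' hpi, hstep]
    have h2 := congrArg (Measure.map fun q : (T × Obs S A H) × EuclideanSpace ℝ (Fin d) ×
      Param H d => (q.1, q.2.1)) (M.map_stepLaw pl m post h)
    rw [Measure.map_map (by fun_prop) (by fun_prop), Measure.map_map (by fun_prop)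
      (by fun_prop)] at h2
    exact h2.symm
  have hW' : ∀ᵐ q ∂m', (W q.1).PosSemidef := by
    have hfst : m'.map Prod.fst = m := by
      refine Measure.ext_of_lintegral _ fun f hf => ?_
      rw [lintegral_map hf measurable_fst, M.lintegral_fst_step pl hstep hf]
    rw [← hfst] at hW
    exact ae_of_ae_map measurable_fst.aemeasurable hW
  have h3 := (M.isCondIndep_stageLaw pl m post hci H le_rfl).lintegral_trace_le hK
    (W := fun q => W q.1) hW' (by
      filter_upwards [hmem] with q hq
      rw [hqm]
      exact memLp_marginal hq) hF (c := fun q y => M.estimator pl (post q.1) h y.2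
        (q.2.1 h, q.2.state (h + 1))) fun t x y => rfl
  simpa only [hqm] using h3

/-- Half of the expected prediction variance of an episode is at most the decrease of the
log-determinant potential. -/
lemma lintegral_logDet_step_le (hM : M.BoundedFeatures)
    (hstep : m' ⊗ₘ post' = M.stepLaw pl m post) {h : Fin H}
    (hci : IsCondIndep ((m ⊗ₘ post).map fun p => (p.1, p.2 h, Param.erase h p.2)))
    (hproper : ∀ᵐ Θ ∂(post ∘ₘ m), M.IsProper Θ)
    (hmoment : MemLp (fun Θ : Param H d => Θ h) 2 (post ∘ₘ m)) (k : ℕ) :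
    ∫⁻ q, logDet k (post' q) h ∂m' + 2⁻¹ * ∫⁻ t, M.expPredVar pl (post t) h ∂m ≤
      ∫⁻ t, logDet (k + 1) (post t) h ∂m := by
  have hmem := ae_memLp_of_comp hmoment
  have hmem' := ae_memLp_of_comp (m := m') (post := post') (h := h) (by rwa [M.comp_step pl hstep])
  have hprop := Measure.ae_ae_of_ae_comp hproper
  have hind := ae_indepFun_of_isCondIndep hci
  -- The weight depends on the old history only, so it is a fixed matrix during the episode.
  set W : T → Matrix (Fin d) (Fin d) ℝ := fun t =>
    (1 + ((k : ℝ) + 1) • covMat (marginal (post t) h))⁻¹ with hWdef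
  have hWm : ∀ i j, Measurable fun t => W t i j := measurable_inv_apply
    (measurable_one_add_smul_apply (measurable_covMat_marginal post h) _)
  have hW : ∀ᵐ t ∂m, (W t).PosSemidef := by
    filter_upwards [hmem] with t ht
    exact posSemidef_resolvent (posSemidef_covMat (memLp_marginal ht)) (by positivity)
  have hfst : m'.map Prod.fst = m := by
    refine Measure.ext_of_lintegral _ fun f hf => ?_
    rw [lintegral_map hf measurable_fst, M.lintegral_fst_step pl hstep hf]
  have hmem1 : ∀ᵐ q ∂m', MemLp (fun Θ : Param H d => Θ h) 2 (post q.1) := by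
    rw [← hfst] at hmem
    exact ae_of_ae_map measurable_fst.aemeasurable hmem
  set V : ENNReal := ∫⁻ t, ENNReal.ofReal (W t * covMat (marginal (post t) h)).trace ∂m with hV
  have htr : Measurable fun t => ENNReal.ofReal (W t * covMat (marginal (post t) h)).trace :=
    (measurable_trace_mul hWm (measurable_covMat_marginal post h)).ennreal_ofReal
  -- The common term (k+1)V is cancelled at the end, which in `ENNReal` requires it to be finite.
  have hVfin : ((k : ENNReal) + 1) * V ≠ ⊤ := by
    have : ((k : ENNReal) + 1) * V ≤ d := by
      rw [hV, ← lintegral_const_mul _ htr]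
      calc _ ≤ ∫⁻ _t, (d : ENNReal) ∂m := by
            refine lintegral_mono_ae ?_
            filter_upwards [hmem] with t ht
            have h1 := trace_resolvent_mul_le (posSemidef_covMat (memLp_marginal ht))
              (by positivity : (0 : ℝ) ≤ (k : ℝ) + 1)
            rw [Fintype.card_fin] at h1
            have h2 := ENNReal.ofReal_le_ofReal h1
            rw [ENNReal.ofReal_mul (by positivity), ENNReal.ofReal_natCast,
              ENNReal.ofReal_add (by positivity) zero_le_one, ENNReal.ofReal_natCast,
              ENNReal.ofReal_one] at h2
            exact h2
        _ = d := by simp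
    exact ne_top_of_le_ne_top (ENNReal.natCast_ne_top d) this
  set V' : ENNReal := ∫⁻ q, ENNReal.ofReal (W q.1 * covMat (marginal (post' q) h)).trace ∂m'
  have h1 : (k : ENNReal) * V' + 2⁻¹ * ∫⁻ t, M.expPredVar pl (post t) h ∂m ≤ (k + 1) * V := by
    have h2 := M.lintegral_trace_step_le pl hstep hci hmoment hWm hW
    refine (add_le_add_left (mul_le_mul_right h2 _) _).trans ?_
    rw [← lintegral_const_mul' _ _ (ENNReal.natCast_ne_top k),
      ← lintegral_const_mul' _ _ (by simp), hV, ← lintegral_const_mul _ htr]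
    refine (le_lintegral_add _ _).trans (lintegral_mono_ae ?_)
    filter_upwards [hmem, hprop, hind] with t ht hp hi
    exact M.lintegral_sqError_add_expPredVar_le pl hM hp ht hi k
  have h2 : ∫⁻ q, logDet k (post' q) h ∂m' + (k + 1) * V ≤
      ∫⁻ t, logDet (k + 1) (post t) h ∂m + k * V' := by
    rw [hV, ← lintegral_const_mul _ htr, ← M.lintegral_fst_step pl hstep (htr.const_mul _),
      ← M.lintegral_fst_step pl hstep (measurable_logDet post _ h),
      ← lintegral_const_mul' _ _ (ENNReal.natCast_ne_top k),
      ← lintegral_add_left (f := fun q : T × Obs S A H => logDet ((k : ℝ) + 1) (post q.1) h)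
        ((measurable_logDet post _ h).comp measurable_fst)]
    refine (le_lintegral_add _ _).trans (lintegral_mono_ae ?_)
    filter_upwards [hmem1, hmem'] with q hq hq'
    exact logDet_add_le hq hq' k
  refine (ENNReal.add_le_add_iff_right hVfin).1 ?_
  calc _ = (∫⁻ q, logDet k (post' q) h ∂m' + (k + 1) * V) +
        2⁻¹ * ∫⁻ t, M.expPredVar pl (post t) h ∂m := by ring
    _ ≤ (∫⁻ t, logDet (k + 1) (post t) h ∂m + k * V') +
        2⁻¹ * ∫⁻ t, M.expPredVar pl (post t) h ∂m := by gcongr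
    _ = ∫⁻ t, logDet (k + 1) (post t) h ∂m +
        (k * V' + 2⁻¹ * ∫⁻ t, M.expPredVar pl (post t) h ∂m) := by ring
    _ ≤ _ := by gcongr

end Step

end Model

end LinearMixture

/-! ### The sequence of histories and posteriors of posterior sampling. -/

namespace LinearMixture

open Matrix

variable {S A : Type*} [MeasurableSpace S] [MeasurableSpace A] {H d : ℕ}

/-- The last episode of a history, and the history before it. -/
def splitHist {ℓ : ℕ} (t : Hist S A H (ℓ + 1)) : Hist S A H ℓ × Obs S A H :=
  (Fin.init t, t (Fin.last ℓ))

lemma measurable_splitHist {ℓ : ℕ} :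
    Measurable (splitHist : Hist S A H (ℓ + 1) → Hist S A H ℓ × Obs S A H) := by
  unfold splitHist Fin.init
  fun_prop

/-- Append an episode to a history. -/
def snocHist {ℓ : ℕ} (q : Hist S A H ℓ × Obs S A H) : Hist S A H (ℓ + 1) :=
  Fin.snoc (α := fun _ => Obs S A H) q.1 q.2

lemma measurable_snocHist' {ℓ : ℕ} :
    Measurable (snocHist : Hist S A H ℓ × Obs S A H → Hist S A H (ℓ + 1)) := measurable_snocHist

omit [MeasurableSpace S] [MeasurableSpace A] in
lemma splitHist_snocHist {ℓ : ℕ} (q : Hist S A H ℓ × Obs S A H) : splitHist (snocHist q) = q := by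
  simp [splitHist, snocHist]

omit [MeasurableSpace S] [MeasurableSpace A] in
lemma snocHist_splitHist {ℓ : ℕ} (t : Hist S A H (ℓ + 1)) : snocHist (splitHist t) = t :=
  Fin.snoc_init_self t

section Sequence

variable (M : Model S A H d) (pl : Planner S A H d) (prior : Measure (Param H d))
  [IsProbabilityMeasure prior]

/-- The law of the history of the first `ℓ` episodes. -/
def histLaw (ℓ : ℕ) : Measure (Hist S A H ℓ) := psrlHist M pl prior ℓ ∘ₘ prior

instance (ℓ : ℕ) : IsProbabilityMeasure (histLaw M pl prior ℓ) := by
  unfold histLaw; infer_instance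

lemma psrlPosterior_comp_histLaw (ℓ : ℕ) :
    psrlPosterior M pl prior ℓ ∘ₘ histLaw M pl prior ℓ = prior :=
  posterior_comp_self

lemma lintegral_histLaw_compProd (ℓ : ℕ) {f : Hist S A H ℓ × Param H d → ENNReal}
    (hf : Measurable f) :
    ∫⁻ q, f q ∂(histLaw M pl prior ℓ ⊗ₘ psrlPosterior M pl prior ℓ) =
      ∫⁻ Θ, ∫⁻ t, f (t, Θ) ∂(psrlHist M pl prior ℓ Θ) ∂prior := by
  rw [histLaw, psrlPosterior, compProd_posterior_eq_map_swap, lintegral_map hf measurable_swap,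
    Measure.lintegral_compProd (by fun_prop)]
  rfl

lemma lintegral_psrlHist_succ (ℓ : ℕ) {f : Hist S A H (ℓ + 1) → ENNReal} (hf : Measurable f)
    (Θ : Param H d) :
    ∫⁻ t, f t ∂(psrlHist M pl prior (ℓ + 1) Θ) =
      ∫⁻ t, ∫⁻ Θ', ∫⁻ o, f (snocHist (t, o)) ∂(M.obsKernel pl H le_rfl (Θ, Θ'))
        ∂(psrlPosterior M pl prior ℓ t) ∂(psrlHist M pl prior ℓ Θ) := by
  have e : psrlHist M pl prior (ℓ + 1) =
      ((psrlHist M pl prior ℓ) ⊗ₖ (M.obsKernel pl H le_rfl ∘ₖ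
        (Kernel.id ∥ₖ psrlPosterior M pl prior ℓ))).map snocHist := rfl
  have hg := measurable_snocHist' (S := S) (A := A) (H := H) (ℓ := ℓ)
  have hfg := hf.comp hg
  simp only [Function.comp_def] at hfg
  rw [e, Kernel.map_apply _ hg, lintegral_map hf hg, Kernel.lintegral_compProd _ _ _ hfg]
  refine lintegral_congr fun t => ?_
  have h1 : Measurable fun o => f (snocHist (t, o)) := hf.comp (hg.comp measurable_prodMk_left)
  rw [Kernel.lintegral_comp _ _ _ h1, Kernel.parallelComp_apply, Kernel.id_apply,
    Measure.dirac_prod, lintegral_map h1.lintegral_kernel measurable_prodMk_left]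

lemma lintegral_map_splitHist_compProd (ℓ : ℕ)
    {f : (Hist S A H ℓ × Obs S A H) × Param H d → ENNReal} (hf : Measurable f) :
    ∫⁻ q, f q ∂(((histLaw M pl prior (ℓ + 1)).map splitHist) ⊗ₘ
        (psrlPosterior M pl prior (ℓ + 1)).comap snocHist measurable_snocHist') =
      ∫⁻ q, f (splitHist q.1, q.2)
        ∂(histLaw M pl prior (ℓ + 1) ⊗ₘ psrlPosterior M pl prior (ℓ + 1)) := by
  have hs := measurable_splitHist (S := S) (A := A) (H := H) (ℓ := ℓ)
  have hF : Measurable fun q : Hist S A H ℓ × Obs S A H =>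
      ∫⁻ Θ, f (q, Θ) ∂(psrlPosterior M pl prior (ℓ + 1) (snocHist q)) :=
    hf.lintegral_kernel_prod_right'
      (κ := (psrlPosterior M pl prior (ℓ + 1)).comap snocHist measurable_snocHist')
  have := Measure.isProbabilityMeasure_map (μ := histLaw M pl prior (ℓ + 1)) hs.aemeasurable
  rw [Measure.lintegral_compProd hf, Measure.lintegral_compProd (by fun_prop)]
  simp only [Kernel.comap_apply]
  rw [lintegral_map hF hs]
  simp only [snocHist_splitHist]

/-- Bayes' rule is used twice. It first exposes Θ as a prior draw, so that the new episode can be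
unfolded. It then turns Θ back into a draw from the old posterior, independent of the planning
parameter. -/
lemma step_histLaw (ℓ : ℕ) :
    ((histLaw M pl prior (ℓ + 1)).map splitHist) ⊗ₘ
        (psrlPosterior M pl prior (ℓ + 1)).comap snocHist measurable_snocHist' =
      M.stepLaw pl (histLaw M pl prior ℓ) (psrlPosterior M pl prior ℓ) := by
  have hs := measurable_splitHist (S := S) (A := A) (H := H) (ℓ := ℓ)
  refine Measure.ext_of_lintegral _ fun f hf => ?_
  rw [lintegral_map_splitHist_compProd _ _ _ _ hf, M.lintegral_stepLaw pl _ _ hf,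
    lintegral_histLaw_compProd _ _ _ _ (by fun_prop)]
  have h1 : Measurable fun q : (Hist S A H ℓ × Param H d × Param H d) =>
      ∫⁻ o, f ((q.1, o), q.2.1) ∂(M.obsKernel pl H le_rfl q.2) :=
    Measurable.lintegral_kernel_prod_right'
      (κ := (M.obsKernel pl H le_rfl).comap
        (Prod.snd : Hist S A H ℓ × Param H d × Param H d → _) measurable_snd)
      (f := fun q : (Hist S A H ℓ × Param H d × Param H d) × Obs S A H =>
        f ((q.1.1, q.2), q.1.2.1)) (by fun_prop)
  have h2 : Measurable fun q : Hist S A H ℓ × Param H d =>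
      ∫⁻ Θ', ∫⁻ o, f ((q.1, o), q.2) ∂(M.obsKernel pl H le_rfl (q.2, Θ'))
        ∂(psrlPosterior M pl prior ℓ q.1) :=
    Measurable.lintegral_kernel_prod_right'
      (κ := (psrlPosterior M pl prior ℓ).comap
        (Prod.fst : Hist S A H ℓ × Param H d → _) measurable_fst)
      (f := fun q : (Hist S A H ℓ × Param H d) × Param H d =>
        ∫⁻ o, f ((q.1.1, o), q.1.2) ∂(M.obsKernel pl H le_rfl (q.1.2, q.2)))
      (h1.comp (f := fun q : (Hist S A H ℓ × Param H d) × Param H d =>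
        (q.1.1, q.1.2, q.2)) (by fun_prop))
  calc _ = ∫⁻ Θ, ∫⁻ t, ∫⁻ Θ', ∫⁻ o, f ((t, o), Θ) ∂(M.obsKernel pl H le_rfl (Θ, Θ'))
        ∂(psrlPosterior M pl prior ℓ t) ∂(psrlHist M pl prior ℓ Θ) ∂prior := by
        refine lintegral_congr fun Θ => ?_
        rw [lintegral_psrlHist_succ _ _ _ _ (f := fun t => f (splitHist t, Θ)) (by fun_prop)]
        simp only [splitHist_snocHist]
    _ = _ := by
        rw [← lintegral_histLaw_compProd _ _ _ _ h2, Measure.lintegral_compProd h2]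
        refine lintegral_congr fun t => ?_
        have h3 := h1.comp (measurable_prodMk_left (x := t))
        simp only [Function.comp_def] at h3
        rw [lintegral_prod _ h3.aemeasurable]

omit [IsProbabilityMeasure prior] in
lemma indepFun_erase (hindep : iIndepFun (fun (h : Fin H) (Θ : Param H d) => Θ h) prior)
    (h : Fin H) : IndepFun (fun Θ : Param H d => Θ h) (Param.erase h) prior := by
  classical
  have h1 := hindep.indepFun_finset {h} {h}ᶜ (by simp) fun i => measurable_pi_apply i
  have hφ : Measurable fun g : ({h} : Finset (Fin H)) → EuclideanSpace ℝ (Fin d) =>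
    g ⟨h, by simp⟩ := measurable_pi_apply _
  have hψ : Measurable fun (g : ({h}ᶜ : Finset (Fin H)) → EuclideanSpace ℝ (Fin d)) (i : Fin H) =>
      if hi : i ∈ ({h}ᶜ : Finset (Fin H)) then g ⟨i, hi⟩ else (0 : EuclideanSpace ℝ (Fin d)) :=
    measurable_pi_lambda _ fun i => by
      split_ifs
      exacts [measurable_pi_apply _, measurable_const]
  have h2 := h1.comp hφ hψ
  have e : (Param.erase h : Param H d → Param H d) = fun Θ i =>
      if i ∈ ({h}ᶜ : Finset (Fin H)) then Θ i else 0 := by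
    funext Θ i
    by_cases hi : i = h
    · subst hi
      simp [Param.erase]
    · simp [hi, Param.erase_of_ne hi]
  rw [e]
  exact h2

/-- The empty history carries no information, and the independent components of the prior supply the
product law. -/
lemma isCondIndep_histLaw_zero
    (hindep : iIndepFun (fun (h : Fin H) (Θ : Param H d) => Θ h) prior) (h : Fin H) :
    IsCondIndep ((histLaw M pl prior 0 ⊗ₘ psrlPosterior M pl prior 0).map
      fun p => (p.1, p.2 h, Param.erase h p.2)) := by
  have her := Param.measurable_erase (d := d) h
  have hpr := Measure.isProbabilityMeasure_map (μ := prior) her.aemeasurable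
  have hind := indepFun_erase prior hindep h
  rw [indepFun_iff_map_prod_eq_prod_map_map (measurable_pi_apply h).aemeasurable
    her.aemeasurable] at hind
  refine ⟨Measure.dirac Fin.elim0, Kernel.const _ (marginal prior h),
    Kernel.const _ (prior.map (Param.erase h)), inferInstance, inferInstance, inferInstance,
    Measure.ext_of_lintegral _ fun f hf => ?_⟩
  have e : ∀ Θ, psrlHist M pl prior 0 Θ = Measure.dirac Fin.elim0 := fun Θ => rfl
  rw [lintegral_map hf (by fun_prop), lintegral_histLaw_compProd _ _ _ _ (by fun_prop),
    Measure.lintegral_compProd hf, lintegral_dirac' _ hf.lintegral_kernel_prod_right',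
    Kernel.prod_apply, Kernel.const_apply, Kernel.const_apply, marginal, ← hind,
    lintegral_map (by fun_prop) (by fun_prop)]
  refine lintegral_congr fun Θ => ?_
  rw [e, lintegral_dirac' _ (by fun_prop)]

/-- Under the posterior, `θ_h` is independent of the other components. -/
lemma isCondIndep_histLaw (hindep : iIndepFun (fun (h : Fin H) (Θ : Param H d) => Θ h) prior)
    (h : Fin H) (ℓ : ℕ) :
    IsCondIndep ((histLaw M pl prior ℓ ⊗ₘ psrlPosterior M pl prior ℓ).map
      fun p => (p.1, p.2 h, Param.erase h p.2)) := by
  have her := Param.measurable_erase (d := d) h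
  induction ℓ with
  | zero => exact isCondIndep_histLaw_zero M pl prior hindep h
  | succ ℓ ih =>
    have hs := measurable_splitHist (S := S) (A := A) (H := H) (ℓ := ℓ)
    have hsn := measurable_snocHist' (S := S) (A := A) (H := H) (ℓ := ℓ)
    have h1 := (M.isCondIndep_step pl (step_histLaw M pl prior ℓ) ih).map_left hsn hs
      splitHist_snocHist
    convert h1 using 1
    refine Measure.ext_of_lintegral _ fun f hf => ?_
    rw [lintegral_map hf (by fun_prop), lintegral_map hf (by fun_prop),
      lintegral_map (by fun_prop) (by fun_prop),
      lintegral_map_splitHist_compProd _ _ _ _ (by fun_prop)]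
    simp only [snocHist_splitHist]

end Sequence

end LinearMixture

/-! ### Optimization over ε, and summation of the potential over the episodes. -/

namespace LinearMixture

open Matrix

variable {S A : Type*} [MeasurableSpace S] [MeasurableSpace A] {H d : ℕ}

lemma le_two_mul_sqrt_of_forall {x a b : ℝ} (ha : 0 ≤ a) (hb : 0 ≤ b)
    (h : ∀ ε, 0 < ε → x ≤ ε * a + b / ε) : x ≤ 2 * Real.sqrt (a * b) := by
  by_contra! hx
  have h0 := Real.sqrt_nonneg (a * b)
  have hx0 : 0 < x := by linarith
  have hab : 4 * (a * b) < x ^ 2 := by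
    have := Real.sq_sqrt (mul_nonneg ha hb)
    nlinarith
  rcases ha.eq_or_lt with rfl | ha
  · have h1 := h (2 * b / x + 1) (by positivity)
    rw [mul_zero, zero_add, le_div_iff₀ (by positivity)] at h1
    have : x * (2 * b / x + 1) = 2 * b + x := by field_simp
    linarith
  · have h1 := h (x / (2 * a)) (by positivity)
    have h2 : x / (2 * a) * a = x / 2 := by field_simp
    have h3 : b / (x / (2 * a)) = 2 * (a * b) / x := by field_simp
    have h4 : 2 * (a * b) / x < x / 2 := by
      rw [div_lt_div_iff₀ hx0 two_pos]
      nlinarith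
    linarith

/-- Reversing the stages gives the sum of j² over j < H. The induction step needs only 2n² ≤ 3n² +
3n + 1. -/
lemma sum_scale_sq_le (H : ℕ) : 2 * ∑ h : Fin H, Model.scale h ^ 2 ≤ (H : ℝ) ^ 3 := by
  have h1 : ∑ h : Fin H, Model.scale h ^ 2 = ∑ j ∈ Finset.range H, (j : ℝ) ^ 2 := by
    rw [← Finset.sum_range_reflect, Finset.sum_range]
    refine Finset.sum_congr rfl fun h _ => ?_
    rw [Model.scale, Nat.sub_sub, Nat.add_comm 1]
  have h2 : ∀ n : ℕ, 2 * ∑ j ∈ Finset.range n, (j : ℝ) ^ 2 ≤ (n : ℝ) ^ 3 := by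
    intro n
    induction n with
    | zero => simp
    | succ n ih =>
      rw [Finset.sum_range_succ]
      push_cast
      have : (0 : ℝ) ≤ n := Nat.cast_nonneg n
      nlinarith
  rw [h1]
  exact h2 H

lemma covMat_marginal_eq_priorCov (prior : Measure (Param H d)) (h : Fin H) :
    covMat (marginal prior h) = priorCov prior h := by
  have hm : AEMeasurable (fun Θ : Param H d => Θ h) prior := (measurable_pi_apply h).aemeasurable
  have hmean : ∀ i, meanVec (marginal prior h) i = ∫ Θ, Θ h i ∂prior := fun i => by
    rw [meanVec, marginal, integral_map hm (Measurable.aestronglyMeasurable (by fun_prop))]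
  ext i j
  rw [covMat, of_apply, hmean, hmean, marginal, integral_map hm
    (Measurable.aestronglyMeasurable (by fun_prop))]
  rfl

section Regret

variable (M : Model S A H d) (pl : Planner S A H d) (prior : Measure (Param H d))
  [IsProbabilityMeasure prior]

lemma lintegral_logDet_histLaw_le (hM : M.BoundedFeatures)
    (hproper : ∀ᵐ Θ ∂prior, M.IsProper Θ)
    (hmoment : ∀ h : Fin H, MemLp (fun Θ : Param H d => Θ h) 2 prior)
    (hindep : iIndepFun (fun (h : Fin H) (Θ : Param H d) => Θ h) prior) (h : Fin H) (k ℓ : ℕ) :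
    ∫⁻ t, logDet k (psrlPosterior M pl prior (ℓ + 1) t) h ∂(histLaw M pl prior (ℓ + 1)) +
        2⁻¹ * ∫⁻ t, M.expPredVar pl (psrlPosterior M pl prior ℓ t) h ∂(histLaw M pl prior ℓ) ≤
      ∫⁻ t, logDet (k + 1) (psrlPosterior M pl prior ℓ t) h ∂(histLaw M pl prior ℓ) := by
  have hs := measurable_splitHist (S := S) (A := A) (H := H) (ℓ := ℓ)
  have hpr := Measure.isProbabilityMeasure_map (μ := histLaw M pl prior (ℓ + 1)) hs.aemeasurable
  have h1 := M.lintegral_logDet_step_le pl hM (step_histLaw M pl prior ℓ)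
    (isCondIndep_histLaw M pl prior hindep h ℓ)
    (by rwa [psrlPosterior_comp_histLaw]) (by rw [psrlPosterior_comp_histLaw]; exact hmoment h) k
  rw [lintegral_map (measurable_logDet _ _ _) hs] at h1
  simpa only [Kernel.comap_apply, snocHist_splitHist] using h1

/-- The law of the empty history does not depend on the parameter, so the constant kernel satisfies
Bayes' rule; posteriors are unique up to null sets. -/
lemma psrlPosterior_zero_ae :
    ∀ᵐ t ∂(histLaw M pl prior 0), psrlPosterior M pl prior 0 t = prior := by
  have h1 : Kernel.const (Hist S A H 0) prior =ᵐ[histLaw M pl prior 0]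
      psrlPosterior M pl prior 0 := by
    refine ae_eq_posterior_of_compProd_eq (Measure.ext_of_lintegral _ fun f hf => ?_)
    have e : psrlHist M pl prior 0 = Kernel.const _ (Measure.dirac Fin.elim0) := rfl
    rw [lintegral_map hf measurable_swap, Measure.lintegral_compProd hf,
      Measure.lintegral_compProd (by fun_prop), e, Measure.const_comp]
    simp only [Kernel.const_apply, measure_univ, one_smul]
    rw [lintegral_dirac' _ (by fun_prop)]
    refine lintegral_congr fun Θ => ?_
    rw [lintegral_dirac' _ (by fun_prop)]
    rfl
  filter_upwards [h1] with t ht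
  rw [← ht, Kernel.const_apply]

/-- Half of the total expected prediction variance is at most the log-determinant of the prior
covariance. -/
lemma sum_expPredVar_le (hM : M.BoundedFeatures)
    (hproper : ∀ᵐ Θ ∂prior, M.IsProper Θ)
    (hmoment : ∀ h : Fin H, MemLp (fun Θ : Param H d => Θ h) 2 prior)
    (hindep : iIndepFun (fun (h : Fin H) (Θ : Param H d) => Θ h) prior) (h : Fin H) (L : ℕ) :
    2⁻¹ * ∑ ℓ ∈ Finset.range L,
        ∫⁻ t, M.expPredVar pl (psrlPosterior M pl prior ℓ t) h ∂(histLaw M pl prior ℓ) ≤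
      logDet L prior h := by
  -- The index k rises as n falls, so that k + n is constant along the telescoping. Taking n = L and
  -- k = 0 starts from log det(1 + LΓ) under the prior.
  have h1 : ∀ n k : ℕ,
      ∫⁻ t, logDet k (psrlPosterior M pl prior n t) h ∂(histLaw M pl prior n) +
        2⁻¹ * ∑ ℓ ∈ Finset.range n,
          ∫⁻ t, M.expPredVar pl (psrlPosterior M pl prior ℓ t) h ∂(histLaw M pl prior ℓ) ≤
      ∫⁻ t, logDet ((k + n : ℕ) : ℝ) (psrlPosterior M pl prior 0 t) h
        ∂(histLaw M pl prior 0) := by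
    intro n
    induction n with
    | zero => intro k; simp
    | succ n ih =>
      intro k
      have h2 := ih (k + 1)
      have h3 := lintegral_logDet_histLaw_le M pl prior hM hproper hmoment hindep h k n
      rw [Finset.sum_range_succ, mul_add, add_comm (2⁻¹ * _), ← add_assoc]
      rw [show k + 1 + n = k + (n + 1) by ring] at h2
      push_cast at h2 h3 ⊢
      exact (add_le_add_left h3 _).trans h2
  have h2 := h1 L 0
  rw [zero_add] at h2
  refine le_add_self.trans (h2.trans_eq ?_)
  calc _ = ∫⁻ _t, logDet L prior h ∂(histLaw M pl prior 0) := by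
        refine lintegral_congr_ae ?_
        filter_upwards [psrlPosterior_zero_ae M pl prior] with t ht
        rw [ht]
    _ = _ := by simp

end Regret

end LinearMixture

/-! ### From the prediction variances to the Bayesian regret. -/

namespace LinearMixture

open Matrix

variable {S A : Type*} [MeasurableSpace S] [MeasurableSpace A] {H d : ℕ}

section Regret

variable (M : Model S A H d) (pl : Planner S A H d) (prior : Measure (Param H d))
  [IsProbabilityMeasure prior]

/-- The value in `M(Θ)` of the policy planned for `Θ'`. -/
def planValue (p : Param H d × Param H d) : ℝ := M.value p.1 (pl.policy p.2)

lemma measurable_planValue : Measurable (planValue M pl) := by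
  refine (StronglyMeasurable.integral_kernel_prod_right' (κ := M.obsKernel pl H le_rfl)
    (f := fun q : (Param H d × Param H d) × Obs S A H => M.totalReward q.2) ?_).measurable
  exact ((M.measurable_partialReward H le_rfl).comp measurable_snd).stronglyMeasurable

lemma abs_planValue_le (p : Param H d × Param H d) : |planValue M pl p| ≤ H := by
  have := M.isProbabilityMeasure_obsLaw p.1 (pl.measurable_policy_apply p.2) H le_rfl
  have h1 : ‖∫ o, M.totalReward o ∂(M.obsLaw p.1 (pl.policy p.2) H le_rfl)‖ ≤
      (H : ℝ) * (M.obsLaw p.1 (pl.policy p.2) H le_rfl).real Set.univ :=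
    norm_integral_le_of_norm_le_const (ae_of_all _ fun o => M.abs_partialReward_le H le_rfl o)
  rw [probReal_univ, mul_one] at h1
  exact h1

lemma integrable_planValue_comp {X : Type*} [MeasurableSpace X] (μ : Measure X) [IsFiniteMeasure μ]
    {g : X → Param H d × Param H d} (hg : Measurable g) :
    Integrable (fun x => planValue M pl (g x)) μ :=
  Integrable.of_bound ((measurable_planValue M pl).comp hg).aestronglyMeasurable H
    (ae_of_all _ fun x => abs_planValue_le M pl (g x))

/-- The expected regret of the policy planned for a draw from `post t`, in `M(Θ)`. -/
def expRegret {T : Type*} [MeasurableSpace T] (post : Kernel T (Param H d)) (q : T × Param H d) :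
    ℝ :=
  ∫ Θ', (planValue M pl (q.2, q.2) - planValue M pl (q.2, Θ')) ∂(post q.1)

section

variable {T : Type*} [MeasurableSpace T] (post : Kernel T (Param H d)) [IsMarkovKernel post]

lemma measurable_expRegret : Measurable (expRegret M pl post) := by
  have hv := measurable_planValue M pl
  refine (StronglyMeasurable.integral_kernel_prod_right'
    (κ := post.comap (Prod.fst : T × Param H d → T) measurable_fst)
    (f := fun q : (T × Param H d) × Param H d =>
      planValue M pl (q.1.2, q.1.2) - planValue M pl (q.1.2, q.2)) ?_).measurable
  exact Measurable.stronglyMeasurable (by fun_prop)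

lemma abs_expRegret_le (q : T × Param H d) : |expRegret M pl post q| ≤ H + H := by
  have h1 : ‖∫ Θ', (planValue M pl (q.2, q.2) - planValue M pl (q.2, Θ')) ∂(post q.1)‖ ≤
      ((H : ℝ) + H) * (post q.1).real Set.univ :=
    norm_integral_le_of_norm_le_const (ae_of_all _ fun Θ' => (abs_sub _ _).trans
      (add_le_add (abs_planValue_le M pl _) (abs_planValue_le M pl _)))
  rw [probReal_univ, mul_one] at h1
  exact h1

lemma integrable_expRegret_comp {X : Type*} [MeasurableSpace X] (μ : Measure X) [IsFiniteMeasure μ]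
    {g : X → T × Param H d} (hg : Measurable g) :
    Integrable (fun x => expRegret M pl post (g x)) μ :=
  Integrable.of_bound ((measurable_expRegret M pl post).comp hg).aestronglyMeasurable (H + H)
    (ae_of_all _ fun x => abs_expRegret_le M pl post (g x))

lemma integrable_integral_expRegret {X : Type*} [MeasurableSpace X] (μ : Measure X)
    [IsFiniteMeasure μ] (K : Kernel X (T × Param H d)) [IsMarkovKernel K] :
    Integrable (fun x => ∫ q, expRegret M pl post q ∂(K x)) μ := by
  refine Integrable.of_bound (C := H + H) (StronglyMeasurable.integral_kernel_prod_right' (κ := K)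
    (f := fun q : X × (T × Param H d) => expRegret M pl post q.2)
    ((measurable_expRegret M pl post).comp measurable_snd).stronglyMeasurable).aestronglyMeasurable
    (ae_of_all _ fun x => ?_)
  have h1 : ‖∫ q, expRegret M pl post q ∂(K x)‖ ≤ ((H : ℝ) + H) * (K x).real Set.univ :=
    norm_integral_le_of_norm_le_const (ae_of_all _ fun q => abs_expRegret_le M pl post q)
  simpa using h1

end

/-- Posterior matching: given the history, the true and the planning parameter have the same
law, so that the regret is the difference of the values of one policy in two MDPs. -/
lemma integral_expRegret_eq {T : Type*} [MeasurableSpace T] (post : Kernel T (Param H d))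
    [IsMarkovKernel post] (t : T) :
    ∫ Θ, expRegret M pl post (t, Θ) ∂(post t) =
      ∫ p, (planValue M pl (p.2, p.2) - planValue M pl (p.1, p.2)) ∂((post t).prod (post t)) := by
  have hi : ∀ {g : Param H d × Param H d → Param H d × Param H d}, Measurable g →
      Integrable (fun p => planValue M pl (g p)) ((post t).prod (post t)) := fun hg =>
    integrable_planValue_comp M pl _ hg
  have h1 := integral_prod (μ := post t) (ν := post t)
    (f := fun p => planValue M pl (p.1, p.1) - planValue M pl (p.1, p.2))
    ((hi (by fun_prop)).sub (hi (by fun_prop)))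
  -- The swap replaces the optimal value term of the true parameter by that of the planning
  -- parameter.
  have h2 := integral_prod_swap (μ := post t) (ν := post t) (fun p => planValue M pl (p.1, p.1))
  simp only [expRegret]
  rw [← h1, integral_sub (hi (by fun_prop)) (hi (by fun_prop)),
    integral_sub (hi (by fun_prop)) (hi (by fun_prop)), ← h2]
  rfl

/-- Bayes' rule reverses the order of averaging: first the history from its marginal law, then the
true parameter from the posterior, as `integral_expRegret_eq` requires. -/
lemma psrlBayesRegret_eq (L : ℕ) :
    psrlBayesRegret M pl prior L = ∑ ℓ ∈ Finset.range L,
      ∫ t, ∫ Θ, expRegret M pl (psrlPosterior M pl prior ℓ) (t, Θ) ∂(psrlPosterior M pl prior ℓ t)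
        ∂(histLaw M pl prior ℓ) := by
  have e : psrlBayesRegret M pl prior L = ∫ Θ, ∑ ℓ ∈ Finset.range L,
      ∫ t, expRegret M pl (psrlPosterior M pl prior ℓ) (t, Θ) ∂(psrlHist M pl prior ℓ Θ)
        ∂prior := rfl
  rw [e, integral_finsetSum]
  · refine Finset.sum_congr rfl fun ℓ _ => ?_
    have hm := measurable_expRegret M pl (psrlPosterior M pl prior ℓ)
    have h1 := Measure.integral_compProd (μ := prior) (κ := psrlHist M pl prior ℓ)
      (integrable_expRegret_comp M pl (psrlPosterior M pl prior ℓ) _ measurable_swap)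
    have h2 := Measure.integral_compProd (μ := histLaw M pl prior ℓ)
      (κ := psrlPosterior M pl prior ℓ)
      (integrable_expRegret_comp M pl (psrlPosterior M pl prior ℓ) _ (g := fun q => q)
        measurable_id)
    have h3 : histLaw M pl prior ℓ ⊗ₘ psrlPosterior M pl prior ℓ =
      (prior ⊗ₘ psrlHist M pl prior ℓ).map Prod.swap := compProd_posterior_eq_map_swap
    rw [h3, integral_map measurable_swap.aemeasurable
      hm.aestronglyMeasurable] at h2
    exact h1.symm.trans h2
  · intro ℓ _
    have hg : Measurable fun q : Hist S A H ℓ × Param H d => q := measurable_id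
    have h1 := integrable_integral_expRegret M pl (psrlPosterior M pl prior ℓ) prior
      (psrlHist M pl prior ℓ ×ₖ Kernel.id)
    refine h1.congr (ae_of_all _ fun Θ => ?_)
    have hm := measurable_expRegret M pl (psrlPosterior M pl prior ℓ)
    dsimp only
    rw [Kernel.prod_apply, Kernel.id_apply, Measure.prod_dirac, integral_map
      (by fun_prop) hm.aestronglyMeasurable]

/-- Both draws are almost surely proper, so the simulation lemma applies pointwise; the decoupling
inequality then bounds each stage. -/
lemma integral_value_difference_le (hM : M.BoundedFeatures) {P : Measure (Param H d)}
    [IsProbabilityMeasure P] (hproper : ∀ᵐ Θ ∂P, M.IsProper Θ)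
    (hmoment : ∀ h : Fin H, MemLp (fun Θ : Param H d => Θ h) 2 P) {ε : ℝ} (hε : 0 < ε) :
    ∫ p, (planValue M pl (p.2, p.2) - planValue M pl (p.1, p.2)) ∂(P.prod P) ≤
      ∑ h : Fin H, (ε * d * Model.scale h ^ 2 + (M.expPredVar pl P h).toReal / (2 * ε)) := by
  have h1 := fun h => M.integral_stageGap_le pl hM hproper (hmoment h) hε
  have h2 : ∫ p, (planValue M pl (p.2, p.2) - planValue M pl (p.1, p.2)) ∂(P.prod P) =
      ∫ p, ∑ h : Fin H, M.stageGap pl h p ∂(P.prod P) := by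
    refine integral_congr_ae ?_
    filter_upwards [Measure.quasiMeasurePreserving_fst.ae hproper,
      Measure.quasiMeasurePreserving_snd.ae hproper] with p hp1 hp2
    exact M.value_sub_value pl hp1 hp2
  rw [h2, integral_finsetSum _ fun h _ => (h1 h).1]
  exact Finset.sum_le_sum fun h _ => (h1 h).2

/-- The same ε serves all episodes and stages, so that it can be optimized after the summation,
where only the total prediction variance is controlled. -/
lemma psrlBayesRegret_le_add (hM : M.BoundedFeatures)
    (hproper : ∀ᵐ Θ ∂prior, M.IsProper Θ)
    (hmoment : ∀ h : Fin H, MemLp (fun Θ : Param H d => Θ h) 2 prior)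
    (hindep : iIndepFun (fun (h : Fin H) (Θ : Param H d) => Θ h) prior) (L : ℕ) {ε : ℝ}
    (hε : 0 < ε) :
    psrlBayesRegret M pl prior L ≤ ε * (d * L * ∑ h : Fin H, Model.scale h ^ 2) +
      (∑ h : Fin H, Real.log (1 + (L : ℝ) • priorCov prior h).det) / ε := by
  set U : ℕ → Fin H → ENNReal := fun ℓ h =>
    ∫⁻ t, M.expPredVar pl (psrlPosterior M pl prior ℓ t) h ∂(histLaw M pl prior ℓ) with hU
  have hsum := fun h => sum_expPredVar_le M pl prior hM hproper hmoment hindep h L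
  -- Finiteness is read off from the potential bound, which is a real number.
  have hUfin : ∀ ℓ ∈ Finset.range L, ∀ h, U ℓ h ≠ ⊤ := by
    intro ℓ hℓ h hUt
    have h1 : 2⁻¹ * U ℓ h ≤ logDet L prior h := le_trans (mul_le_mul_right
      (Finset.single_le_sum (f := fun ℓ => U ℓ h) (fun _ _ => zero_le) hℓ) _) (hsum h)
    rw [hUt, ENNReal.mul_top (by simp)] at h1
    exact ENNReal.ofReal_ne_top (top_le_iff.1 h1)
  have hep : ∀ ℓ ∈ Finset.range L,
      ∫ t, ∫ Θ, expRegret M pl (psrlPosterior M pl prior ℓ) (t, Θ) ∂(psrlPosterior M pl prior ℓ t)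
        ∂(histLaw M pl prior ℓ) ≤
      ∑ h : Fin H, (ε * d * Model.scale h ^ 2 + (U ℓ h).toReal / (2 * ε)) := by
    intro ℓ hℓ
    have hmU := fun h => M.measurable_expPredVar (psrlPosterior M pl prior ℓ) pl h
    have hi : ∀ h, Integrable (fun t => ε * d * Model.scale h ^ 2 +
        (M.expPredVar pl (psrlPosterior M pl prior ℓ t) h).toReal / (2 * ε))
        (histLaw M pl prior ℓ) := fun h => (integrable_const _).add
      ((integrable_toReal_of_lintegral_ne_top (hmU h).aemeasurable (hUfin ℓ hℓ h)).div_const _)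
    have e : ∑ h : Fin H, (ε * d * Model.scale h ^ 2 + (U ℓ h).toReal / (2 * ε)) =
        ∫ t, ∑ h : Fin H, (ε * d * Model.scale h ^ 2 +
          (M.expPredVar pl (psrlPosterior M pl prior ℓ t) h).toReal / (2 * ε))
          ∂(histLaw M pl prior ℓ) := by
      rw [integral_finsetSum _ fun h _ => hi h]
      refine Finset.sum_congr rfl fun h _ => ?_
      rw [integral_add (integrable_const _) ((integrable_toReal_of_lintegral_ne_top
        (hmU h).aemeasurable (hUfin ℓ hℓ h)).div_const _), integral_div, integral_toReal
        (hmU h).aemeasurable (ae_lt_top (hmU h) (hUfin ℓ hℓ h)), integral_const]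
      simp [hU]
    rw [e]
    have hcomp := psrlPosterior_comp_histLaw M pl prior ℓ
    have hpr : ∀ᵐ t ∂(histLaw M pl prior ℓ), ∀ᵐ Θ ∂(psrlPosterior M pl prior ℓ t),
        M.IsProper Θ := Measure.ae_ae_of_ae_comp (by rwa [hcomp])
    have hmem : ∀ᵐ t ∂(histLaw M pl prior ℓ), ∀ h : Fin H,
        MemLp (fun Θ : Param H d => Θ h) 2 (psrlPosterior M pl prior ℓ t) :=
      ae_all_iff.2 fun h => ae_memLp_of_comp (by rw [hcomp]; exact hmoment h)
    refine integral_mono_ae ?_ (integrable_finsetSum _ fun h _ => hi h) ?_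
    · have h1 := integrable_integral_expRegret M pl (psrlPosterior M pl prior ℓ)
        (histLaw M pl prior ℓ) (Kernel.id ×ₖ psrlPosterior M pl prior ℓ)
      refine h1.congr (ae_of_all _ fun t => ?_)
      have hm := measurable_expRegret M pl (psrlPosterior M pl prior ℓ)
      dsimp only
      rw [Kernel.prod_apply, Kernel.id_apply, Measure.dirac_prod, integral_map
        (by fun_prop) hm.aestronglyMeasurable]
    · filter_upwards [hpr, hmem] with t hpr hmem
      rw [integral_expRegret_eq]
      exact integral_value_difference_le M pl hM hpr hmem hε
  have hlog : ∀ h, ∑ ℓ ∈ Finset.range L, (U ℓ h).toReal ≤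
      2 * Real.log (1 + (L : ℝ) • priorCov prior h).det := by
    intro h
    have h0 : 0 ≤ Real.log (1 + (L : ℝ) • priorCov prior h).det := by
      rw [← covMat_marginal_eq_priorCov]
      exact log_det_one_add_smul_nonneg (posSemidef_covMat (memLp_marginal (hmoment h)))
        (Nat.cast_nonneg L)
    have h1 := ENNReal.toReal_mono ENNReal.ofReal_ne_top (hsum h)
    rw [covMat_marginal_eq_priorCov, ENNReal.toReal_ofReal h0, ENNReal.toReal_mul,
      ENNReal.toReal_sum fun ℓ hℓ => hUfin ℓ hℓ h] at h1
    simp only [ENNReal.toReal_inv, ENNReal.toReal_ofNat] at h1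
    linarith
  rw [psrlBayesRegret_eq]
  refine (Finset.sum_le_sum hep).trans ?_
  rw [Finset.sum_comm]
  simp only [Finset.sum_add_distrib, Finset.sum_const, Finset.card_range, ← Finset.sum_div,
    nsmul_eq_mul, Finset.mul_sum]
  refine add_le_add (le_of_eq (Finset.sum_congr rfl fun h _ => by ring)) ?_
  -- The total prediction variance is at most twice the log-determinants, which cancels the 2 in the
  -- denominator 2ε.
  rw [div_le_div_iff₀ (by positivity) hε]
  have h3 : ∑ h : Fin H, ∑ ℓ ∈ Finset.range L, (U ℓ h).toReal ≤
      2 * ∑ h : Fin H, Real.log (1 + (L : ℝ) • priorCov prior h).det := by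
    rw [Finset.mul_sum]
    exact Finset.sum_le_sum fun h _ => hlog h
  nlinarith

end Regret

end LinearMixture

end

theorem mainTheorem1 {S A : Type*} [MeasurableSpace S] [MeasurableSpace A] {H d : ℕ}
    (M : LinearMixture.Model S A H d) (hM : M.BoundedFeatures)
    (prior : MeasureTheory.Measure (LinearMixture.Param H d))
    [MeasureTheory.IsProbabilityMeasure prior]
    (hproper : ∀ᵐ Θ ∂prior, M.IsProper Θ)
    (hmoment : ∀ h : Fin H,
      MeasureTheory.MemLp (fun Θ : LinearMixture.Param H d => Θ h) 2 prior)
    (hindep : ProbabilityTheory.iIndepFun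
      (fun (h : Fin H) (Θ : LinearMixture.Param H d) => Θ h) prior)
    (pl : LinearMixture.Planner S A H d)
    (hpl : ∀ᵐ Θ ∂prior, M.IsOptimal Θ (pl.policy Θ))
    (L : ℕ) :
    LinearMixture.psrlBayesRegret M pl prior L ≤
      Real.sqrt (2 * (d : ℝ) * (H : ℝ) ^ 3 * (L : ℝ) *
        ∑ h : Fin H, Real.log
          (Matrix.det (1 + (L : ℝ) • LinearMixture.priorCov prior h))) := by
  have hD : 0 ≤ ∑ h : Fin H, Real.log
      (Matrix.det (1 + (L : ℝ) • LinearMixture.priorCov prior h)) := by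
    refine Finset.sum_nonneg fun h _ => ?_
    rw [← LinearMixture.covMat_marginal_eq_priorCov]
    exact LinearMixture.log_det_one_add_smul_nonneg (LinearMixture.posSemidef_covMat
      (LinearMixture.memLp_marginal (hmoment h))) (Nat.cast_nonneg L)
  have hC := LinearMixture.sum_scale_sq_le H
  have hC0 : 0 ≤ ∑ h : Fin H, LinearMixture.Model.scale h ^ 2 :=
    Finset.sum_nonneg fun h _ => sq_nonneg _
  have h1 := LinearMixture.le_two_mul_sqrt_of_forall (by positivity) hD fun ε hε =>
    LinearMixture.psrlBayesRegret_le_add M pl prior hM hproper hmoment hindep L hε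
  refine h1.trans ?_
  -- The factor 2 enters the root as 4. One factor 2 is absorbed by 2 Σ (H-h-1)² ≤ H³, and the other
  -- is the constant 2 of the bound.
  rw [show (2 : ℝ) = Real.sqrt (2 ^ 2) by simp, ← Real.sqrt_mul (by positivity)]
  refine Real.sqrt_le_sqrt ?_
  have h2 := mul_le_mul_of_nonneg_right hC
    (by positivity : 0 ≤ 2 * ((d : ℝ) * L * ∑ h : Fin H, Real.log
      (Matrix.det (1 + (L : ℝ) • LinearMixture.priorCov prior h))))
  simp only [Real.sqrt_sq (zero_le_two : (0 : ℝ) ≤ 2)]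
  linarith
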